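/- Let $A$ and $B$ be trivially graded $C^*$-algebras, let $E$ be a trivially graded, countably generated right Hilbert $B$-module with a $*$-homomorphism $\pi\colon A\to\mathrm{End}_B(E)$ into the adjointable operators, let $\mathcal A\subset A$ be a separable dense $*$-subalgebra, and let $\mathcal D\colon \mathrm{Dom}\,\mathcal D\subset E\to E$ be a closed regular operator (closed, densely defined, $B$-linear, $\mathcal D^*$ densely defined, $1+\mathcal D^*\mathcal D$ with dense range). The real and imaginary parts $\mathrm{Re}\,\mathcal D$, $\mathrm{Im}\,\mathcal D$ are the closures of $\frac12(\mathcal D+\mathcal D^*)$ and $-\frac i2(\mathcal D-\mathcal D^*)$ on $\mathrm{Dom}\,\mathcal D\cap\mathrm{Dom}\,\mathcal D^*$; $\mathcal D_\pm$ are the closures of $\mathrm{Re}\,\mathcal D\pm\mathrm{Im}\,\mathcal D$ on $\mathrm{Dom}\,\mathrm{Re}\,\mathcal D\cap\mathrm{Dom}\,\mathrm{Im}\,\mathcal D$. On $E\oplus E$, graded with first summand even and second summand odd, and with $A$ acting by $\pi\oplus\pi$, put $$\tilde{\mathcal D}=\begin{pmatrix}0&\mathcal D_+\\ \mathcal D_-&0\end{pmatrix},\qquad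 \tilde{\mathcal D}_+=\begin{pmatrix}0&\mathcal D^*\\ \mathcal D&0\end{pmatrix},\qquad \tilde{\mathcal D}_-=\begin{pmatrix}0&\mathcal D\\ \mathcal D^*&0\end{pmatrix}.$$ Then the following are equivalent: 1. $(\mathcal A,E,\mathcal D)$ is an odd indefinite unbounded Kasparov $A$-$B$-module; 2. $\mathrm{Dom}\,\mathcal D\cap\mathrm{Dom}\,\mathcal D^*$ is a core for both $\mathcal D$ and $\mathcal D^*$, and $(\mathcal A,E\oplus E,\tilde{\mathcal D})$ is an indefinite unbounded Kasparov $A$-$B$-module; 3. $(\mathcal A,E\oplus E,\tilde{\mathcal D}_+,\tilde{\mathcal D}_-)$ is a pair of unbounded Kasparov $A$-$B$-modules. In particular, if $\mathrm{Dom}\,\mathcal D\cap\mathrm{Dom}\,\mathcal D^*$ is a core for both $\mathcal D$ and $\mathcal D^*$, then (1), (3) and "$(\mathcal A,E\oplus E,\tilde{\mathcal D})$ is an indefinite unbounded Kasparov $A$-$B$-module" are equivalent. Definitions. An operator is essentially self-adjoint on a subspace $\mathcal E$ of its domain if the closure of its restriction to $\mathcal E$ is self-adjoint. Regular self-adjoint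 operators $S,T$ form an *almost commuting* (*almost anti-commuting*) pair if there is a submodule $\mathcal E\subset\mathrm{Dom}\,T$ which is a core for $T$ such that for all $\mu\in\mathbb R\setminus\{0\}$ and $\xi\in\mathcal E$ one has $(S-i\mu)^{-1}\xi\in\mathrm{Dom}\,S\cap\mathrm{Dom}\,T$ and $T(S-i\mu)^{-1}\xi\in\mathrm{Dom}\,S$, and for all such $\mu$ the map $[S,T](S-i\mu)^{-1}\colon\mathcal E\to E$ (respectively $\{S,T\}(S-i\mu)^{-1}$) extends to an adjointable operator on $E$. $(\mathcal A,E,\mathcal D)$, with $E$ countably generated, $\mathcal A\subset A$ a separable dense $*$-subalgebra and $\mathcal D$ closed and regular, is an *odd indefinite unbounded Kasparov module* if for some subspace $\mathcal E\subset\mathrm{Dom}\,\mathcal D\cap\mathrm{Dom}\,\mathcal D^*$: (a) $\mathcal E$ is dense in $\mathrm{Dom}\,\mathcal D\cap\mathrm{Dom}\,\mathcal D^*$ for the norm of the inner product $(\phi|\psi)_{\mathcal D,\mathcal D^*}=(\phi|\psi)+(\mathcal D\phi|\mathcal D\psi)+(\mathcal D^*\phi|\mathcal D^*\psi)$, and is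 a core for $\mathcal D$ and for $\mathcal D^*$; (b) $\mathrm{Re}\,\mathcal D$ and $\mathrm{Im}\,\mathcal D$ are regular and essentially self-adjoint on $\mathcal E$; (c) $(\mathrm{Re}\,\mathcal D,\mathrm{Im}\,\mathcal D)$ is an almost commuting pair; (d) $\pi(\mathcal A)\mathcal E\subset\mathrm{Dom}\,\mathcal D\cap\mathrm{Dom}\,\mathcal D^*$, and $[\mathcal D,\pi(a)]$, $[\mathcal D^*,\pi(a)]$ are bounded on $\mathcal E$ for all $a\in\mathcal A$; (e) for all $a\in A$ the map $\pi(a)\colon\mathrm{Dom}\,\mathcal D\cap\mathrm{Dom}\,\mathcal D^*\to E$ is a compact operator of Hilbert modules, the domain carrying $(\cdot|\cdot)_{\mathcal D,\mathcal D^*}$. It is an *indefinite unbounded Kasparov module* if $E$ is $\mathbb Z_2$-graded, $\pi(A)$ is even, $\mathcal D$ is odd, and the same holds with "almost anti-commuting" in (c). It is an *unbounded Kasparov module* if $E$ is $\mathbb Z_2$-graded, $\pi(A)$ is even, $\mathcal D$ is odd, regular and self-adjoint, $\pi(a)$ preserves $\mathrm{Dom}\,\mathcal D$ and $[\mathcal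 D,\pi(a)]$ is bounded on it for all $a\in\mathcal A$, and (e) holds. $(\mathcal A,E,\mathcal D_1,\mathcal D_2)$ is a *pair of unbounded Kasparov modules* if $(\mathcal A,E,\mathcal D_1)$ and $(\mathcal A,E,\mathcal D_2)$ are unbounded Kasparov modules, there is a subspace $\mathcal E\subset\mathrm{Dom}\,\mathcal D_1\cap\mathrm{Dom}\,\mathcal D_2$ which is a common core for $\mathcal D_1,\mathcal D_2$, the operators $\mathcal D_1\pm\mathcal D_2$ (closures) are regular and essentially self-adjoint on $\mathcal E$, and $(\mathcal D_1+\mathcal D_2,\mathcal D_1-\mathcal D_2)$ is an almost anti-commuting pair. -/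

import Mathlib

/-!
Hilbert modules.  Mathlib's class `CStarModule R E` has an inner product which is conjugate linear
in the first variable, linear in the second, and satisfies `⟪x, r • y⟫ = r * ⟪x, y⟫`.  A *right*
Hilbert `B`-module is therefore a complete `CStarModule Bᵐᵒᵖ E`: the action `x · b` is
`MulOpposite.op b • x`, and `op ⟪x, y · b⟫ = op (⟪x, y⟫ b) = op b * op ⟪x, y⟫`.  The norm of `E` is
the Hilbert module norm.  All C⋆-algebras may be non-unital.
-/

open scoped WithCStarModule

noncomputable section

namespace HilbertModule

section Operators

variable (B : Type*) {E : Type*} [NonUnitalCStarAlgebra B] [PartialOrder B] [StarOrderedRing B]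
  [NormedAddCommGroup E] [NormedSpace ℂ E] [SMul Bᵐᵒᵖ E] [CStarModule Bᵐᵒᵖ E]

variable (E) in
/-- `E` is countably generated: for some countable set `s`, the span of `s · B` is dense in `E`. -/
def IsCountablyGenerated : Prop :=
  ∃ s : Set E, s.Countable ∧
    Dense (Submodule.span ℂ {y : E | ∃ x ∈ s, ∃ b : Bᵐᵒᵖ, y = b • x} : Set E)

/-- Membership in `End_B(E)`: the operator has an adjoint (it is then automatically bounded and
`B`-linear). -/
def IsAdjointable (T : E →ₗ[ℂ] E) : Prop :=
  ∃ T' : E →ₗ[ℂ] E, ∀ x y : E, inner Bᵐᵒᵖ (T x) y = inner Bᵐᵒᵖ x (T' y)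

/-- The pairs `(y, z)` with `⟪y, T x⟫ = ⟪z, x⟫` for all `x ∈ Dom T`. -/
def adjointGraph (T : E →ₗ.[ℂ] E) : Submodule ℂ (E × E) where
  carrier := {p | ∀ x : T.domain, inner Bᵐᵒᵖ p.1 (T x) = inner Bᵐᵒᵖ p.2 (x : E)}
  zero_mem' := by intro x; simp
  add_mem' := by
    intro p q hp hq x
    simp [hp x, hq x]
  smul_mem' := by
    intro c p hp x
    simp [hp x]

/-- The adjoint `T*` of a densely defined operator `T`: `y ∈ Dom T*` with `T* y = z` if and only if
`⟪y, T x⟫ = ⟪z, x⟫` for all `x ∈ Dom T`. -/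
def adj (T : E →ₗ.[ℂ] E) : E →ₗ.[ℂ] E := (adjointGraph B T).toLinearPMap

/-- A subspace of `E` is a `B`-submodule. -/
def IsBSubmodule (V : Submodule ℂ E) : Prop := ∀ (b : Bᵐᵒᵖ), ∀ x ∈ V, b • x ∈ V

/-- Regular operators: `B`-linear, closed, densely defined, with densely defined adjoint, and such
that `1 + T* T` has dense range. -/
structure IsRegular (T : E →ₗ.[ℂ] E) : Prop where
  map_smul : ∀ (b : Bᵐᵒᵖ) (x : T.domain), ∃ h : b • (x : E) ∈ T.domain, T ⟨b • (x : E), h⟩ = b • T x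
  closed : T.IsClosed
  dense_domain : Dense (T.domain : Set E)
  dense_adj_domain : Dense ((adj B T).domain : Set E)
  dense_range : Dense {z : E | ∃ (x : T.domain) (h : T x ∈ (adj B T).domain),
    z = (x : E) + adj B T ⟨T x, h⟩}

/-- `T` is densely defined and equal to its adjoint. -/
def IsSelfAdj (T : E →ₗ.[ℂ] E) : Prop := Dense (T.domain : Set E) ∧ adj B T = T

/-- `T` is essentially self-adjoint on `V`: the closure of the restriction of `T` to `V ⊆ Dom T` is
self-adjoint. -/
def IsEssSelfAdjOn (T : E →ₗ.[ℂ] E) (V : Submodule ℂ E) : Prop :=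
  V ≤ T.domain ∧ IsSelfAdj B (T.domRestrict V).closure

/-- The real part of `D`: the closure of `(D + D*) / 2` on `Dom D ∩ Dom D*`. -/
def rePart (D : E →ₗ.[ℂ] E) : E →ₗ.[ℂ] E := ((1 / 2 : ℂ) • (D + adj B D)).closure

/-- The imaginary part of `D`: the closure of `-(i / 2) (D - D*)` on `Dom D ∩ Dom D*`. -/
def imPart (D : E →ₗ.[ℂ] E) : E →ₗ.[ℂ] E := ((-(Complex.I / 2) : ℂ) • (D - adj B D)).closure

/-- The Wick rotation `D₊`: the closure of `Re D + Im D` on `Dom Re D ∩ Dom Im D`. -/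
def wickPlus (D : E →ₗ.[ℂ] E) : E →ₗ.[ℂ] E := (rePart B D + imPart B D).closure

/-- The Wick rotation `D₋`: the closure of `Re D - Im D` on `Dom Re D ∩ Dom Im D`. -/
def wickMinus (D : E →ₗ.[ℂ] E) : E →ₗ.[ℂ] E := (rePart B D - imPart B D).closure

/-- `(S, T)` is an almost commuting pair of regular self-adjoint operators: there is a submodule
`V ⊆ Dom T` which is a core for `T` such that, for all real `μ ≠ 0` and all `ξ ∈ V`, the vector
`η = (S - iμ)⁻¹ ξ` lies in `Dom S ∩ Dom T` and `T η ∈ Dom S`, and such that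
`[S, T] (S - iμ)⁻¹ : V → E` extends to some `C ∈ End_B(E)`.
(`S η = ξ + iμ η` is automatically in `Dom T`, and `η` is unique.) -/
structure IsAlmostCommuting (S T : E →ₗ.[ℂ] E) : Prop where
  regular_left : IsRegular B S
  selfAdj_left : IsSelfAdj B S
  regular_right : IsRegular B T
  selfAdj_right : IsSelfAdj B T
  bounded : ∃ V : Submodule ℂ E, IsBSubmodule B V ∧ T.HasCore V ∧
    ∀ μ : ℝ, μ ≠ 0 → ∃ C : E →ₗ[ℂ] E, IsAdjointable B C ∧
      ∀ ξ ∈ V, ∃ (η : E) (hS : η ∈ S.domain) (hT : η ∈ T.domain)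
        (hTS : T ⟨η, hT⟩ ∈ S.domain) (hST : S ⟨η, hS⟩ ∈ T.domain),
        S ⟨η, hS⟩ - (Complex.I * (μ : ℂ)) • η = ξ ∧
        C ξ = S ⟨T ⟨η, hT⟩, hTS⟩ - T ⟨S ⟨η, hS⟩, hST⟩

/-- `(S, T)` is an almost anti-commuting pair of regular self-adjoint operators: the same as
`IsAlmostCommuting`, with the anti-commutator `{S, T}` in place of the commutator `[S, T]`. -/
structure IsAlmostAntiCommuting (S T : E →ₗ.[ℂ] E) : Prop where
  regular_left : IsRegular B S
  selfAdj_left : IsSelfAdj B S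
  regular_right : IsRegular B T
  selfAdj_right : IsSelfAdj B T
  bounded : ∃ V : Submodule ℂ E, IsBSubmodule B V ∧ T.HasCore V ∧
    ∀ μ : ℝ, μ ≠ 0 → ∃ C : E →ₗ[ℂ] E, IsAdjointable B C ∧
      ∀ ξ ∈ V, ∃ (η : E) (hS : η ∈ S.domain) (hT : η ∈ T.domain)
        (hTS : T ⟨η, hT⟩ ∈ S.domain) (hST : S ⟨η, hS⟩ ∈ T.domain),
        S ⟨η, hS⟩ - (Complex.I * (μ : ℂ)) • η = ξ ∧
        C ξ = S ⟨T ⟨η, hT⟩, hTS⟩ + T ⟨S ⟨η, hS⟩, hST⟩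

/-- The inner product `⟪x, y⟫ + ⟪S x, S y⟫ + ⟪T x, T y⟫` on `Dom S ∩ Dom T`. -/
def graphInner (S T : E →ₗ.[ℂ] E) (x y : ↥(S.domain ⊓ T.domain)) : Bᵐᵒᵖ :=
  inner Bᵐᵒᵖ (x : E) (y : E)
    + inner Bᵐᵒᵖ (S ⟨x, x.2.1⟩) (S ⟨y, y.2.1⟩)
    + inner Bᵐᵒᵖ (T ⟨x, x.2.2⟩) (T ⟨y, y.2.2⟩)

/-- The norm of `Dom S ∩ Dom T` associated with `graphInner`. -/
def graphNorm (S T : E →ₗ.[ℂ] E) (x : ↥(S.domain ⊓ T.domain)) : ℝ := √‖graphInner B S T x x‖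

/-- `K : Dom S ∩ Dom T → E` is a compact operator of Hilbert modules, where `Dom S ∩ Dom T` carries
the inner product `graphInner`: it is a limit, in operator norm, of finite sums of rank one
operators `x ↦ e · ⟪w, x⟫`. -/
def IsCompactOnDomain (S T : E →ₗ.[ℂ] E) (K : ↥(S.domain ⊓ T.domain) →ₗ[ℂ] E) : Prop :=
  ∀ ε : ℝ, 0 < ε → ∃ (n : ℕ) (e : Fin n → E) (w : Fin n → ↥(S.domain ⊓ T.domain)),
    ∀ x : ↥(S.domain ⊓ T.domain),
      ‖K x - ∑ i, graphInner B S T (w i) x • e i‖ ≤ ε * graphNorm B S T x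

/-- `V ⊆ Dom D`, `a V ⊆ Dom D`, and the commutator `[D, a]` is bounded on `V`. -/
def HasBoundedCommutatorOn (D : E →ₗ.[ℂ] E) (a : E →ₗ[ℂ] E) (V : Submodule ℂ E) : Prop :=
  ∃ C : ℝ, ∀ x ∈ V, ∃ (h : x ∈ D.domain) (h' : a x ∈ D.domain),
    ‖D ⟨a x, h'⟩ - a (D ⟨x, h⟩)‖ ≤ C * ‖x‖

/-- A `ℤ₂`-grading of `E` (with `B` trivially graded), given by its grading operator: `γ` is `1` on
the even and `-1` on the odd summand. -/
structure IsGrading (γ : E →ₗ[ℂ] E) : Prop where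
  involutive : ∀ x, γ (γ x) = x
  map_smul : ∀ (b : Bᵐᵒᵖ) (x : E), γ (b • x) = b • γ x
  inner_map : ∀ x y : E, inner Bᵐᵒᵖ (γ x) (γ y) = inner Bᵐᵒᵖ x y

end Operators

/-- `D` is odd for the grading operator `γ`. -/
def IsOdd {E : Type*} [AddCommGroup E] [Module ℂ E] (γ : E →ₗ[ℂ] E) (D : E →ₗ.[ℂ] E) : Prop :=
  ∀ x : D.domain, ∃ h : γ x ∈ D.domain, D ⟨γ x, h⟩ = -γ (D x)

/-- A `*`-homomorphism `π : A → End_B(E)`: the operator `π a` has the adjoint `π a*`. -/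
structure Rep (A B E : Type*) [NonUnitalCStarAlgebra A]
    [NonUnitalCStarAlgebra B] [PartialOrder B] [StarOrderedRing B]
    [NormedAddCommGroup E] [NormedSpace ℂ E] [SMul Bᵐᵒᵖ E] [CStarModule Bᵐᵒᵖ E] where
  hom : A →ₙₐ[ℂ] Module.End ℂ E
  hom_star : ∀ (a : A) (x y : E), inner Bᵐᵒᵖ (hom a x) y = inner Bᵐᵒᵖ x (hom (star a) y)

section KasparovModules

variable {A B E : Type*} [NonUnitalCStarAlgebra A]
  [NonUnitalCStarAlgebra B] [PartialOrder B] [StarOrderedRing B]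
  [NormedAddCommGroup E] [NormedSpace ℂ E] [SMul Bᵐᵒᵖ E] [CStarModule Bᵐᵒᵖ E]

/-- The map `π(a) ∘ ι : Dom D ∩ Dom D* → E` is compact for all `a ∈ A`, where `Dom D ∩ Dom D*` is
a Hilbert module for the inner product `⟪x, y⟫ + ⟪D x, D y⟫ + ⟪D* x, D* y⟫`. -/
def IsLocallyCompact (π : Rep A B E) (D : E →ₗ.[ℂ] E) : Prop :=
  ∀ a : A, IsCompactOnDomain B D (adj B D)
    ((π.hom a).comp (D.domain ⊓ (adj B D).domain).subtype)

/-- The part of the definitions of Kasparov modules that does not involve the operator: `E` is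
countably generated and `𝒜` is a separable dense `*`-subalgebra of `A`. -/
structure IsBimoduleData (_π : Rep A B E) (𝒜 : NonUnitalStarSubalgebra ℂ A) : Prop where
  countablyGenerated : IsCountablyGenerated B E
  separable : TopologicalSpace.IsSeparable (𝒜 : Set A)
  dense : Dense (𝒜 : Set A)

/-- `V ⊆ Dom D ∩ Dom D*` is dense in `Dom D ∩ Dom D*` for the norm `graphNorm B D D*`, and it is a
core for both `D` and `D*`. -/
structure IsCommonCore (D : E →ₗ.[ℂ] E) (V : Submodule ℂ E) : Prop where
  le : V ≤ D.domain ⊓ (adj B D).domain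
  dense : ∀ (x : ↥(D.domain ⊓ (adj B D).domain)) (ε : ℝ), 0 < ε →
    ∃ v : ↥(D.domain ⊓ (adj B D).domain), (v : E) ∈ V ∧ graphNorm B D (adj B D) (x - v) < ε
  core : D.HasCore V
  core_adj : (adj B D).HasCore V

/-- `(𝒜, E, D)` is an odd indefinite unbounded Kasparov `A`-`B`-module. -/
structure IsOddIndefiniteKasparovModule (π : Rep A B E) (𝒜 : NonUnitalStarSubalgebra ℂ A)
    (D : E →ₗ.[ℂ] E) : Prop where
  data : IsBimoduleData π 𝒜
  regular : IsRegular B D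
  regular_re : IsRegular B (rePart B D)
  regular_im : IsRegular B (imPart B D)
  almostCommuting : IsAlmostCommuting B (rePart B D) (imPart B D)
  exists_core : ∃ V : Submodule ℂ E, IsCommonCore (B := B) D V ∧
    IsEssSelfAdjOn B (rePart B D) V ∧ IsEssSelfAdjOn B (imPart B D) V ∧
    ∀ a ∈ 𝒜, HasBoundedCommutatorOn D (π.hom a) V ∧ HasBoundedCommutatorOn (adj B D) (π.hom a) V
  locallyCompact : IsLocallyCompact π D

/-- `(𝒜, E, D)` is an (even) indefinite unbounded Kasparov `A`-`B`-module, where `E` is graded by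
`γ`, and `A` and `B` are trivially graded (so that `π` maps to even operators and graded commutators
with `π(a)` are commutators). -/
structure IsIndefiniteKasparovModule (γ : E →ₗ[ℂ] E) (π : Rep A B E)
    (𝒜 : NonUnitalStarSubalgebra ℂ A) (D : E →ₗ.[ℂ] E) : Prop where
  data : IsBimoduleData π 𝒜
  grading : IsGrading B γ
  even : ∀ (a : A) (x : E), γ (π.hom a x) = π.hom a (γ x)
  regular : IsRegular B D
  odd : IsOdd γ D
  regular_re : IsRegular B (rePart B D)
  regular_im : IsRegular B (imPart B D)
  almostAntiCommuting : IsAlmostAntiCommuting B (rePart B D) (imPart B D)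
  exists_core : ∃ V : Submodule ℂ E, IsCommonCore (B := B) D V ∧
    IsEssSelfAdjOn B (rePart B D) V ∧ IsEssSelfAdjOn B (imPart B D) V ∧
    ∀ a ∈ 𝒜, HasBoundedCommutatorOn D (π.hom a) V ∧ HasBoundedCommutatorOn (adj B D) (π.hom a) V
  locallyCompact : IsLocallyCompact π D

/-- `(𝒜, E, D)` is an (even) unbounded Kasparov `A`-`B`-module, where `E` is graded by `γ`, and `A`
and `B` are trivially graded: `D` is odd, regular and self-adjoint, `𝒜` preserves `Dom D` and has
bounded commutators with `D`, and `π(a) : Dom D → E` is compact for all `a ∈ A`. -/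
structure IsKasparovModule (γ : E →ₗ[ℂ] E) (π : Rep A B E)
    (𝒜 : NonUnitalStarSubalgebra ℂ A) (D : E →ₗ.[ℂ] E) : Prop where
  data : IsBimoduleData π 𝒜
  grading : IsGrading B γ
  even : ∀ (a : A) (x : E), γ (π.hom a x) = π.hom a (γ x)
  regular : IsRegular B D
  selfAdj : IsSelfAdj B D
  odd : IsOdd γ D
  boundedCommutator : ∀ a ∈ 𝒜, HasBoundedCommutatorOn D (π.hom a) D.domain
  locallyCompact : IsLocallyCompact π D

/-- `(𝒜, E, D₁, D₂)` is a pair of unbounded Kasparov `A`-`B`-modules.  The operators `D₁ ± D₂` are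
defined on `Dom D₁ ∩ Dom D₂`; where closedness is required, their closures are meant. -/
structure IsPairOfKasparovModules (γ : E →ₗ[ℂ] E) (π : Rep A B E)
    (𝒜 : NonUnitalStarSubalgebra ℂ A) (D₁ D₂ : E →ₗ.[ℂ] E) : Prop where
  left : IsKasparovModule γ π 𝒜 D₁
  right : IsKasparovModule γ π 𝒜 D₂
  regular_add : IsRegular B (D₁ + D₂).closure
  regular_sub : IsRegular B (D₁ - D₂).closure
  exists_core : ∃ V : Submodule ℂ E, V ≤ D₁.domain ⊓ D₂.domain ∧ D₁.HasCore V ∧ D₂.HasCore V ∧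
    IsEssSelfAdjOn B (D₁ + D₂) V ∧ IsEssSelfAdjOn B (D₁ - D₂) V
  almostAntiCommuting : IsAlmostAntiCommuting B (D₁ + D₂).closure (D₁ - D₂).closure

end KasparovModules

section Doubling

variable (B : Type*) {E : Type*} [NonUnitalCStarAlgebra B] [PartialOrder B] [StarOrderedRing B]
  [NormedAddCommGroup E] [NormedSpace ℂ E] [SMul Bᵐᵒᵖ E] [CStarModule Bᵐᵒᵖ E]

variable (E) in
/-- The Hilbert `B`-module direct sum `E ⊕ E`. -/
abbrev Sum₂ : Type _ := C⋆ᵐᵒᵈ(Bᵐᵒᵖ, E × E)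

/-- The operator `(x, y) ↦ (f x, g y)` on `E ⊕ E`. -/
def diag (f g : E →ₗ[ℂ] E) : Sum₂ B E →ₗ[ℂ] Sum₂ B E :=
  (WithCStarModule.linearEquiv ℂ Bᵐᵒᵖ (E × E)).symm.toLinearMap ∘ₗ (f.prodMap g) ∘ₗ
    (WithCStarModule.linearEquiv ℂ Bᵐᵒᵖ (E × E)).toLinearMap

variable (E) in
/-- The grading of `E ⊕ E` with even first summand and odd second summand. -/
def sumGrading : Sum₂ B E →ₗ[ℂ] Sum₂ B E := diag B LinearMap.id (-LinearMap.id)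

/-- The operator matrix `[[0, X], [Y, 0]]`, `(x, y) ↦ (X y, Y x)`, on `Dom Y ⊕ Dom X`. -/
def offDiag (X Y : E →ₗ.[ℂ] E) : Sum₂ B E →ₗ.[ℂ] Sum₂ B E where
  domain := (Y.domain.prod X.domain).comap
    (WithCStarModule.linearEquiv ℂ Bᵐᵒᵖ (E × E)).toLinearMap
  toFun :=
    { toFun := fun p => (WithCStarModule.equiv Bᵐᵒᵖ (E × E)).symm
        (X ⟨(WithCStarModule.equiv Bᵐᵒᵖ (E × E) p).2, p.2.2⟩,
          Y ⟨(WithCStarModule.equiv Bᵐᵒᵖ (E × E) p).1, p.2.1⟩)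
      map_add' := fun p q => by
        refine Prod.ext ?_ ?_
        · exact X.map_add ⟨_, p.2.2⟩ ⟨_, q.2.2⟩
        · exact Y.map_add ⟨_, p.2.1⟩ ⟨_, q.2.1⟩
      map_smul' := fun c p => by
        refine Prod.ext ?_ ?_
        · exact X.map_smul c ⟨_, p.2.2⟩
        · exact Y.map_smul c ⟨_, p.2.1⟩ }

variable {B} in
/-- The representation `π ⊕ π` of `A` on `E ⊕ E`. -/
def Rep.sum {A : Type*} [NonUnitalCStarAlgebra A] (π : Rep A B E) : Rep A B (Sum₂ B E) where
  hom :=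
    { toFun := fun a => diag B (π.hom a) (π.hom a)
      map_smul' := fun c a => by
        refine LinearMap.ext fun p => Prod.ext ?_ ?_
        · exact LinearMap.congr_fun (map_smul π.hom c a) p.1
        · exact LinearMap.congr_fun (map_smul π.hom c a) p.2
      map_zero' := by
        refine LinearMap.ext fun p => Prod.ext ?_ ?_
        · exact LinearMap.congr_fun (map_zero π.hom) p.1
        · exact LinearMap.congr_fun (map_zero π.hom) p.2
      map_add' := fun a b => by
        refine LinearMap.ext fun p => Prod.ext ?_ ?_
        · exact LinearMap.congr_fun (map_add π.hom a b) p.1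
        · exact LinearMap.congr_fun (map_add π.hom a b) p.2
      map_mul' := fun a b => by
        refine LinearMap.ext fun p => Prod.ext ?_ ?_
        · exact LinearMap.congr_fun (map_mul π.hom a b) p.1
        · exact LinearMap.congr_fun (map_mul π.hom a b) p.2 }
  hom_star := fun a x y => congrArg₂ (· + ·) (π.hom_star a x.1 y.1) (π.hom_star a x.2 y.2)

end Doubling

end HilbertModule

end

/-!
All three conditions are equivalent to `IsCartesianKasparov`: with `S = Re D` and `T = Im D` there is
a Cartesian decomposition `D = S + iT`, `D* = S - iT` with common domain `Dom S ∩ Dom T`, where `S` and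
`T` are self-adjoint, regular and almost commute (`IsCartesian`); moreover, the commutators of `D` and
`D*` with the algebra are bounded on this domain, and the representation is compact from this domain
to `E`. Unbounded operators are handled through their graphs, as linear relations on `E`, and both
kinds of pairs are treated at once as pairs with a twisted commutator `S T - σ T S` for `σ = ±1`.

*Estimates for twisted pairs.* The commutator extends from the core in the definition to a form on
`Dom S ∩ Dom T` which is of first order in `S` (`HasTwistedCommutator.exists_form_bound`); the resolvents
of `S` serve as smoothing operators. It is therefore of lower order in `⟪(S + cT) x, (S + cT) x⟫`, and
`S + cT` is closed on `Dom S ∩ Dom T`, for `c = ±i` if the pair almost commutes and for `c = ±1` if it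
almost anti-commutes (`HasTwistedCommutator.isClosed_relComb`). Hence an operator `D` for which
`Dom D ∩ Dom D*` is a core for `D` and `D*` has a Cartesian decomposition as soon as its real and
imaginary parts almost commute (`isCartesian_of_core`).

*Wick rotation.* For a Cartesian decomposition, the closures `D₊` and `D₋` of `S + T` and `S - T` are
self-adjoint and regular (`IsCartesian.isSelfAdjRegular_closure`). Here `S ± T` need not be closed, and
the proof is a version of Nelson's commutator theorem for Hilbert modules: since the commutator of
`S ± T` with `1 + D* D` is bounded by the latter as a form, the equation `(S ± T + iμ) x = z` can be
solved approximately by elliptic regularisation with `ε (1 + D* D)`. The operators `D` and `D*` are in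
turn linear combinations of `D₊` and `D₋` on `Dom D₊ ∩ Dom D₋ = Dom D`.

*Doubling.* The off-diagonal operators `[[0, S], [S, 0]]` and `[[0, -iT], [iT, 0]]` on `E ⊕ E` almost
anti-commute if and only if `S` and `T` almost commute (`HasTwistedCommutator.double`,
`hasTwistedCommutator_of_double`). Up to a factor, these are the sum and the difference of
`[[0, D*], [D, 0]]` and `[[0, D], [D*, 0]]`, as well as the real and imaginary parts of
`[[0, D₊], [D₋, 0]]`. If the indefinite module `[[0, D₊], [D₋, 0]]` is given, the latter identification
is not available at first, since it depends on the decomposition of `D`. It is obtained from the fact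
that, for an almost anti-commuting pair, `S ± T` are self-adjoint on `Dom S ∩ Dom T`, and self-adjoint
operators have no proper self-adjoint extensions (`isCartesian_of_double`).

*Commutators and compactness.* Bounded commutators pass from a core to the domain of a closed operator,
and to linear combinations. Compactness refers to the inner products on the domains, which differ for
`D`, for `D±`, and for the members of a pair. Hilbert modules have no Riesz theorem, so equivalence of
the norms does not suffice to compare them; `IsRegular.exists_riesz` shows that all of these inner
products represent the same functionals, by the method of continuity.
-/

open scoped WithCStarModule

noncomputable section

namespace HilbertModule

set_option linter.unusedSectionVars false

open Filter Topology

/-! ### Linear relations and their adjoints -/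

section Relations

variable (B : Type*) {E : Type*} [NonUnitalCStarAlgebra B] [PartialOrder B] [StarOrderedRing B]
  [NormedAddCommGroup E] [NormedSpace ℂ E] [SMul Bᵐᵒᵖ E] [CStarModule Bᵐᵒᵖ E]

local notation "⟪" x "," y "⟫" => inner Bᵐᵒᵖ x y

open CStarModule

/-- The adjoint of a linear relation `G ⊆ E × E`: the pairs `(y, z)` with `⟪y, Tx⟫ = ⟪z, x⟫` for all
`(x, Tx) ∈ G`. -/
def relAdj (G : Submodule ℂ (E × E)) : Submodule ℂ (E × E) where
  carrier := {p | ∀ q ∈ G, ⟪p.1, q.2⟫ = ⟪p.2, q.1⟫}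
  zero_mem' := by intro q _; simp
  add_mem' := by
    intro p q hp hq x hx
    simp [hp x hx, hq x hx]
  smul_mem' := by
    intro c p hp x hx
    simp [hp x hx]

/-- The restriction of a linear relation to a subspace. -/
def relRestrict (G : Submodule ℂ (E × E)) (V : Submodule ℂ E) : Submodule ℂ (E × E) :=
  G ⊓ V.comap (LinearMap.fst ℂ E E)

variable {B}

theorem mem_relAdj {G : Submodule ℂ (E × E)} {p : E × E} :
    p ∈ relAdj B G ↔ ∀ q ∈ G, ⟪p.1, q.2⟫ = ⟪p.2, q.1⟫ := Iff.rfl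

theorem mem_relRestrict {G : Submodule ℂ (E × E)} {V : Submodule ℂ E} {p : E × E} :
    p ∈ relRestrict G V ↔ p ∈ G ∧ p.1 ∈ V := Iff.rfl

theorem continuous_inner_left (y : E) : Continuous fun x : E => ⟪y, x⟫ :=
  (innerSL (A := Bᵐᵒᵖ) y).continuous

theorem continuous_inner_right (y : E) : Continuous fun x : E => ⟪x, y⟫ := by
  have h := continuous_star.comp (continuous_inner_left (B := B) y)
  exact h.congr fun x => by simp

theorem norm_inner_self_eq (x : E) : ‖⟪x, x⟫‖ = ‖x‖ ^ 2 := (norm_sq_eq Bᵐᵒᵖ).symm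

theorem norm_inner_le' (x y : E) : ‖⟪x, y⟫‖ ≤ ‖x‖ * ‖y‖ := norm_inner_le E

theorem inner_self_nonneg' (x : E) : 0 ≤ ⟪x, x⟫ := inner_self_nonneg

theorem inner_self_eq_zero' {x : E} (h : ⟪x, x⟫ = 0) : x = 0 := inner_self.1 h

/-- A sum of squares bounds each of its terms. -/
theorem norm_sq_le_of_inner_add (x : E) {a : Bᵐᵒᵖ} (ha : 0 ≤ a) :
    ‖x‖ ^ 2 ≤ ‖⟪x, x⟫ + a‖ := by
  rw [← norm_inner_self_eq (B := B)]
  exact CStarAlgebra.norm_le_norm_of_nonneg_of_le inner_self_nonneg (le_add_of_nonneg_right ha)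

theorem eq_of_inner_eq {a b : E} {V : Set E} (hV : Dense V)
    (h : ∀ x ∈ V, ⟪a, x⟫ = ⟪b, x⟫) : a = b := by
  have h1 : (fun x => ⟪a, x⟫) = fun x => ⟪b, x⟫ :=
    (continuous_inner_left a).ext_on hV (continuous_inner_left b) h
  rw [← sub_eq_zero]
  refine inner_self_eq_zero' (B := B) ?_
  rw [CStarModule.inner_sub_left, sub_eq_zero]
  exact congrFun h1 _

theorem eq_of_inner_left_eq {a b : E} (h : ∀ x, ⟪x, a⟫ = ⟪x, b⟫) : a = b := by
  refine eq_of_inner_eq (B := B) dense_univ fun x _ => ?_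
  rw [← star_inner, h, star_inner]

theorem isClosed_relAdj (G : Submodule ℂ (E × E)) :
    IsClosed (relAdj B G : Set (E × E)) := by
  have : (relAdj B G : Set (E × E)) = ⋂ q ∈ G, {p | ⟪p.1, q.2⟫ = ⟪p.2, q.1⟫} := by
    ext p; simp [mem_relAdj]
  rw [this]
  refine isClosed_biInter fun q _ => isClosed_eq ?_ ?_
  · exact (continuous_inner_right q.2).comp continuous_fst
  · exact (continuous_inner_right q.1).comp continuous_snd

theorem relAdj_anti {G H : Submodule ℂ (E × E)} (h : G ≤ H) : relAdj B H ≤ relAdj B G :=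
  fun _ hp q hq => hp q (h hq)

theorem le_relAdj_symm {G H : Submodule ℂ (E × E)} (h : G ≤ relAdj B H) : H ≤ relAdj B G := by
  intro p hp q hq
  have := congrArg star (h hq p hp)
  simpa using this.symm

theorem le_relAdj_relAdj (G : Submodule ℂ (E × E)) : G ≤ relAdj B (relAdj B G) :=
  le_relAdj_symm le_rfl

theorem relAdj_topologicalClosure (G : Submodule ℂ (E × E)) :
    relAdj B G.topologicalClosure = relAdj B G := by
  refine le_antisymm (relAdj_anti G.le_topologicalClosure) (le_relAdj_symm ?_)
  exact G.topologicalClosure_minimal (le_relAdj_relAdj G) (isClosed_relAdj _)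

theorem eq_zero_of_mem_relAdj {G : Submodule ℂ (E × E)}
    (hG : Dense {x : E | ∃ y, (x, y) ∈ G}) {y : E} (h : (0, y) ∈ relAdj B G) : y = 0 := by
  refine eq_of_inner_eq (B := B) hG ?_
  rintro x ⟨z, hz⟩
  have := h _ hz
  simpa using this.symm

/-! ### Graphs of partially defined operators -/

theorem coe_domain_eq (T : E →ₗ.[ℂ] E) : (T.domain : Set E) = {x | ∃ y, (x, y) ∈ T.graph} := by
  ext x
  exact LinearPMap.mem_domain_iff

theorem apply_eq_of_mem_graph {T : E →ₗ.[ℂ] E} {x y : E} (h : (x, y) ∈ T.graph)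
    (hx : x ∈ T.domain) : T ⟨x, hx⟩ = y :=
  T.mem_graph_snd_inj (T.mem_graph ⟨x, hx⟩) h rfl

theorem adjointGraph_eq (T : E →ₗ.[ℂ] E) : adjointGraph B T = relAdj B T.graph := by
  ext p
  constructor
  · intro h q hq
    obtain ⟨y, hy1, hy2⟩ := (LinearPMap.mem_graph_iff _).1 hq
    rw [← hy1, ← hy2]
    exact h y
  · intro h x
    exact h _ (T.mem_graph x)

theorem adj_graph {T : E →ₗ.[ℂ] E} (hT : Dense (T.domain : Set E)) :
    (adj B T).graph = relAdj B T.graph := by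
  rw [adj, adjointGraph_eq]
  refine Submodule.toLinearPMap_graph_eq _ fun p hp hp1 => ?_
  rw [coe_domain_eq] at hT
  refine eq_zero_of_mem_relAdj hT (B := B) ?_
  rwa [← hp1]

theorem isSelfAdj_iff {T : E →ₗ.[ℂ] E} :
    IsSelfAdj B T ↔ Dense (T.domain : Set E) ∧ relAdj B T.graph = T.graph := by
  refine and_congr_right fun hT => ?_
  rw [← adj_graph hT]
  exact ⟨fun h => by rw [h], fun h => LinearPMap.eq_of_eq_graph h⟩

theorem isClosable_of_le_relAdj {T : E →ₗ.[ℂ] E} {G : Submodule ℂ (E × E)}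
    (hG : Dense {x : E | ∃ y, (x, y) ∈ G}) (h : T.graph ≤ relAdj B G) : T.IsClosable := by
  refine ⟨T.graph.topologicalClosure.toLinearPMap, ?_⟩
  rw [Submodule.toLinearPMap_graph_eq]
  intro p hp hp1
  have h2 := T.graph.topologicalClosure_minimal h (isClosed_relAdj _) hp
  refine eq_zero_of_mem_relAdj hG (B := B) ?_
  rwa [← hp1]

/-- A densely defined symmetric operator is closable. -/
theorem isClosable_of_symm {T : E →ₗ.[ℂ] E} (hT : Dense (T.domain : Set E))
    (h : T.graph ≤ relAdj B T.graph) : T.IsClosable :=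
  isClosable_of_le_relAdj (by rwa [← coe_domain_eq]) h

theorem graph_closure_of_symm {T : E →ₗ.[ℂ] E} (hT : Dense (T.domain : Set E))
    (h : T.graph ≤ relAdj B T.graph) : T.closure.graph = T.graph.topologicalClosure :=
  (isClosable_of_symm hT h).graph_closure_eq_closure_graph.symm

theorem graph_domRestrict (T : E →ₗ.[ℂ] E) (V : Submodule ℂ E) :
    (T.domRestrict V).graph = relRestrict T.graph V := by
  ext p
  rw [mem_relRestrict, LinearPMap.mem_graph_iff, LinearPMap.mem_graph_iff]
  constructor
  · rintro ⟨y, hy1, hy2⟩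
    refine ⟨⟨⟨y, y.2.2⟩, hy1, ?_⟩, hy1 ▸ y.2.1⟩
    rw [← hy2]
    exact (LinearPMap.domRestrict_apply rfl).symm
  · rintro ⟨⟨y, hy1, hy2⟩, h⟩
    refine ⟨⟨y, ⟨hy1 ▸ h, y.2⟩⟩, hy1, ?_⟩
    rw [← hy2]
    exact LinearPMap.domRestrict_apply rfl

theorem hasCore_iff {T : E →ₗ.[ℂ] E} (hT : T.IsClosed) {V : Submodule ℂ E} :
    T.HasCore V ↔ V ≤ T.domain ∧ (relRestrict T.graph V).topologicalClosure = T.graph := by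
  have hc : (T.domRestrict V).IsClosable := hT.isClosable.leIsClosable LinearPMap.domRestrict_le
  have hg := hc.graph_closure_eq_closure_graph
  rw [graph_domRestrict] at hg
  constructor
  · intro h
    exact ⟨h.1, by rw [hg, h.2]⟩
  · intro h
    exact ⟨h.1, LinearPMap.eq_of_eq_graph (by rw [← hg, h.2])⟩

theorem graph_add (S T : E →ₗ.[ℂ] E) {p : E × E} : p ∈ (S + T).graph ↔
    ∃ s t, (p.1, s) ∈ S.graph ∧ (p.1, t) ∈ T.graph ∧ p.2 = s + t := by
  constructor
  · intro h
    obtain ⟨y, hy1, hy2⟩ := (LinearPMap.mem_graph_iff _).1 h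
    refine ⟨S ⟨y, y.2.1⟩, T ⟨y, y.2.2⟩, ?_, ?_, hy2.symm⟩
    · rw [← hy1]; exact S.mem_graph ⟨y, y.2.1⟩
    · rw [← hy1]; exact T.mem_graph ⟨y, y.2.2⟩
  · rintro ⟨s, t, hs, ht, h⟩
    have h1 := LinearPMap.mem_domain_of_mem_graph hs
    have h2 := LinearPMap.mem_domain_of_mem_graph ht
    refine (LinearPMap.mem_graph_iff _).2 ⟨⟨p.1, h1, h2⟩, rfl, ?_⟩
    rw [h, ← apply_eq_of_mem_graph hs h1, ← apply_eq_of_mem_graph ht h2]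
    rfl

theorem graph_sub (S T : E →ₗ.[ℂ] E) {p : E × E} : p ∈ (S - T).graph ↔
    ∃ s t, (p.1, s) ∈ S.graph ∧ (p.1, t) ∈ T.graph ∧ p.2 = s - t := by
  constructor
  · intro h
    obtain ⟨y, hy1, hy2⟩ := (LinearPMap.mem_graph_iff _).1 h
    refine ⟨S ⟨y, y.2.1⟩, T ⟨y, y.2.2⟩, ?_, ?_, hy2.symm⟩
    · rw [← hy1]; exact S.mem_graph ⟨y, y.2.1⟩
    · rw [← hy1]; exact T.mem_graph ⟨y, y.2.2⟩
  · rintro ⟨s, t, hs, ht, h⟩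
    have h1 := LinearPMap.mem_domain_of_mem_graph hs
    have h2 := LinearPMap.mem_domain_of_mem_graph ht
    refine (LinearPMap.mem_graph_iff _).2 ⟨⟨p.1, h1, h2⟩, rfl, ?_⟩
    rw [h, ← apply_eq_of_mem_graph hs h1, ← apply_eq_of_mem_graph ht h2]
    rfl

theorem graph_smul (c : ℂ) (T : E →ₗ.[ℂ] E) {p : E × E} : p ∈ (c • T).graph ↔
    ∃ t, (p.1, t) ∈ T.graph ∧ p.2 = c • t := by
  constructor
  · intro h
    obtain ⟨y, hy1, hy2⟩ := (LinearPMap.mem_graph_iff _).1 h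
    refine ⟨T ⟨y, y.2⟩, ?_, hy2.symm⟩
    rw [← hy1]; exact T.mem_graph ⟨y, y.2⟩
  · rintro ⟨t, ht, h⟩
    have h1 := LinearPMap.mem_domain_of_mem_graph ht
    refine (LinearPMap.mem_graph_iff _).2 ⟨⟨p.1, h1⟩, rfl, ?_⟩
    rw [h, ← apply_eq_of_mem_graph ht h1]
    rfl

end Relations

/-! ### Bounded operators on Banach spaces -/

section Banach

variable {F F' : Type*} [NormedAddCommGroup F] [NormedSpace ℂ F] [CompleteSpace F]
  [NormedAddCommGroup F'] [NormedSpace ℂ F']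

theorem surjective_of_bound_of_denseRange (f : F →L[ℂ] F') (K : ℝ) (hK : ∀ x, ‖x‖ ≤ K * ‖f x‖)
    (hf : DenseRange f) : Function.Surjective f := by
  have h1 : AntilipschitzWith K.toNNReal f := by
    refine AddMonoidHomClass.antilipschitz_of_bound f fun x => (hK x).trans ?_
    gcongr
    exact Real.le_coe_toNNReal K
  have h2 := h1.isClosed_range f.uniformContinuous
  rw [← Set.range_eq_univ, ← h2.closure_eq]
  exact hf.closure_range

theorem exists_sub_eq_of_norm_lt_one (A : F →L[ℂ] F) (hA : ‖A‖ < 1) (z : F) :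
    ∃ y, y - A y = z := by
  obtain ⟨u, hu⟩ := isUnit_one_sub_of_norm_lt_one hA
  refine ⟨(↑u⁻¹ : F →L[ℂ] F) z, ?_⟩
  have h : (u : F →L[ℂ] F) ((↑u⁻¹ : F →L[ℂ] F) z) = z := by
    rw [← mul_apply_eq_comp, Units.mul_inv]
    rfl
  rw [hu] at h
  simpa using h

/-- The method of continuity: a lower bound that is uniform along the segment from the invertible
operator `C` to `A + C` makes `A + C` surjective. -/
theorem surjective_of_bound_segment (A C : F →L[ℂ] F) (hC : IsUnit C) {k : ℝ} (hk : 0 < k)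
    (h : ∀ s : ℝ, 0 ≤ s → s ≤ 1 → ∀ x, k * ‖x‖ ≤ ‖(s : ℂ) • A x + C x‖) :
    Function.Surjective (A + C) := by
  -- From an invertible point of the segment the Neumann series reaches all points at distance less
  -- than `k / ‖A‖`, so steps of length `1 / n` suffice.
  obtain ⟨n, hn⟩ := exists_nat_gt (‖A‖ / k)
  have hn0 : (0 : ℝ) < n := lt_of_le_of_lt (by positivity) hn
  have key : ∀ j : ℕ, j ≤ n → IsUnit ((((j / n : ℝ) : ℝ) : ℂ) • A + C) := by
    intro j
    induction j with
    | zero => intro _; simpa using hC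
    | succ j ih =>
      intro hj
      obtain ⟨u, hu⟩ := ih (by omega)
      have hb : ‖(↑u⁻¹ : F →L[ℂ] F)‖ ≤ k⁻¹ := by
        refine ContinuousLinearMap.opNorm_le_bound _ (by positivity) fun z => ?_
        have h1 := h (j / n) (by positivity)
          ((div_le_one hn0).2 (by exact_mod_cast (by omega : j ≤ n))) ((↑u⁻¹ : F →L[ℂ] F) z)
        have h2 : (u : F →L[ℂ] F) ((↑u⁻¹ : F →L[ℂ] F) z) = z := by
          rw [← mul_apply_eq_comp, Units.mul_inv]
          rfl
        rw [hu] at h2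
        have h3 : ((((j / n : ℝ) : ℝ) : ℂ) • A + C) ((↑u⁻¹ : F →L[ℂ] F) z)
          = ((j / n : ℝ) : ℂ) • A ((↑u⁻¹ : F →L[ℂ] F) z) + C ((↑u⁻¹ : F →L[ℂ] F) z) := rfl
        rw [h3] at h2
        rw [h2] at h1
        rw [inv_mul_eq_div, le_div_iff₀ hk, mul_comm]
        exact h1
      have he : (((((j + 1 : ℕ) : ℝ) / n : ℝ) : ℝ) : ℂ) • A + C =
          u * (1 - (-((↑u⁻¹ : F →L[ℂ] F) * (((1 / n : ℝ) : ℂ) • A)))) := by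
        rw [sub_neg_eq_add, mul_add, mul_one, ← mul_assoc, Units.mul_inv, one_mul, hu]
        have : (((((j + 1 : ℕ) : ℝ) / n : ℝ) : ℝ) : ℂ) = ((j / n : ℝ) : ℂ) + ((1 / n : ℝ) : ℂ) := by
          push_cast; ring
        rw [this, add_smul]
        abel
      rw [he]
      refine u.isUnit.mul (isUnit_one_sub_of_norm_lt_one ?_)
      rw [norm_neg]
      calc _ ≤ ‖(↑u⁻¹ : F →L[ℂ] F)‖ * ‖((1 / n : ℝ) : ℂ) • A‖ := norm_mul_le _ _
        _ ≤ k⁻¹ * (1 / n * ‖A‖) := by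
          gcongr
          rw [norm_smul, Complex.norm_real, Real.norm_of_nonneg (by positivity)]
        _ < 1 := by
          rw [div_lt_iff₀ hk] at hn
          rw [one_div, ← mul_assoc, ← mul_inv, inv_mul_eq_div, div_lt_one (by positivity)]
          linarith
  obtain ⟨u, hu⟩ := key n le_rfl
  rw [div_self hn0.ne', Complex.ofReal_one, one_smul] at hu
  intro z
  refine ⟨(↑u⁻¹ : F →L[ℂ] F) z, ?_⟩
  rw [← hu, ← mul_apply_eq_comp, Units.mul_inv]
  rfl

end Banach

/-! ### Self-adjoint relations and their resolvents -/

section SelfAdjoint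

variable (B : Type*) {E : Type*} [NonUnitalCStarAlgebra B] [PartialOrder B] [StarOrderedRing B]
  [NormedAddCommGroup E] [NormedSpace ℂ E] [SMul Bᵐᵒᵖ E] [CStarModule Bᵐᵒᵖ E]

local notation "⟪" x "," y "⟫" => inner Bᵐᵒᵖ x y

/-- `T - iμ` is surjective, where `G` is the graph of `T`. -/
def SurjAt (G : Submodule ℂ (E × E)) (μ : ℝ) : Prop :=
  ∀ z, ∃ x, (x, z + (Complex.I * (μ : ℂ)) • x) ∈ G

/-- `G` is the graph of a regular self-adjoint operator `T` (up to `B`-linearity), expressed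
through the surjectivity of `T - iμ` for all real `μ ≠ 0`. -/
structure IsSelfAdjRegular (G : Submodule ℂ (E × E)) : Prop where
  dense : Dense {x : E | ∃ y, (x, y) ∈ G}
  relAdj_eq : relAdj B G = G
  surjAt : ∀ μ : ℝ, μ ≠ 0 → SurjAt G μ

/-- `r μ` is the resolvent `(T - iμ)⁻¹`, for all real `μ ≠ 0`. -/
structure IsResolvent (G : Submodule ℂ (E × E)) (r : ℝ → E →L[ℂ] E) : Prop where
  mem : ∀ μ : ℝ, μ ≠ 0 → ∀ z, (r μ z, z + (Complex.I * (μ : ℂ)) • r μ z) ∈ G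
  eq : ∀ μ : ℝ, μ ≠ 0 → ∀ x s, (x, s) ∈ G → r μ (s - (Complex.I * (μ : ℂ)) • x) = x
  norm_le : ∀ μ : ℝ, μ ≠ 0 → ∀ z, |μ| * ‖r μ z‖ ≤ ‖z‖

variable {B}

theorem star_I_mul (μ : ℝ) : star (Complex.I * (μ : ℂ)) = -(Complex.I * (μ : ℂ)) := by
  simp

theorem inner_self_sub_smul {s x : E} (h : ⟪s, x⟫ = ⟪x, s⟫) (μ : ℝ) :
    ⟪s - (Complex.I * (μ : ℂ)) • x, s - (Complex.I * (μ : ℂ)) • x⟫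
      = ⟪s, s⟫ + ((μ ^ 2 : ℝ) : ℂ) • ⟪x, x⟫ := by
  have h2 : (Complex.I * (μ : ℂ)) * (Complex.I * (μ : ℂ)) = -((μ ^ 2 : ℝ) : ℂ) := by
    push_cast
    linear_combination (μ : ℂ) ^ 2 * Complex.I_mul_I
  simp only [CStarModule.inner_sub_left, CStarModule.inner_sub_right,
    CStarModule.inner_smul_left_complex, CStarModule.inner_smul_right_complex, star_I_mul, h,
    smul_sub, smul_smul, neg_smul, smul_neg, h2]
  abel

theorem smul_inner_self_nonneg {a : ℝ} (ha : 0 ≤ a) (x : E) : 0 ≤ (a : ℂ) • ⟪x, x⟫ := by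
  have : (a : ℂ) • ⟪x, x⟫ = ⟪((√a : ℝ) : ℂ) • x, ((√a : ℝ) : ℂ) • x⟫ := by
    rw [CStarModule.inner_smul_left_complex, CStarModule.inner_smul_right_complex, smul_smul]
    congr 1
    rw [Complex.star_def, Complex.conj_ofReal, ← Complex.ofReal_mul, Real.mul_self_sqrt ha]
  rw [this]
  exact CStarModule.inner_self_nonneg

theorem norm_smul_inner_self {a : ℝ} (ha : 0 ≤ a) (x : E) :
    ‖(a : ℂ) • ⟪x, x⟫‖ = a * ‖x‖ ^ 2 := by
  rw [norm_smul, norm_inner_self_eq, Complex.norm_real, Real.norm_of_nonneg ha]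

theorem norm_le_norm_sub_smul {s x : E} (h : ⟪s, x⟫ = ⟪x, s⟫) (μ : ℝ) :
    ‖s‖ ≤ ‖s - (Complex.I * (μ : ℂ)) • x‖ ∧ |μ| * ‖x‖ ≤ ‖s - (Complex.I * (μ : ℂ)) • x‖ := by
  have key := inner_self_sub_smul h μ
  have h1 := norm_inner_self_eq (B := B) (s - (Complex.I * (μ : ℂ)) • x)
  rw [key] at h1
  constructor
  · refine le_of_sq_le_sq ?_ (norm_nonneg _)
    rw [← h1]
    exact norm_sq_le_of_inner_add s (smul_inner_self_nonneg (sq_nonneg _) x)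
  · refine le_of_sq_le_sq ?_ (norm_nonneg _)
    rw [← h1, mul_pow, sq_abs, ← norm_smul_inner_self (B := B) (sq_nonneg μ) x]
    exact CStarAlgebra.norm_le_norm_of_nonneg_of_le (smul_inner_self_nonneg (sq_nonneg _) x)
      (le_add_of_nonneg_left CStarModule.inner_self_nonneg)

theorem IsSelfAdjRegular.isClosed {G : Submodule ℂ (E × E)} (h : IsSelfAdjRegular B G) :
    IsClosed (G : Set (E × E)) := by
  rw [← h.relAdj_eq]
  exact isClosed_relAdj G

theorem inner_symm_of_le {G : Submodule ℂ (E × E)} (h : G ≤ relAdj B G) {x s y t : E}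
    (h1 : (x, s) ∈ G) (h2 : (y, t) ∈ G) : ⟪s, y⟫ = ⟪x, t⟫ :=
  (h h1 _ h2).symm

variable [CompleteSpace E]

/-- A closed symmetric operator `T` for which `T - iμ` has dense range has `T - iμ` surjective. -/
theorem surjAt_of_dense {G : Submodule ℂ (E × E)} (hcl : IsClosed (G : Set (E × E)))
    (hs : G ≤ relAdj B G) {μ : ℝ} (hμ : μ ≠ 0)
    (hd : Dense {z : E | ∃ x, (x, z + (Complex.I * (μ : ℂ)) • x) ∈ G}) : SurjAt G μ := by
  have : CompleteSpace G := hcl.completeSpace_coe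
  let f : G →L[ℂ] E := (ContinuousLinearMap.snd ℂ E E
    - (Complex.I * (μ : ℂ)) • ContinuousLinearMap.fst ℂ E E).comp G.subtypeL
  have hf : ∀ g : G, f g = g.1.2 - (Complex.I * (μ : ℂ)) • g.1.1 := fun g => rfl
  have hsurj : Function.Surjective f := by
    refine surjective_of_bound_of_denseRange f (|μ|⁻¹ + 1) (fun g => ?_) ?_
    · have h1 := norm_le_norm_sub_smul (inner_symm_of_le hs g.2 g.2) μ
      rw [← hf] at h1
      have h2 : ‖(g : E × E).1‖ ≤ |μ|⁻¹ * ‖f g‖ := by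
        rw [inv_mul_eq_div, le_div_iff₀ (abs_pos.2 hμ), mul_comm]
        exact h1.2
      have h3 : ‖g‖ = max ‖(g : E × E).1‖ ‖(g : E × E).2‖ := rfl
      rw [h3, max_le_iff, add_mul, one_mul]
      have : 0 ≤ |μ|⁻¹ * ‖f g‖ := by positivity
      exact ⟨h2.trans (by linarith [norm_nonneg (f g)]), h1.1.trans (by linarith)⟩
    · refine hd.mono ?_
      rintro z ⟨x, hx⟩
      exact ⟨⟨_, hx⟩, by rw [hf]; simp⟩
  intro z
  obtain ⟨g, hg⟩ := hsurj z
  refine ⟨g.1.1, ?_⟩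
  rw [hf] at hg
  rw [← hg]
  simp

/-- The bounded inverse `(T - iμ)⁻¹` of a symmetric operator with `T - iμ` surjective. -/
theorem exists_resolvent_at {G : Submodule ℂ (E × E)} (hs : G ≤ relAdj B G) {μ : ℝ} (hμ : μ ≠ 0)
    (h : SurjAt G μ) : ∃ r : E →L[ℂ] E, (∀ z, (r z, z + (Complex.I * (μ : ℂ)) • r z) ∈ G) ∧
      (∀ x s, (x, s) ∈ G → r (s - (Complex.I * (μ : ℂ)) • x) = x) ∧
      (∀ z, |μ| * ‖r z‖ ≤ ‖z‖) := by
  choose f hf using h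
  have hb : ∀ x s, (x, s) ∈ G → |μ| * ‖x‖ ≤ ‖s - (Complex.I * (μ : ℂ)) • x‖ :=
    fun x s hx => (norm_le_norm_sub_smul (inner_symm_of_le hs hx hx) μ).2
  have hu : ∀ x s, (x, s) ∈ G → f (s - (Complex.I * (μ : ℂ)) • x) = x := by
    intro x s hx
    have h1 := G.sub_mem (hf (s - (Complex.I * (μ : ℂ)) • x)) hx
    have h2 := hb _ _ h1
    have h3 : (s - (Complex.I * (μ : ℂ)) • x
        + (Complex.I * (μ : ℂ)) • f (s - (Complex.I * (μ : ℂ)) • x) - s)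
        - (Complex.I * (μ : ℂ)) • (f (s - (Complex.I * (μ : ℂ)) • x) - x) = 0 := by
      rw [smul_sub]; abel
    rw [h3, norm_zero] at h2
    have h4 := nonpos_of_mul_nonpos_right h2 (abs_pos.2 hμ)
    exact sub_eq_zero.1 (norm_le_zero_iff.1 h4)
  have hn : ∀ z, |μ| * ‖f z‖ ≤ ‖z‖ := fun z => by simpa using hb _ _ (hf z)
  have hlin : IsLinearMap ℂ f := by
    constructor
    · intro x y
      have := G.add_mem (hf x) (hf y)
      rw [Prod.mk_add_mk] at this
      have := hu _ _ this
      convert this using 2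
      rw [smul_add]; abel
    · intro c x
      have := G.smul_mem c (hf x)
      rw [Prod.smul_mk] at this
      have := hu _ _ this
      convert this using 2
      rw [smul_add, smul_comm]; abel
  refine ⟨hlin.mk'.mkContinuous |μ|⁻¹ fun z => ?_, hf, hu, hn⟩
  rw [inv_mul_eq_div, le_div_iff₀ (abs_pos.2 hμ), mul_comm]
  exact hn z

/-- Surjectivity persists for `|ν - μ| < |μ|`, by the Neumann series for the resolvent. -/
theorem SurjAt.of_abs_sub_lt {G : Submodule ℂ (E × E)} (hs : G ≤ relAdj B G) {μ ν : ℝ}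
    (hμ : μ ≠ 0) (h : SurjAt G μ) (hν : |ν - μ| < |μ|) : SurjAt G ν := by
  obtain ⟨r, hr, -, hn⟩ := exists_resolvent_at hs hμ h
  intro z
  have hμ' := abs_pos.2 hμ
  obtain ⟨y, hy⟩ := exists_sub_eq_of_norm_lt_one ((Complex.I * ((ν - μ : ℝ) : ℂ)) • r) (by
    rw [norm_smul, norm_mul, Complex.norm_I, one_mul, Complex.norm_real, Real.norm_eq_abs]
    have : ‖r‖ ≤ |μ|⁻¹ := by
      refine ContinuousLinearMap.opNorm_le_bound _ (by positivity) fun z => ?_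
      rw [inv_mul_eq_div, le_div_iff₀ hμ', mul_comm]
      exact hn z
    calc _ ≤ |ν - μ| * |μ|⁻¹ := by gcongr
      _ < 1 := by rwa [← div_eq_mul_inv, div_lt_one hμ']) z
  refine ⟨r y, ?_⟩
  have h1 := hr y
  convert h1 using 2
  have hy' : y - (Complex.I * ((ν - μ : ℝ) : ℂ)) • r y = z := hy
  rw [← hy', Complex.ofReal_sub, mul_sub, sub_smul]
  abel

/-- Surjectivity of `T - iμ` depends only on the sign of `μ`. -/
theorem SurjAt.of_mul_pos {G : Submodule ℂ (E × E)} (hs : G ≤ relAdj B G) {μ ν : ℝ}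
    (h : SurjAt G μ) (hν : 0 < ν * μ) : SurjAt G ν := by
  -- The Neumann series reaches factors in the open interval `(0, 2)`. The factor `2` is thus reached
  -- in two steps by `3 / 2`, which leave `9 / 4`, and a further step back.
  have key : ∀ n : ℕ, SurjAt G (2 ^ n * μ) := by
    have hμ : μ ≠ 0 := by rintro rfl; simp at hν
    have h3 : ∀ ρ : ℝ, ρ ≠ 0 → SurjAt G ρ → SurjAt G (3 / 2 * ρ) := by
      intro ρ hρ h
      refine h.of_abs_sub_lt hs hρ ?_
      have : 3 / 2 * ρ - ρ = 1 / 2 * ρ := by ring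
      rw [this, abs_mul]
      have := abs_pos.2 hρ
      norm_num
      linarith
    intro n
    induction n with
    | zero => simpa using h
    | succ n ih =>
      have h1 : (2 : ℝ) ^ n * μ ≠ 0 := by positivity
      have h2 := h3 _ (by positivity) (h3 _ h1 ih)
      refine h2.of_abs_sub_lt hs (by positivity) ?_
      have e1 : (2 : ℝ) ^ (n + 1) * μ - 3 / 2 * (3 / 2 * (2 ^ n * μ)) = (-1 / 4) * (2 ^ n * μ) := by
        ring
      have e2 : 3 / 2 * (3 / 2 * ((2 : ℝ) ^ n * μ)) = 9 / 4 * (2 ^ n * μ) := by ring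
      have := abs_pos.2 h1
      rw [e1, e2, abs_mul (-1 / 4), abs_mul (9 / 4)]
      generalize |(2 : ℝ) ^ n * μ| = a at this ⊢
      norm_num
      linarith
  have hμ : μ ≠ 0 := by rintro rfl; simp at hν
  obtain ⟨n, hn⟩ := pow_unbounded_of_one_lt (ν / μ) (one_lt_two (α := ℝ))
  have hpos : 0 < ν / μ := by
    have : ν / μ = ν * μ / (μ * μ) := by field_simp
    rw [this]
    exact div_pos hν (mul_self_pos.2 hμ)
  -- The ball about `2 ^ n * μ` contains every smaller multiple of `μ` of the same sign.
  refine (key n).of_abs_sub_lt hs (by positivity) ?_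
  have e1 : ν - 2 ^ n * μ = -(2 ^ n - ν / μ) * μ := by field_simp; ring
  have e2 : |(2 : ℝ) ^ n * μ| = 2 ^ n * |μ| := by rw [abs_mul, abs_of_pos (by positivity)]
  rw [e1, e2, abs_mul, abs_neg, abs_of_pos (by linarith)]
  have := abs_pos.2 hμ
  gcongr
  linarith

/-- The basic criterion for self-adjointness and regularity of a symmetric operator. -/
theorem isSelfAdjRegular_of_surjAt {G : Submodule ℂ (E × E)}
    (hd : Dense {x : E | ∃ y, (x, y) ∈ G}) (hs : G ≤ relAdj B G) {μ : ℝ} (hμ : μ ≠ 0)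
    (h1 : SurjAt G μ) (h2 : SurjAt G (-μ)) : IsSelfAdjRegular B G := by
  refine ⟨hd, le_antisymm ?_ hs, ?_⟩
  · rintro ⟨y, w⟩ hp
    obtain ⟨x, hx⟩ := h1 (w - (Complex.I * (μ : ℂ)) • y)
    have h3 := (relAdj B G).sub_mem hp (hs hx)
    have h4 : y - x = 0 := by
      refine eq_of_inner_eq (B := B) dense_univ fun z _ => ?_
      obtain ⟨a, ha⟩ := h2 z
      have := h3 _ ha
      simp only [Prod.mk_sub_mk] at this
      have e : w - (w - (Complex.I * (μ : ℂ)) • y + (Complex.I * (μ : ℂ)) • x)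
          = (Complex.I * (μ : ℂ)) • (y - x) := by rw [smul_sub]; abel
      rw [e, CStarModule.inner_smul_left_complex, star_I_mul, CStarModule.inner_add_right,
        CStarModule.inner_smul_right_complex, Complex.ofReal_neg, mul_neg] at this
      rw [CStarModule.inner_zero_left]
      simpa using this
    rw [sub_eq_zero] at h4
    subst h4
    simpa using hx
  · intro ν hν
    rcases lt_or_gt_of_ne (mul_ne_zero hν hμ) with h | h
    · exact h2.of_mul_pos hs (by linarith)
    · exact h1.of_mul_pos hs h

theorem IsSelfAdjRegular.exists_resolvent {G : Submodule ℂ (E × E)} (h : IsSelfAdjRegular B G) :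
    ∃ r, IsResolvent G r := by
  have hs : G ≤ relAdj B G := h.relAdj_eq.ge
  choose! r h1 h2 h3 using fun (μ : ℝ) (hμ : μ ≠ 0) => exists_resolvent_at hs hμ (h.surjAt μ hμ)
  exact ⟨r, h1, h2, h3⟩

/-! ### Regular operators -/

/-- The orthogonal decomposition of `E × E` by the graph of a regular operator `T`: every `(u, v)`
is of the form `(x, T x) + (T* y, -y)`. -/
theorem IsRegular.exists_decomp {T : E →ₗ.[ℂ] E} (hT : IsRegular B T) (u v : E) :
    ∃ x t y w, (x, t) ∈ T.graph ∧ (y, w) ∈ relAdj B T.graph ∧ u = x + w ∧ v = t - y := by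
  set G := T.graph
  set H := relAdj B G
  have : CompleteSpace G := hT.closed.completeSpace_coe
  have : CompleteSpace H := (isClosed_relAdj G).completeSpace_coe
  -- The two summands are orthogonal, so this map is bounded below, and its range is closed. It
  -- contains `(1 + T* T) E × 0` and, modulo `E × 0`, the vectors `(0, y)` with `y ∈ Dom T*`.
  let f : G × H →L[ℂ] E × E :=
    G.subtypeL.comp (ContinuousLinearMap.fst ℂ G H) +
      (((ContinuousLinearMap.snd ℂ E E).prod (-ContinuousLinearMap.fst ℂ E E)).comp
        (H.subtypeL.comp (ContinuousLinearMap.snd ℂ G H)))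
  have hf : ∀ p : G × H, f p = (p.1.1.1 + p.2.1.2, p.1.1.2 - p.2.1.1) := by
    intro p
    simp [f, Prod.ext_iff, sub_eq_add_neg]
  have hadj := adj_graph (B := B) hT.dense_domain
  have hd : DenseRange f := by
    have h1 : ∀ z : E, (z, 0) ∈ (LinearMap.range f.toLinearMap).topologicalClosure := by
      intro z
      have : (fun z : E => (z, (0 : E))) z ∈
          closure ((LinearMap.range f.toLinearMap : Submodule ℂ (E × E)) : Set (E × E)) := by
        refine map_mem_closure (f := fun z : E => (z, (0 : E))) (by fun_prop)
          (hT.dense_range z) ?_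
        rintro z ⟨x, hx, rfl⟩
        refine ⟨(⟨_, T.mem_graph x⟩, ⟨(T x, adj B T ⟨T x, hx⟩), ?_⟩), ?_⟩
        · change _ ∈ relAdj B T.graph
          rw [← hadj]
          exact (adj B T).mem_graph ⟨T x, hx⟩
        · change f _ = _
          rw [hf]
          simp
      exact this
    have h2 : ∀ z : E, (0, z) ∈ (LinearMap.range f.toLinearMap).topologicalClosure := by
      intro z
      have : (fun z : E => ((0 : E), z)) z ∈ closure
          (((LinearMap.range f.toLinearMap).topologicalClosure : Submodule ℂ (E × E)) :
            Set (E × E)) := by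
        refine map_mem_closure (f := fun z : E => ((0 : E), z)) (by fun_prop)
          (hT.dense_adj_domain z) ?_
        intro y hy
        have h3 : (y, adj B T ⟨y, hy⟩) ∈ H := by
          change _ ∈ relAdj B T.graph
          rw [← hadj]
          exact (adj B T).mem_graph ⟨y, hy⟩
        have h4 : f (0, ⟨_, h3⟩) ∈ (LinearMap.range f.toLinearMap).topologicalClosure :=
          Submodule.le_topologicalClosure _ ⟨_, rfl⟩
        have h5 := Submodule.sub_mem _ (h1 (adj B T ⟨y, hy⟩)) h4
        rw [hf] at h5
        simp only [ZeroMemClass.coe_zero, Prod.fst_zero, Prod.snd_zero, zero_add, zero_sub,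
          Prod.mk_sub_mk, sub_self, sub_neg_eq_add] at h5
        exact h5
      rw [(Submodule.isClosed_topologicalClosure _).closure_eq] at this
      exact this
    rintro ⟨a, b⟩
    have := Submodule.add_mem _ (h1 a) (h2 b)
    simp only [Prod.mk_add_mk, add_zero, zero_add] at this
    exact this
  have hsurj := surjective_of_bound_of_denseRange f 2 (fun p => ?_) hd
  · obtain ⟨p, hp⟩ := hsurj (u, v)
    rw [hf, Prod.ext_iff] at hp
    exact ⟨_, _, _, _, p.1.2, p.2.2, hp.1.symm, hp.2.symm⟩
  · obtain ⟨⟨⟨x, t⟩, hx⟩, ⟨⟨y, w⟩, hy⟩⟩ := p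
    rw [hf]
    have h0 := hy _ hx
    have h0' := congrArg star h0
    simp only [CStarModule.star_inner] at h0 h0'
    have key : ⟪x + w, x + w⟫ + ⟪t - y, t - y⟫ = ⟪x, x⟫ + ⟪t, t⟫ + ⟪y, y⟫ + ⟪w, w⟫ := by
      simp only [CStarModule.inner_add_left, CStarModule.inner_add_right,
        CStarModule.inner_sub_left, CStarModule.inner_sub_right, h0, h0']
      abel
    set N := ‖((x + w, t - y) : E × E)‖ with hN
    have hN1 : ‖x + w‖ ≤ N := le_max_left _ _
    have hN2 : ‖t - y‖ ≤ N := le_max_right _ _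
    have hN0 : 0 ≤ N := norm_nonneg _
    have hk : ‖⟪x, x⟫ + ⟪t, t⟫ + ⟪y, y⟫ + ⟪w, w⟫‖ ≤ (2 * N) ^ 2 := by
      rw [← key]
      refine (norm_add_le _ _).trans ?_
      rw [norm_inner_self_eq, norm_inner_self_eq]
      nlinarith [norm_nonneg (x + w), norm_nonneg (t - y)]
    have nn := fun x : E => inner_self_nonneg' (B := B) x
    have b1 : ‖x‖ ≤ 2 * N := by
      refine le_of_sq_le_sq (le_trans ?_ hk) (by positivity)
      rw [add_assoc, add_assoc]
      exact norm_sq_le_of_inner_add x (add_nonneg (nn _) (add_nonneg (nn _) (nn _)))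
    have b2 : ‖t‖ ≤ 2 * N := by
      refine le_of_sq_le_sq (le_trans ?_ hk) (by positivity)
      rw [add_comm ⟪x, x⟫, add_assoc, add_assoc]
      exact norm_sq_le_of_inner_add t (add_nonneg (nn _) (add_nonneg (nn _) (nn _)))
    have b3 : ‖y‖ ≤ 2 * N := by
      refine le_of_sq_le_sq (le_trans ?_ hk) (by positivity)
      rw [add_comm _ ⟪y, y⟫, add_assoc]
      exact norm_sq_le_of_inner_add y (add_nonneg (add_nonneg (nn _) (nn _)) (nn _))
    have b4 : ‖w‖ ≤ 2 * N := by
      refine le_of_sq_le_sq (le_trans ?_ hk) (by positivity)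
      rw [add_comm _ ⟪w, w⟫]
      exact norm_sq_le_of_inner_add w (add_nonneg (add_nonneg (nn _) (nn _)) (nn _))
    exact max_le (max_le b1 b2) (max_le b3 b4)

/-- A regular operator is equal to its double adjoint. -/
theorem IsRegular.relAdj_relAdj {T : E →ₗ.[ℂ] E} (hT : IsRegular B T) :
    relAdj B (relAdj B T.graph) = T.graph := by
  refine le_antisymm ?_ (le_relAdj_relAdj _)
  rintro ⟨u, v⟩ hp
  obtain ⟨x, t, y, w, hx, hy, rfl, rfl⟩ := hT.exists_decomp u v
  have h1 := (relAdj B (relAdj B T.graph)).sub_mem hp (le_relAdj_relAdj _ hx) _ hy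
  have h2 : ⟪y, y⟫ = 0 ∧ ⟪w, w⟫ = 0 := by
    simp only [Prod.mk_sub_mk, add_sub_cancel_left, sub_sub_cancel_left,
      CStarModule.inner_neg_left] at h1
    have a1 := inner_self_nonneg' (B := B) y
    have a2 := inner_self_nonneg' (B := B) w
    rw [h1] at a2
    have a3 := le_antisymm (neg_nonneg.1 a2) a1
    rw [a3] at h1
    exact ⟨a3, by simpa using h1⟩
  rw [inner_self_eq_zero' h2.1, inner_self_eq_zero' h2.2]
  simpa using hx

theorem IsRegular.exists_add_adj {T : E →ₗ.[ℂ] E} (hT : IsRegular B T) (u : E) :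
    ∃ x t w, (x, t) ∈ T.graph ∧ (t, w) ∈ relAdj B T.graph ∧ u = x + w := by
  obtain ⟨x, t, y, w, hx, hy, h1, h2⟩ := hT.exists_decomp u 0
  rw [eq_comm, sub_eq_zero] at h2
  subst h2
  exact ⟨x, t, w, hx, hy, h1⟩

/-- Regularity amounts to `B`-linearity and to the surjectivity, not only the density of the range,
of `1 + T* T`. -/
theorem isRegular_iff {T : E →ₗ.[ℂ] E} (hcl : T.IsClosed) (hd : Dense (T.domain : Set E))
    (hd' : Dense ((adj B T).domain : Set E)) : IsRegular B T ↔
      (∀ (b : Bᵐᵒᵖ) (x t : E), (x, t) ∈ T.graph → (b • x, b • t) ∈ T.graph) ∧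
      (∀ u, ∃ x t w, (x, t) ∈ T.graph ∧ (t, w) ∈ relAdj B T.graph ∧ u = x + w) := by
  constructor
  · refine fun hT => ⟨fun b x t h => ?_, hT.exists_add_adj⟩
    obtain ⟨h', e⟩ := hT.map_smul b ⟨x, LinearPMap.mem_domain_of_mem_graph h⟩
    rw [apply_eq_of_mem_graph h] at e
    rw [← e]
    exact T.mem_graph ⟨_, h'⟩
  · rintro ⟨h1, h2⟩
    refine ⟨fun b x => ?_, hcl, hd, hd', ?_⟩
    · have := h1 b x _ (T.mem_graph x)
      exact ⟨LinearPMap.mem_domain_of_mem_graph this, apply_eq_of_mem_graph this _⟩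
    · refine dense_univ.mono fun u _ => ?_
      obtain ⟨x, t, w, hx, ht, rfl⟩ := h2 u
      rw [← adj_graph hd] at ht
      have hx' := LinearPMap.mem_domain_of_mem_graph hx
      have ht' := LinearPMap.mem_domain_of_mem_graph ht
      refine ⟨⟨x, hx'⟩, ?_, ?_⟩
      · rwa [apply_eq_of_mem_graph hx]
      · have : (⟨T ⟨x, hx'⟩, by rwa [apply_eq_of_mem_graph hx]⟩ : (adj B T).domain) = ⟨t, ht'⟩ :=
          Subtype.ext (apply_eq_of_mem_graph hx hx')
        rw [this, apply_eq_of_mem_graph ht]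

theorem IsRegular.smul_mem {T : E →ₗ.[ℂ] E} (hT : IsRegular B T) (b : Bᵐᵒᵖ) {x t : E}
    (h : (x, t) ∈ T.graph) : (b • x, b • t) ∈ T.graph :=
  ((isRegular_iff hT.closed hT.dense_domain hT.dense_adj_domain).1 hT).1 b x t h

/-- The operator `T` is regular and self-adjoint if and only if it is `B`-linear and `T - iμ` is
surjective for all real `μ ≠ 0`. -/
theorem isRegular_and_isSelfAdj_iff {T : E →ₗ.[ℂ] E} : (IsRegular B T ∧ IsSelfAdj B T) ↔
    (∀ (b : Bᵐᵒᵖ) (x t : E), (x, t) ∈ T.graph → (b • x, b • t) ∈ T.graph) ∧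
      IsSelfAdjRegular B T.graph := by
  constructor
  · rintro ⟨hT, hs⟩
    have hsa := (isSelfAdj_iff.1 hs).2
    refine ⟨fun b x t h => hT.smul_mem b h, ?_⟩
    have hdense : Dense {x : E | ∃ y, (x, y) ∈ T.graph} := by
      rw [← coe_domain_eq]
      exact hs.1
    have key : ∀ μ : ℝ, μ * μ = 1 → SurjAt T.graph μ := by
      intro μ hμ z
      obtain ⟨x, t, w, hx, ht, rfl⟩ := hT.exists_add_adj z
      rw [hsa] at ht
      refine ⟨t + (Complex.I * (μ : ℂ)) • x, ?_⟩
      have h1 := T.graph.add_mem ht (T.graph.smul_mem (Complex.I * (μ : ℂ)) hx)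
      convert h1 using 1
      refine Prod.ext rfl ?_
      have e : (Complex.I * (μ : ℂ)) * (Complex.I * (μ : ℂ)) = -1 := by
        have : (μ : ℂ) * μ = 1 := by exact_mod_cast hμ
        linear_combination (μ : ℂ) * μ * Complex.I_mul_I - this
      simp only [Prod.smul_mk, Prod.mk_add_mk, smul_add, smul_smul, e]
      module
    exact isSelfAdjRegular_of_surjAt hdense hsa.ge one_ne_zero (key 1 (by norm_num))
      (key (-1) (by norm_num))
  · rintro ⟨h1, h2⟩
    have hd : Dense (T.domain : Set E) := by
      rw [coe_domain_eq]
      exact h2.dense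
    have hs : IsSelfAdj B T := isSelfAdj_iff.2 ⟨hd, h2.relAdj_eq⟩
    refine ⟨(isRegular_iff h2.isClosed hd (by rw [hs.2]; exact hd)).2 ⟨h1, fun u => ?_⟩, hs⟩
    rw [h2.relAdj_eq]
    obtain ⟨y, hy⟩ := h2.surjAt 1 one_ne_zero u
    obtain ⟨x, hx⟩ := h2.surjAt (-1) (by norm_num) y
    refine ⟨x, _, u - x, hx, ?_, by abel⟩
    have h3 := T.graph.add_mem hy (T.graph.smul_mem (-Complex.I) hx)
    convert h3 using 1
    have e : Complex.I * Complex.I = -1 := Complex.I_mul_I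
    refine Prod.ext ?_ ?_
    · simp
    · simp only [Prod.smul_mk, Prod.mk_add_mk, smul_add, smul_smul, Complex.ofReal_one, mul_one,
        Complex.ofReal_neg, mul_neg, neg_mul, neg_neg, e]
      module

/-- The adjoint of a regular operator is regular. -/
theorem IsRegular.adj {T : E →ₗ.[ℂ] E} (hT : IsRegular B T) : IsRegular B (adj B T) := by
  have hg := adj_graph (B := B) hT.dense_domain
  have hd : Dense ((HilbertModule.adj B (HilbertModule.adj B T)).domain : Set E) := by
    have := adj_graph (B := B) hT.dense_adj_domain
    rw [hg, hT.relAdj_relAdj] at this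
    rw [LinearPMap.eq_of_eq_graph this]
    exact hT.dense_domain
  refine (isRegular_iff ?_ hT.dense_adj_domain hd).2 ⟨?_, ?_⟩
  · rw [LinearPMap.IsClosed, hg]
    exact isClosed_relAdj _
  · intro b x t h
    rw [hg] at h ⊢
    intro q hq
    simp only [CStarModule.inner_op_smul_left]
    rw [h q hq]
  · intro u
    rw [hg, hT.relAdj_relAdj]
    obtain ⟨x, t, y, w, hx, hy, h1, h2⟩ := hT.exists_decomp 0 u
    refine ⟨-y, -w, t, ?_, ?_, ?_⟩
    · exact (relAdj B T.graph).neg_mem hy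
    · have : -w = x := by rw [eq_comm, ← sub_eq_zero, sub_neg_eq_add, ← h1]
      rwa [this]
    · rw [h2]; abel

end SelfAdjoint

/-! ### Almost commuting and almost anti-commuting pairs -/

section Pairs

variable (B : Type*) {E : Type*} [NonUnitalCStarAlgebra B] [PartialOrder B] [StarOrderedRing B]
  [NormedAddCommGroup E] [NormedSpace ℂ E] [SMul Bᵐᵒᵖ E] [CStarModule Bᵐᵒᵖ E]

local notation "⟪" x "," y "⟫" => inner Bᵐᵒᵖ x y

/-- The domain of a linear relation. -/
def relDom (G : Submodule ℂ (E × E)) : Submodule ℂ E := G.map (LinearMap.fst ℂ E E)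

/-- The graph of `S + c T` on `Dom S ∩ Dom T`. -/
def relComb (S T : Submodule ℂ (E × E)) (c : ℂ) : Submodule ℂ (E × E) where
  carrier := {p | ∃ s t, (p.1, s) ∈ S ∧ (p.1, t) ∈ T ∧ p.2 = s + c • t}
  zero_mem' := ⟨0, 0, S.zero_mem, T.zero_mem, by simp⟩
  add_mem' := by
    rintro p q ⟨s, t, hs, ht, h⟩ ⟨s', t', hs', ht', h'⟩
    refine ⟨s + s', t + t', S.add_mem hs hs', T.add_mem ht ht', ?_⟩
    rw [Prod.snd_add, h, h', smul_add]
    abel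
  smul_mem' := by
    rintro a p ⟨s, t, hs, ht, h⟩
    refine ⟨a • s, a • t, S.smul_mem a hs, T.smul_mem a ht, ?_⟩
    rw [Prod.smul_snd, h, smul_add, smul_comm]

/-- The condition that `[S, T] (S - iμ)⁻¹` (for `σ = 1`) or `{S, T} (S - iμ)⁻¹` (for `σ = -1`) is
defined on a core of `T` and extends to an adjointable operator, in terms of the graphs of `S` and
`T`. -/
def HasTwistedCommutator (σ : ℝ) (S T : Submodule ℂ (E × E)) : Prop :=
  ∃ V : Submodule ℂ E, (relRestrict T V).topologicalClosure = T ∧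
    ∀ μ : ℝ, μ ≠ 0 → ∃ C : E →ₗ[ℂ] E, IsAdjointable B C ∧
      ∀ ξ ∈ V, ∃ η s t u v, (η, s) ∈ S ∧ (η, t) ∈ T ∧ (t, u) ∈ S ∧ (s, v) ∈ T ∧
        s - (Complex.I * (μ : ℂ)) • η = ξ ∧ C ξ = u - (σ : ℂ) • v

variable {B}

theorem mem_relDom {G : Submodule ℂ (E × E)} {x : E} : x ∈ relDom G ↔ ∃ y, (x, y) ∈ G := by
  simp [relDom]

theorem relDom_graph (T : E →ₗ.[ℂ] E) : relDom T.graph = T.domain :=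
  T.graph_map_fst_eq_domain

theorem mem_relComb {S T : Submodule ℂ (E × E)} {c : ℂ} {p : E × E} :
    p ∈ relComb S T c ↔ ∃ s t, (p.1, s) ∈ S ∧ (p.1, t) ∈ T ∧ p.2 = s + c • t := Iff.rfl

theorem IsSelfAdjRegular.eq_of_mem {G : Submodule ℂ (E × E)} (h : IsSelfAdjRegular B G) {x y z : E}
    (hy : (x, y) ∈ G) (hz : (x, z) ∈ G) : y = z := by
  rw [← sub_eq_zero]
  refine eq_zero_of_mem_relAdj h.dense (B := B) ?_
  rw [h.relAdj_eq]
  simpa using G.sub_mem hy hz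

variable [CompleteSpace E]

/-- Adjointable operators are bounded. -/
theorem IsAdjointable.exists_continuous {C : E →ₗ[ℂ] E} (hC : IsAdjointable B C) :
    ∃ K : E →L[ℂ] E, ∀ x, K x = C x := by
  obtain ⟨C', hC'⟩ := hC
  refine ⟨ContinuousLinearMap.ofIsClosedGraph (g := C) ?_, fun x => rfl⟩
  have : (C.graph : Set (E × E)) = ⋂ z, {p | ⟪p.2, z⟫ = ⟪p.1, C' z⟫} := by
    ext p
    simp only [SetLike.mem_coe, LinearMap.mem_graph_iff, Set.mem_iInter, Set.mem_ofPred_eq]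
    constructor
    · intro h z
      rw [h, hC']
    · intro h
      refine eq_of_inner_eq (B := B) dense_univ fun z _ => ?_
      rw [h, hC']
  rw [this]
  refine isClosed_iInter fun z => isClosed_eq ?_ ?_
  · exact (continuous_inner_right z).comp continuous_snd
  · exact (continuous_inner_right (C' z)).comp continuous_fst

/-- The operators `-iν (S - iν)⁻¹` converge strongly to the identity as `|ν| → ∞`. -/
theorem IsResolvent.tendsto {S : Submodule ℂ (E × E)} (hS : Dense {x : E | ∃ y, (x, y) ∈ S})
    {r : ℝ → E →L[ℂ] E} (hr : IsResolvent S r) {ν : ℕ → ℝ} (hν : ∀ n, ν n ≠ 0)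
    (hν' : Tendsto (fun n => |ν n|) atTop atTop) (z : E) :
    Tendsto (fun n => (-(Complex.I * (ν n : ℂ))) • r (ν n) z) atTop (𝓝 z) := by
  have hb : ∀ n z, ‖(-(Complex.I * (ν n : ℂ))) • r (ν n) z‖ ≤ ‖z‖ := by
    intro n z
    rw [norm_smul, norm_neg, norm_mul, Complex.norm_I, one_mul, Complex.norm_real]
    exact hr.norm_le _ (hν n) z
  have hS' : ∀ z s, (z, s) ∈ S →
      Tendsto (fun n => (-(Complex.I * (ν n : ℂ))) • r (ν n) z) atTop (𝓝 z) := by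
    intro z s hz
    rw [tendsto_iff_norm_sub_tendsto_zero]
    have h0 : Tendsto (fun n => ‖s‖ * |ν n|⁻¹) atTop (𝓝 0) := by
      simpa using hν'.inv_tendsto_atTop.const_mul ‖s‖
    refine squeeze_zero (fun n => norm_nonneg _) (fun n => ?_) h0
    have h1 := hr.eq _ (hν n) z s hz
    rw [map_sub, map_smul] at h1
    have h2 : (-(Complex.I * (ν n : ℂ))) • r (ν n) z - z = -r (ν n) s := by
      nth_rewrite 2 [← h1]
      rw [neg_smul]
      abel
    rw [h2, norm_neg, ← div_eq_mul_inv, le_div_iff₀ (abs_pos.2 (hν n)), mul_comm]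
    exact hr.norm_le _ (hν n) s
  rw [Metric.tendsto_atTop]
  intro ε hε
  obtain ⟨z', hd, s, hz'⟩ := Metric.dense_iff.1 hS z (ε / 3) (by positivity)
  rw [Metric.mem_ball, dist_eq_norm] at hd
  obtain ⟨N, hN⟩ := Metric.tendsto_atTop.1 (hS' z' s hz') (ε / 3) (by positivity)
  refine ⟨N, fun n hn => ?_⟩
  have h1 := hN n hn
  have h2 := hb n (z' - z)
  rw [dist_eq_norm] at h1 ⊢
  have h3 : (-(Complex.I * (ν n : ℂ))) • r (ν n) z - z =
      ((-(Complex.I * (ν n : ℂ))) • r (ν n) z' - z') + (z' - z)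
        - (-(Complex.I * (ν n : ℂ))) • r (ν n) (z' - z) := by
    rw [map_sub, smul_sub]
    abel
  rw [h3]
  calc _ ≤ _ := norm_sub_le _ _
    _ ≤ _ := add_le_add (norm_add_le _ _) le_rfl
    _ < ε := by linarith

section Twisted

variable {S T : Submodule ℂ (E × E)} {σ : ℝ} {r : ℝ → E →L[ℂ] E}

/-- The commutation relation `T (S - iν)⁻¹ = (S - iσν)⁻¹ (C + σT)` extends from the core of `T` in
the definition of almost (anti-)commuting pairs to all of `Dom T`. -/
theorem HasTwistedCommutator.exists_adjointable (h : HasTwistedCommutator B σ S T)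
    (hT : IsSelfAdjRegular B T) (hr : IsResolvent S r) (hσ : σ * σ = 1) {ν : ℝ} (hν : ν ≠ 0) :
    ∃ C : E →L[ℂ] E, IsAdjointable B (C : E →ₗ[ℂ] E) ∧ ∀ ξ t, (ξ, t) ∈ T →
      (r ν ξ, r (σ * ν) (C ξ + (σ : ℂ) • t)) ∈ T := by
  obtain ⟨V, hV, h⟩ := h
  obtain ⟨C₀, hC₀, hC₁⟩ := h ν hν
  obtain ⟨C, hC⟩ := hC₀.exists_continuous
  have hσ0 : σ ≠ 0 := by rintro rfl; simp at hσ
  have e : (C : E →ₗ[ℂ] E) = C₀ := LinearMap.ext hC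
  refine ⟨C, by rwa [e], ?_⟩
  let Φ : E × E →L[ℂ] E × E :=
    ((r ν).comp (ContinuousLinearMap.fst ℂ E E)).prod
      ((r (σ * ν)).comp (C.comp (ContinuousLinearMap.fst ℂ E E) +
        (σ : ℂ) • ContinuousLinearMap.snd ℂ E E))
  have hle : T ≤ T.comap Φ.toLinearMap := by
    rw [← hV]
    refine Submodule.topologicalClosure_minimal _ ?_ ?_
    · rintro ⟨ξ, t₀⟩ ⟨hξT, hξ⟩
      obtain ⟨η, s, t, u, v, h1, h2, h3, h4, h5, h6⟩ := hC₁ ξ hξ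
      have e1 : r ν ξ = η := by
        rw [← h5]
        exact hr.eq ν hν _ _ h1
      have e2 : v = t₀ + (Complex.I * (ν : ℂ)) • t := by
        refine hT.eq_of_mem h4 ?_
        have := T.add_mem hξT (T.smul_mem (Complex.I * (ν : ℂ)) h2)
        have e3 : s = ξ + (Complex.I * (ν : ℂ)) • η := by rw [← h5]; abel
        rw [e3]
        exact this
      have e3 : r (σ * ν) (C ξ + (σ : ℂ) • t₀) = t := by
        have := hr.eq (σ * ν) (mul_ne_zero hσ0 hν) _ _ h3
        rw [hC, h6, e2]
        convert this using 2
        push_cast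
        module
      change (r ν ξ, r (σ * ν) (C ξ + (σ : ℂ) • t₀)) ∈ (relRestrict T V).topologicalClosure
      rw [e1, e3, hV]
      exact h2
    · rw [hV]
      exact hT.isClosed.preimage Φ.continuous
  exact fun ξ t ht => hle ht

/-- The operators `C` for different `ν` are determined by the one for `ν = 1`. -/
theorem HasTwistedCommutator.exists_continuous (h : HasTwistedCommutator B σ S T)
    (hT : IsSelfAdjRegular B T) (hr : IsResolvent S r) (hσ : σ * σ = 1) :
    ∃ C : E →L[ℂ] E, ∀ ν : ℝ, ν ≠ 0 → ∀ ξ t, (ξ, t) ∈ T →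
      (r ν ξ, r (σ * ν) (C (ξ + (Complex.I * ((ν : ℂ) - 1)) • r ν ξ) + (σ : ℂ) • t)) ∈ T := by
  have hσ0 : σ ≠ 0 := by rintro rfl; simp at hσ
  obtain ⟨C, -, hC⟩ := h.exists_adjointable hT hr hσ one_ne_zero
  refine ⟨C, fun ν hν ξ t ht => ?_⟩
  obtain ⟨C', -, hC'⟩ := h.exists_adjointable hT hr hσ hν
  have h1 := hC' ξ t ht
  set τ := r (σ * ν) (C' ξ + (σ : ℂ) • t) with hτ
  set ξ' := ξ + (Complex.I * ((ν : ℂ) - 1)) • r ν ξ with hξ'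
  have h2 : (ξ', t + (Complex.I * ((ν : ℂ) - 1)) • τ) ∈ T :=
    T.add_mem ht (T.smul_mem (Complex.I * ((ν : ℂ) - 1)) h1)
  have h3 : r 1 ξ' = r ν ξ := by
    have := hr.eq 1 one_ne_zero _ _ (hr.mem ν hν ξ)
    convert this using 2
    rw [hξ']
    push_cast
    module
  have h4 := hC ξ' _ h2
  rw [h3, mul_one] at h4
  have h5 := hT.eq_of_mem h1 h4
  have h6 := hr.mem σ hσ0 (C ξ' + (σ : ℂ) • (t + (Complex.I * ((ν : ℂ) - 1)) • τ))
  rw [← h5] at h6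
  have h7 := hr.eq (σ * ν) (mul_ne_zero hσ0 hν) _ _ h6
  have h8 : r (σ * ν) (C ξ' + (σ : ℂ) • t) = τ := by
    rw [← h7]
    congr 1
    push_cast
    module
  rw [h8]
  exact h1

/-- Smoothing operators for a twisted pair: `eₙ = -iν (S - iν)⁻¹` with `ν = n + 1` converges
strongly to the identity, commutes with `S`, and `T eₙ x → T x` for `x ∈ Dom T`. -/
theorem HasTwistedCommutator.exists_approx (h : HasTwistedCommutator B σ S T)
    (hS : IsSelfAdjRegular B S) (hT : IsSelfAdjRegular B T) (hσ : σ * σ = 1) :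
    ∃ e : ℕ → E →L[ℂ] E, (∀ z, Tendsto (fun n => e n z) atTop (𝓝 z)) ∧
      (∀ n x s, (x, s) ∈ S → (e n x, e n s) ∈ S) ∧ (∀ n z, e n z ∈ relDom S) ∧
      (∀ n x s, (x, s) ∈ S → x ∈ relDom T → e n s ∈ relDom T) ∧
      ∀ x t, (x, t) ∈ T → ∃ y : ℕ → E, (∀ n, (e n x, y n) ∈ T) ∧ Tendsto y atTop (𝓝 t) := by
  have hσ0 : σ ≠ 0 := by rintro rfl; simp at hσ
  obtain ⟨r, hr⟩ := hS.exists_resolvent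
  obtain ⟨C, hC⟩ := h.exists_continuous hT hr hσ
  let ν : ℕ → ℝ := fun n => n + 1
  have hν : ∀ n, ν n ≠ 0 := fun n => by positivity
  have hν' : Tendsto (fun n => |ν n|) atTop atTop :=
    tendsto_abs_atTop_atTop.comp (tendsto_atTop_add_const_right _ _ tendsto_natCast_atTop_atTop)
  have hσν : ∀ n, σ * ν n ≠ 0 := fun n => mul_ne_zero hσ0 (hν n)
  have hσ1 : |σ| = 1 := by
    have : |σ| * |σ| = 1 := by rw [← abs_mul, hσ, abs_one]
    nlinarith [abs_nonneg σ]
  have hσν' : Tendsto (fun n => |σ * ν n|) atTop atTop := by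
    simpa only [abs_mul, hσ1, one_mul] using hν'
  have hlim := hr.tendsto hS.dense hν hν'
  have hrel : ∀ n x s, (x, s) ∈ S → r (ν n) s = x + (Complex.I * (ν n : ℂ)) • r (ν n) x := by
    intro n x s hx
    have := hr.eq _ (hν n) x s hx
    rw [map_sub, map_smul, sub_eq_iff_eq_add] at this
    exact this
  refine ⟨fun n => (-(Complex.I * (ν n : ℂ))) • r (ν n), hlim, ?_, ?_, ?_, ?_⟩
  · intro n x s hx
    have h1 := S.smul_mem (-(Complex.I * (ν n : ℂ))) (hr.mem _ (hν n) x)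
    have h2 := hrel n x s hx
    rw [← h2] at h1
    exact h1
  · intro n z
    exact mem_relDom.2 ⟨_, S.smul_mem (-(Complex.I * (ν n : ℂ))) (hr.mem _ (hν n) z)⟩
  · intro n x s hx hxT
    refine Submodule.smul_mem _ _ ?_
    obtain ⟨t, ht⟩ := mem_relDom.1 hxT
    change r (ν n) s ∈ _
    rw [hrel n x s hx]
    exact (relDom T).add_mem hxT
      (Submodule.smul_mem _ _ (mem_relDom.2 ⟨_, hC _ (hν n) x t ht⟩))
  · intro x t ht
    refine ⟨_, fun n => T.smul_mem (-(Complex.I * (ν n : ℂ))) (hC _ (hν n) x t ht), ?_⟩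
    -- the argument of `C` tends to zero, and `-iν = σ (-iσν)`
    let w : ℕ → E := fun n => x + (Complex.I * ((ν n : ℂ) - 1)) • r (ν n) x
    have hr0 : Tendsto (fun n => Complex.I • r (ν n) x) atTop (𝓝 0) := by
      have h1 : Tendsto (fun n => ‖x‖ * |ν n|⁻¹) atTop (𝓝 0) := by
        simpa using hν'.inv_tendsto_atTop.const_mul ‖x‖
      refine squeeze_zero_norm (fun n => ?_) h1
      rw [norm_smul, Complex.norm_I, one_mul, ← div_eq_mul_inv, le_div_iff₀ (abs_pos.2 (hν n)),
        mul_comm]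
      exact hr.norm_le _ (hν n) x
    have hw : Tendsto w atTop (𝓝 0) := by
      have h1 := (tendsto_const_nhds (x := x)).sub ((hlim x).add hr0)
      rw [add_zero, sub_self] at h1
      refine h1.congr fun n => ?_
      change _ = x + (Complex.I * ((ν n : ℂ) - 1)) • r (ν n) x
      module
    have hCw : Tendsto (fun n => (σ : ℂ) • (-(Complex.I * ((σ * ν n : ℝ) : ℂ))) •
        r (σ * ν n) (C (w n))) atTop (𝓝 0) := by
      have h1 : Tendsto (fun n => C (w n)) atTop (𝓝 0) := by
        rw [← map_zero C]
        exact (C.continuous.tendsto 0).comp hw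
      refine squeeze_zero_norm (fun n => ?_) (tendsto_norm_zero.comp h1)
      rw [norm_smul, norm_smul, norm_neg, norm_mul, Complex.norm_I, one_mul, Complex.norm_real,
        Complex.norm_real, Real.norm_eq_abs, Real.norm_eq_abs, hσ1, one_mul]
      exact hr.norm_le _ (hσν n) _
    have h2 := hCw.add (hr.tendsto hS.dense hσν hσν' t)
    rw [zero_add] at h2
    refine h2.congr fun n => ?_
    have e : (σ : ℂ) * σ = 1 := by exact_mod_cast hσ
    change _ = (-(Complex.I * (ν n : ℂ))) • r (σ * ν n) (C (w n) + (σ : ℂ) • t)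
    generalize C (w n) = a
    rw [map_add, map_smul, smul_add, smul_smul, smul_smul]
    push_cast
    congr 2
    · linear_combination (-Complex.I * ν n) * e
    · ring

/-- The commutator form: `⟪S y, T x⟫ - σ ⟪T y, S x⟫` on `Dom S ∩ Dom T` is of first order in `S`. -/
theorem HasTwistedCommutator.exists_form_bound (h : HasTwistedCommutator B σ S T)
    (hS : IsSelfAdjRegular B S) (hT : IsSelfAdjRegular B T) (hσ : σ * σ = 1) :
    ∃ κ : ℝ, 0 ≤ κ ∧ ∀ x s t y s' t', (x, s) ∈ S → (x, t) ∈ T → (y, s') ∈ S → (y, t') ∈ T →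
      ‖⟪s', t⟫ - (σ : ℂ) • ⟪t', s⟫‖ ≤ κ * ‖y‖ * (‖s‖ + ‖x‖) := by
  have hσ0 : σ ≠ 0 := by rintro rfl; simp at hσ
  obtain ⟨e, he1, he2, he3, he4, he5⟩ := h.exists_approx hS hT hσ
  obtain ⟨r, hr⟩ := hS.exists_resolvent
  obtain ⟨C, hC⟩ := h.exists_continuous hT hr hσ
  refine ⟨‖C‖, norm_nonneg C, fun x s t y s' t' hxs hxt hys hyt => ?_⟩
  -- the form is first computed on `(S - i)⁻¹ Dom T`
  have key : ∀ x s t, (x, s) ∈ S → (x, t) ∈ T → s ∈ relDom T →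
      ⟪s', t⟫ - (σ : ℂ) • ⟪t', s⟫ = ⟪y, C (s - Complex.I • x)⟫ := by
    intro x s t hxs hxt hsT
    obtain ⟨t₁, ht₁⟩ := mem_relDom.1 hsT
    have h1 : (s - Complex.I • x, t₁ - Complex.I • t) ∈ T :=
      T.sub_mem ht₁ (T.smul_mem Complex.I hxt)
    have h2 := hC 1 one_ne_zero _ _ h1
    have h3 : r 1 (s - Complex.I • x) = x := by
      simpa using hr.eq 1 one_ne_zero x s hxs
    rw [h3, Complex.ofReal_one, sub_self, mul_zero, zero_smul, add_zero, mul_one] at h2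
    have h4 := hr.mem σ hσ0 (C (s - Complex.I • x) + (σ : ℂ) • (t₁ - Complex.I • t))
    rw [← hT.eq_of_mem hxt h2] at h4
    rw [inner_symm_of_le hS.relAdj_eq.ge hys h4, inner_symm_of_le hT.relAdj_eq.ge hyt ht₁]
    simp only [CStarModule.inner_add_right, CStarModule.inner_sub_right,
      CStarModule.inner_smul_right_complex]
    module
  obtain ⟨y', hy1, hy2⟩ := he5 x t hxt
  have hxT : x ∈ relDom T := mem_relDom.2 ⟨t, hxt⟩
  have l1 : Tendsto (fun n => ⟪s', y' n⟫ - (σ : ℂ) • ⟪t', e n s⟫) atTop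
      (𝓝 (⟪s', t⟫ - (σ : ℂ) • ⟪t', s⟫)) :=
    (((continuous_inner_left s').tendsto t).comp hy2).sub
      ((((continuous_inner_left t').tendsto s).comp (he1 s)).const_smul _)
  have l2 : Tendsto (fun n => ⟪y, C (e n s - Complex.I • e n x)⟫) atTop
      (𝓝 ⟪y, C (s - Complex.I • x)⟫) :=
    (((continuous_inner_left (B := B) y).comp C.continuous).tendsto _).comp
      ((he1 s).sub ((he1 x).const_smul Complex.I))
  have l3 := tendsto_nhds_unique l1 (l2.congr fun n =>
    (key _ _ _ (he2 n x s hxs) (hy1 n) (he4 n x s hxs hxT)).symm)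
  rw [l3]
  calc _ ≤ ‖y‖ * ‖C (s - Complex.I • x)‖ := norm_inner_le' _ _
    _ ≤ ‖y‖ * (‖C‖ * (‖s‖ + ‖x‖)) := by
      gcongr
      refine (C.le_opNorm _).trans ?_
      gcongr
      refine (norm_sub_le _ _).trans ?_
      rw [norm_smul, Complex.norm_I, one_mul]
    _ = _ := by ring

/-- `Dom S ∩ Dom T` is a core for `T`. -/
theorem HasTwistedCommutator.core_right (h : HasTwistedCommutator B σ S T)
    (hS : IsSelfAdjRegular B S) (hT : IsSelfAdjRegular B T) (hσ : σ * σ = 1) :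
    (relRestrict T (relDom S)).topologicalClosure = T := by
  refine le_antisymm (Submodule.topologicalClosure_minimal _ inf_le_left hT.isClosed) ?_
  rintro ⟨x, t⟩ hx
  obtain ⟨e, he1, he2, he3, he4, he5⟩ := h.exists_approx hS hT hσ
  obtain ⟨y, hy1, hy2⟩ := he5 x t hx
  exact mem_closure_of_tendsto ((he1 x).prodMk_nhds hy2)
    (Eventually.of_forall fun n => ⟨hy1 n, he3 n x⟩)

/-- `Dom S ∩ Dom T` is a core for `S`. -/
theorem HasTwistedCommutator.core_left (h : HasTwistedCommutator B σ S T)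
    (hS : IsSelfAdjRegular B S) (hT : IsSelfAdjRegular B T) (hσ : σ * σ = 1) :
    (relRestrict S (relDom T)).topologicalClosure = S := by
  refine le_antisymm (Submodule.topologicalClosure_minimal _ inf_le_left hS.isClosed) ?_
  rintro ⟨x, s⟩ hx
  obtain ⟨r, hr⟩ := hS.exists_resolvent
  obtain ⟨C, hC⟩ := h.exists_continuous hT hr hσ
  let f : E → E × E := fun z => (r 1 z, z + (Complex.I * ((1 : ℝ) : ℂ)) • r 1 z)
  have hf : Continuous f := by fun_prop
  have h1 := map_mem_closure hf (hT.dense (s - (Complex.I * ((1 : ℝ) : ℂ)) • x))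
    (t := relRestrict S (relDom T)) ?_
  · have h2 : f (s - (Complex.I * ((1 : ℝ) : ℂ)) • x) = (x, s) := by
      change (_, _) = _
      rw [hr.eq 1 one_ne_zero x s hx, sub_add_cancel]
    rw [h2] at h1
    exact h1
  · rintro z ⟨t, ht⟩
    exact ⟨hr.mem 1 one_ne_zero z, mem_relDom.2 ⟨_, hC 1 one_ne_zero z t ht⟩⟩

/-- The graph norms of `S`, `T` on `Dom S ∩ Dom T` are controlled by that of `S + c T`. The condition
on `c` means `c = ±i` for commutators and `c = ±1` for anti-commutators: then the mixed terms of
`⟪(S + c T) x, (S + c T) x⟫` are a multiple of the commutator form, of lower order. -/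
theorem HasTwistedCommutator.exists_norm_bound (h : HasTwistedCommutator B σ S T)
    (hS : IsSelfAdjRegular B S) (hT : IsSelfAdjRegular B T) (hσ : σ * σ = 1) :
    ∃ M : ℝ, 0 ≤ M ∧ ∀ c : ℂ, star c = -(σ : ℂ) * c → ‖c‖ = 1 →
      ∀ x s t, (x, s) ∈ S → (x, t) ∈ T →
        ‖s‖ ≤ M * (‖x‖ + ‖s + c • t‖) ∧ ‖t‖ ≤ M * (‖x‖ + ‖s + c • t‖) := by
  obtain ⟨κ, hκ, hq⟩ := h.exists_form_bound hS hT hσ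
  refine ⟨κ + 2, by positivity, fun c hc hc1 x s t hs ht => ?_⟩
  have hcc : star c * c = 1 := by
    rw [Complex.star_def, mul_comm, Complex.mul_conj, Complex.normSq_eq_norm_sq, hc1]
    simp
  have e1 : ⟪s + c • t, s + c • t⟫ - c • (⟪s, t⟫ - (σ : ℂ) • ⟪t, s⟫) = ⟪s, s⟫ + ⟪t, t⟫ := by
    simp only [CStarModule.inner_add_right, CStarModule.inner_add_left,
      CStarModule.inner_smul_right_complex, CStarModule.inner_smul_left_complex]
    have : c • star c • ⟪t, t⟫ = ⟪t, t⟫ := by rw [smul_smul, mul_comm, hcc, one_smul]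
    rw [smul_add, this, hc]
    module
  have e2 : ‖s‖ ^ 2 ≤ ‖s + c • t‖ ^ 2 + κ * ‖x‖ * (‖s‖ + ‖x‖) := by
    calc _ ≤ ‖⟪s, s⟫ + ⟪t, t⟫‖ := norm_sq_le_of_inner_add s CStarModule.inner_self_nonneg
      _ ≤ _ := by
        rw [← e1]
        refine (norm_sub_le _ _).trans ?_
        rw [norm_inner_self_eq, norm_smul, hc1, one_mul]
        gcongr
        exact hq x s t x s t hs ht hs ht
  have e3 : ‖s‖ ≤ ‖s + c • t‖ + (κ + 1) * ‖x‖ := by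
    by_contra hcon
    push Not at hcon
    have a1 := norm_nonneg x
    have a2 := norm_nonneg (s + c • t)
    nlinarith [mul_nonneg hκ a1, mul_nonneg a1 a2, mul_nonneg (mul_nonneg hκ a1) a2,
      mul_nonneg (mul_nonneg hκ a1) a1, norm_nonneg s]
  have e4 : ‖t‖ ≤ ‖s + c • t‖ + ‖s‖ := by
    have : ‖t‖ = ‖c • t‖ := by rw [norm_smul, hc1, one_mul]
    rw [this]
    calc _ = ‖(s + c • t) - s‖ := by congr 1; abel
      _ ≤ _ := norm_sub_le _ _
  have a1 := norm_nonneg x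
  have a2 := norm_nonneg (s + c • t)
  constructor <;> nlinarith [mul_nonneg hκ a1, mul_nonneg hκ a2]

/-- The operator `S + c T` is closed on `Dom S ∩ Dom T`. -/
theorem HasTwistedCommutator.isClosed_relComb (h : HasTwistedCommutator B σ S T)
    (hS : IsSelfAdjRegular B S) (hT : IsSelfAdjRegular B T) (hσ : σ * σ = 1) {c : ℂ}
    (hc : star c = -(σ : ℂ) * c) (hc1 : ‖c‖ = 1) :
    IsClosed (relComb S T c : Set (E × E)) := by
  obtain ⟨M, hM, hb⟩ := h.exists_norm_bound hS hT hσ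
  let P : Submodule ℂ (E × E × E) :=
    { carrier := {p | (p.1, p.2.1) ∈ S ∧ (p.1, p.2.2) ∈ T}
      zero_mem' := ⟨S.zero_mem, T.zero_mem⟩
      add_mem' := fun hp hq => ⟨S.add_mem hp.1 hq.1, T.add_mem hp.2 hq.2⟩
      smul_mem' := fun c _ hp => ⟨S.smul_mem c hp.1, T.smul_mem c hp.2⟩ }
  have hP : IsClosed (P : Set (E × E × E)) := by
    have h1 : IsClosed {p : E × E × E | (p.1, p.2.1) ∈ S} := hS.isClosed.preimage (by fun_prop)
    have h2 : IsClosed {p : E × E × E | (p.1, p.2.2) ∈ T} := hT.isClosed.preimage (by fun_prop)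
    exact h1.inter h2
  have : CompleteSpace P := hP.completeSpace_coe
  let f : P →L[ℂ] E × E :=
    ((ContinuousLinearMap.fst ℂ E (E × E)).prod
      ((ContinuousLinearMap.fst ℂ E E + c • ContinuousLinearMap.snd ℂ E E).comp
        (ContinuousLinearMap.snd ℂ E (E × E)))).comp P.subtypeL
  have hf : AntilipschitzWith (2 * M + 1).toNNReal f := by
    refine AddMonoidHomClass.antilipschitz_of_bound f ?_
    rintro ⟨⟨x, s, t⟩, hs, ht⟩
    obtain ⟨h1, h2⟩ := hb c hc hc1 x s t hs ht
    rw [Real.coe_toNNReal _ (by positivity)]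
    change max ‖x‖ (max ‖s‖ ‖t‖) ≤ (2 * M + 1) * max ‖x‖ ‖s + c • t‖
    have m1 := le_max_left ‖x‖ ‖s + c • t‖
    have m2 := le_max_right ‖x‖ ‖s + c • t‖
    have m0 := norm_nonneg x
    refine max_le ?_ (max_le ?_ ?_) <;>
      nlinarith [mul_le_mul_of_nonneg_left m1 hM, mul_le_mul_of_nonneg_left m2 hM]
  have hrange : (relComb S T c : Set (E × E)) = Set.range f := by
    refine Set.ext fun p => ?_
    obtain ⟨x, d⟩ := p
    constructor
    · rintro ⟨s, t, hs, ht, hd⟩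
      exact ⟨⟨(x, s, t), hs, ht⟩, Prod.ext rfl hd.symm⟩
    · rintro ⟨⟨⟨x, s, t⟩, hs, ht⟩, hp⟩
      rw [Prod.ext_iff] at hp
      obtain ⟨rfl, rfl⟩ := hp
      exact ⟨s, t, hs, ht, rfl⟩
  rw [hrange]
  exact hf.isClosed_range f.uniformContinuous

end Twisted

end Pairs

/-! ### The Cartesian decomposition and the Wick rotations -/

/-- The method of continuity for operators between two Banach spaces. -/
theorem surjective_of_bound_segment_of_bijective {X Y : Type*} [NormedAddCommGroup X] [NormedSpace ℂ X]
    [CompleteSpace X] [NormedAddCommGroup Y] [NormedSpace ℂ Y] [CompleteSpace Y]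
    (A C : X →L[ℂ] Y) (hC : Function.Bijective C) {k : ℝ} (hk : 0 < k)
    (h : ∀ s : ℝ, 0 ≤ s → s ≤ 1 → ∀ x, k * ‖C x‖ ≤ ‖(s : ℂ) • A x + C x‖) :
    Function.Surjective (A + C) := by
  let e : X ≃L[ℂ] Y := ContinuousLinearEquiv.ofBijective C
    (LinearMap.ker_eq_bot.2 hC.1) (LinearMap.range_eq_top.2 hC.2)
  have he : ∀ y, C (e.symm y) = y := fun y => e.apply_symm_apply y
  have h1 := surjective_of_bound_segment (A.comp e.symm.toContinuousLinearMap) 1 isUnit_one hk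
    (fun s h0 h1 y => by simpa [he] using h s h0 h1 (e.symm y))
  intro y
  obtain ⟨y', hy'⟩ := h1 y
  refine ⟨e.symm y', ?_⟩
  rw [← hy']
  simp [he]

section Cartesian

variable (B : Type*) {E : Type*} [NonUnitalCStarAlgebra B] [PartialOrder B] [StarOrderedRing B]
  [NormedAddCommGroup E] [NormedSpace ℂ E] [SMul Bᵐᵒᵖ E] [CStarModule Bᵐᵒᵖ E]

local notation "⟪" x "," y "⟫" => inner Bᵐᵒᵖ x y

/-- The Cartesian decomposition `D = S + iT`, `D* = S - iT` of a regular operator `D`, with common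
domain `Dom S ∩ Dom T`, in terms of the graphs of an almost commuting pair `S`, `T`. -/
structure IsCartesian (D : E →ₗ.[ℂ] E) (S T : Submodule ℂ (E × E)) : Prop where
  regular : IsRegular B D
  left : IsSelfAdjRegular B S
  right : IsSelfAdjRegular B T
  commutator : HasTwistedCommutator B 1 S T
  graph_eq : D.graph = relComb S T Complex.I
  adj_eq : relAdj B D.graph = relComb S T (-Complex.I)

variable {B}

theorem relComb_le_relAdj {S T : Submodule ℂ (E × E)} (hS : S ≤ relAdj B S) (hT : T ≤ relAdj B T)
    (c : ℂ) : relComb S T (star c) ≤ relAdj B (relComb S T c) := by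
  rintro ⟨y, w⟩ ⟨s', t', hs', ht', hw⟩ ⟨x, d⟩ ⟨s, t, hs, ht, hd⟩
  change w = s' + star c • t' at hw
  change d = s + c • t at hd
  have h1 := hS hs' _ hs
  have h2 := hT ht' _ ht
  subst hw hd
  simp only [CStarModule.inner_add_right, CStarModule.inner_add_left,
    CStarModule.inner_smul_right_complex, CStarModule.inner_smul_left_complex, star_star]
  rw [h1, h2]

variable [CompleteSpace E]

/-- Two inclusions suffice for a Cartesian decomposition: taking adjoints exchanges them and reverses
their direction. -/
theorem isCartesian_of_le {D : E →ₗ.[ℂ] E} {S T : Submodule ℂ (E × E)} (hD : IsRegular B D)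
    (hS : IsSelfAdjRegular B S) (hT : IsSelfAdjRegular B T) (h : HasTwistedCommutator B 1 S T)
    (h1 : D.graph ≤ relComb S T Complex.I) (h2 : relAdj B D.graph ≤ relComb S T (-Complex.I)) :
    IsCartesian B D S T := by
  have hI : star Complex.I = -Complex.I := Complex.conj_I
  have hI' : star (-Complex.I) = Complex.I := by rw [star_neg, hI, neg_neg]
  refine ⟨hD, hS, hT, h, le_antisymm h1 ?_, le_antisymm h2 ?_⟩
  · rw [← hD.relAdj_relAdj]
    refine le_trans ?_ (relAdj_anti h2)
    have := relComb_le_relAdj hS.relAdj_eq.ge hT.relAdj_eq.ge (-Complex.I)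
    rwa [hI'] at this
  · refine le_trans ?_ (relAdj_anti h1)
    have := relComb_le_relAdj hS.relAdj_eq.ge hT.relAdj_eq.ge Complex.I
    rwa [hI] at this

theorem norm_le_norm_of_add {a b : Bᵐᵒᵖ} (ha : 0 ≤ a) (hb : 0 ≤ b) : ‖a‖ ≤ ‖a + b‖ :=
  CStarAlgebra.norm_le_norm_of_nonneg_of_le ha (le_add_of_nonneg_right hb)

theorem norm_sub_star_le (a : Bᵐᵒᵖ) : ‖a - star a‖ ≤ 2 * ‖a‖ := by
  refine (norm_sub_le _ _).trans ?_
  rw [norm_star]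
  linarith

variable {D : E →ₗ.[ℂ] E} {S T : Submodule ℂ (E × E)}

/-- `Dom D* D` as a Banach space: the tuples `(x, S x, T x, D* D x)`. -/
def secondOrderDomain (D : E →ₗ.[ℂ] E) (S T : Submodule ℂ (E × E)) :
    Submodule ℂ (E × E × E × E) where
  carrier := {p | (p.1, p.2.1) ∈ S ∧ (p.1, p.2.2.1) ∈ T ∧
    (p.2.1 + Complex.I • p.2.2.1, p.2.2.2) ∈ relAdj B D.graph}
  zero_mem' := ⟨S.zero_mem, T.zero_mem, by
    have := (relAdj B D.graph).zero_mem
    simp only [Prod.snd_zero, Prod.fst_zero, smul_zero, add_zero]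
    exact this⟩
  add_mem' := by
    rintro p q ⟨h1, h2, h3⟩ ⟨h1', h2', h3'⟩
    refine ⟨S.add_mem h1 h1', T.add_mem h2 h2', ?_⟩
    have := (relAdj B D.graph).add_mem h3 h3'
    convert this using 1
    refine Prod.ext ?_ rfl
    simp only [Prod.mk_add_mk, Prod.snd_add, Prod.fst_add, smul_add]
    abel
  smul_mem' := by
    rintro c p ⟨h1, h2, h3⟩
    refine ⟨S.smul_mem c h1, T.smul_mem c h2, ?_⟩
    have := (relAdj B D.graph).smul_mem c h3
    convert this using 1
    refine Prod.ext ?_ rfl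
    simp only [Prod.smul_mk, Prod.smul_snd, Prod.smul_fst, smul_add, smul_comm c]

/-- Elliptic regularisation: for `H = S + τT` and `Δ = 1 + D* D`, the operator
`H + iλμ + iλεΔ` is surjective on `Dom D* D`. -/
theorem IsCartesian.exists_regularised (h : IsCartesian B D S T) {τ l μ ε : ℝ}
    (hτ : |τ| = 1) (hl : |l| = 1) (hμ : 0 ≤ μ) (hε : 0 < ε) (z : E) :
    ∃ x s t w, (x, s) ∈ S ∧ (x, t) ∈ T ∧ (s + Complex.I • t, w) ∈ relAdj B D.graph ∧
      s + (τ : ℂ) • t + (Complex.I * l * μ : ℂ) • x + (Complex.I * l * ε : ℂ) • (x + w) = z := by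
  obtain ⟨M, hM, hb⟩ := h.commutator.exists_norm_bound h.left h.right (by norm_num)
  have hI : star Complex.I = -((1 : ℝ) : ℂ) * Complex.I := by simp
  let X : Submodule ℂ (E × E × E × E) := secondOrderDomain (B := B) D S T
  have hX : IsClosed (X : Set (E × E × E × E)) := by
    have h1 : IsClosed {p : E × E × E × E | (p.1, p.2.1) ∈ S} :=
      h.left.isClosed.preimage (by fun_prop)
    have h2 : IsClosed {p : E × E × E × E | (p.1, p.2.2.1) ∈ T} :=
      h.right.isClosed.preimage (by fun_prop)
    have h3 : IsClosed {p : E × E × E × E |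
        (p.2.1 + Complex.I • p.2.2.1, p.2.2.2) ∈ relAdj B D.graph} :=
      (isClosed_relAdj D.graph).preimage (by fun_prop)
    exact h1.inter (h2.inter h3)
  have : CompleteSpace X := hX.completeSpace_coe
  let fx : X →L[ℂ] E := (ContinuousLinearMap.fst ℂ E (E × E × E)).comp X.subtypeL
  let f' : X →L[ℂ] E × E × E := (ContinuousLinearMap.snd ℂ E (E × E × E)).comp X.subtypeL
  let fs : X →L[ℂ] E := (ContinuousLinearMap.fst ℂ E (E × E)).comp f'
  let ft : X →L[ℂ] E :=
    (ContinuousLinearMap.fst ℂ E E).comp ((ContinuousLinearMap.snd ℂ E (E × E)).comp f')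
  let fw : X →L[ℂ] E :=
    (ContinuousLinearMap.snd ℂ E E).comp ((ContinuousLinearMap.snd ℂ E (E × E)).comp f')
  let A : X →L[ℂ] E := fs + (τ : ℂ) • ft + (Complex.I * l * μ : ℂ) • fx
  let C : X →L[ℂ] E := (Complex.I * l * ε : ℂ) • (fx + fw)
  have hl0 : l ≠ 0 := by rintro rfl; simp at hl
  have hc0 : (Complex.I * l * ε : ℂ) ≠ 0 := by
    simp [hl0, hε.ne']
  have hgr : ∀ {x s t}, (x, s) ∈ S → (x, t) ∈ T → (x, s + Complex.I • t) ∈ D.graph := by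
    intro x s t hs ht
    rw [h.graph_eq]
    exact ⟨s, t, hs, ht, rfl⟩
  -- `⟪x, (1 + D* D) x⟫ = ⟪x, x⟫ + ⟪D x, D x⟫`
  have hxu : ∀ {x s t w}, (x, s) ∈ S → (x, t) ∈ T → (s + Complex.I • t, w) ∈ relAdj B D.graph →
      ⟪x, x + w⟫ = ⟪x, x⟫ + ⟪s + Complex.I • t, s + Complex.I • t⟫ ∧
      ⟪x + w, x⟫ = ⟪x, x⟫ + ⟪s + Complex.I • t, s + Complex.I • t⟫ := by
    intro x s t w hs ht hw
    have h1 := hw _ (hgr hs ht)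
    have h2 := congrArg star h1
    simp only [CStarModule.star_inner] at h1 h2
    rw [h1, CStarModule.inner_add_right, CStarModule.inner_add_left, ← h2, ← h1]
    exact ⟨rfl, rfl⟩
  have hC : Function.Bijective C := by
    constructor
    · rw [injective_iff_map_eq_zero]
      rintro ⟨⟨x, s, t, w⟩, hs, ht, hw⟩ h0
      have h1 : x + w = 0 := (smul_eq_zero.1 h0).resolve_left hc0
      have h2 := (hxu hs ht hw).1
      rw [h1, CStarModule.inner_zero_right] at h2
      have hx : x = 0 := by
        refine inner_self_eq_zero' (B := B) (le_antisymm ?_ CStarModule.inner_self_nonneg)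
        rw [h2]
        exact le_add_of_nonneg_right CStarModule.inner_self_nonneg
      subst hx
      have hs0 := h.left.eq_of_mem hs S.zero_mem
      have ht0 := h.right.eq_of_mem ht T.zero_mem
      have hw0 : w = 0 := by simpa using h1
      subst hs0 ht0 hw0
      rfl
    · intro z
      obtain ⟨x, d, w, hx, hw, hz⟩ := h.regular.exists_add_adj ((Complex.I * l * ε : ℂ)⁻¹ • z)
      rw [h.graph_eq] at hx
      obtain ⟨s, t, hs, ht, hd⟩ := hx
      change d = s + Complex.I • t at hd
      rw [hd] at hw
      refine ⟨⟨(x, s, t, w), hs, ht, hw⟩, ?_⟩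
      change (Complex.I * l * ε : ℂ) • (x + w) = z
      rw [← hz, smul_inv_smul₀ hc0]
  have hsurj := surjective_of_bound_segment_of_bijective A C hC
    (k := (1 + (4 * M + μ) / ε)⁻¹) (by positivity) ?_
  · obtain ⟨⟨⟨x, s, t, w⟩, hs, ht, hw⟩, hz⟩ := hsurj z
    exact ⟨x, s, t, w, hs, ht, hw, hz⟩
  · rintro q hq0 hq1 ⟨⟨x, s, t, w⟩, hs, ht, hw⟩
    replace hs : (x, s) ∈ S := hs
    replace ht : (x, t) ∈ T := ht
    replace hw : (s + Complex.I • t, w) ∈ relAdj B D.graph := hw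
    set d := s + Complex.I • t with hd
    obtain ⟨b1, b2⟩ := hb Complex.I hI Complex.norm_I x s t hs ht
    rw [← hd] at b1 b2
    obtain ⟨u1, u2⟩ := hxu hs ht hw
    rw [← hd] at u1 u2
    set z' := (q : ℂ) • (s + (τ : ℂ) • t + (Complex.I * l * μ : ℂ) • x)
      + (Complex.I * l * ε : ℂ) • (x + w) with hz'
    change _ * ‖(Complex.I * l * ε : ℂ) • (x + w)‖ ≤ ‖z'‖
    have e0 : ∀ (a : ℝ), star (Complex.I * l * a : ℂ) = -(Complex.I * l * a : ℂ) := by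
      intro a; simp
    have e00 : ∀ (a : ℝ), star (a : ℂ) = (a : ℂ) := fun a => Complex.conj_ofReal a
    -- `S + τT` contributes a self-adjoint term to `⟪x, z'⟫`. The anti-self-adjoint part bounds the graph
    -- norm of `x` for `D`, and hence `S x` and `T x`, by `z'`.
    have e1 : ⟪x, z'⟫ - star ⟪x, z'⟫ = (2 * Complex.I * l : ℂ) •
        (((ε : ℝ) : ℂ) • ⟪x, x⟫ + ((ε : ℝ) : ℂ) • ⟪d, d⟫ + ((q * μ : ℝ) : ℂ) • ⟪x, x⟫) := by
      have s1 := inner_symm_of_le h.left.relAdj_eq.ge hs hs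
      have s2 := inner_symm_of_le h.right.relAdj_eq.ge ht ht
      rw [CStarModule.star_inner, hz']
      simp only [CStarModule.inner_add_right (z := (Complex.I * l * ε : ℂ) • (x + w)),
        CStarModule.inner_add_left (y := (Complex.I * l * ε : ℂ) • (x + w)),
        CStarModule.inner_smul_right_complex, CStarModule.inner_smul_left_complex, u1, u2]
      simp only [CStarModule.inner_add_right, CStarModule.inner_add_left,
        CStarModule.inner_smul_right_complex, CStarModule.inner_smul_left_complex, s1, s2, e0, e00]
      push_cast
      module
    have e2 : ‖((ε : ℝ) : ℂ) • ⟪x, x⟫ + ((ε : ℝ) : ℂ) • ⟪d, d⟫ + ((q * μ : ℝ) : ℂ) • ⟪x, x⟫‖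
        ≤ ‖x‖ * ‖z'‖ := by
      have h1 := norm_sub_star_le (B := B) ⟪x, z'⟫
      rw [e1, norm_smul] at h1
      have h2 : ‖(2 * Complex.I * l : ℂ)‖ = 2 := by simp [hl]
      rw [h2] at h1
      have h3 := norm_inner_le' (B := B) x z'
      linarith
    have p1 := smul_inner_self_nonneg (B := B) hε.le x
    have p2 := smul_inner_self_nonneg (B := B) hε.le d
    have p3 := smul_inner_self_nonneg (B := B) (mul_nonneg hq0 hμ) x
    have n1 : ε * ‖x‖ ^ 2 ≤ ‖x‖ * ‖z'‖ := by
      rw [← norm_smul_inner_self (B := B) hε.le]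
      refine le_trans ?_ e2
      rw [add_assoc]
      exact norm_le_norm_of_add p1 (add_nonneg p2 p3)
    have n2 : ε * ‖d‖ ^ 2 ≤ ‖x‖ * ‖z'‖ := by
      rw [← norm_smul_inner_self (B := B) hε.le]
      refine le_trans ?_ e2
      rw [add_comm (_ • ⟪x, x⟫), add_assoc]
      exact norm_le_norm_of_add p2 (add_nonneg p1 p3)
    have n0 := norm_nonneg x
    have nz := norm_nonneg z'
    have n3 : ‖x‖ ≤ ‖z'‖ / ε := by
      rw [le_div_iff₀ hε]
      by_contra hcon
      push Not at hcon
      nlinarith [norm_nonneg x]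
    have n4 : ‖d‖ ≤ ‖z'‖ / ε := by
      refine le_of_sq_le_sq ?_ (by positivity)
      rw [div_pow, le_div_iff₀ (by positivity)]
      rw [le_div_iff₀ hε] at n3
      nlinarith
    have n5 : ‖(Complex.I * l * ε : ℂ) • (x + w)‖ ≤ ‖z'‖ + (‖s‖ + ‖t‖ + μ * ‖x‖) := by
      have : (Complex.I * l * ε : ℂ) • (x + w) = z' -
          (q : ℂ) • (s + (τ : ℂ) • t + (Complex.I * l * μ : ℂ) • x) := by rw [hz']; abel
      rw [this]
      refine (norm_sub_le _ _).trans (add_le_add le_rfl ?_)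
      rw [norm_smul, Complex.norm_real, Real.norm_of_nonneg hq0]
      refine (mul_le_of_le_one_left (norm_nonneg _) hq1).trans ?_
      refine (norm_add_le _ _).trans (add_le_add ((norm_add_le _ _).trans ?_) ?_)
      · rw [norm_smul, Complex.norm_real, Real.norm_eq_abs, hτ, one_mul]
      · rw [norm_smul]
        simp [hl, abs_of_nonneg hμ]
    rw [inv_mul_le_iff₀ (by positivity)]
    calc _ ≤ _ := n5
      _ ≤ ‖z'‖ + (M * (‖z'‖ / ε + ‖z'‖ / ε) + M * (‖z'‖ / ε + ‖z'‖ / ε) + μ * (‖z'‖ / ε)) := by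
        gcongr
        · exact b1.trans (by gcongr)
        · exact b2.trans (by gcongr)
      _ = _ := by ring

/-- The commutator estimate for the regularised equation, obtained from its inner product with
`u = (1 + D* D) x`. In `⟪u, (S + τT) x⟫` all terms are self-adjoint, except for a value of the
commutator form, of norm at most `K ‖⟪x, x⟫ + ⟪D x, D x⟫‖` with `K = 2κ(2M + 1)`. The shift
`μ = K + 1` is chosen such that the term `μ ⟪u, x⟫ = μ (⟪x, x⟫ + ⟪D x, D x⟫)` absorbs it. -/
theorem IsCartesian.norm_regularised (h : IsCartesian B D S T) {M κ : ℝ} (hM : 0 ≤ M)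
    (hb : ∀ c : ℂ, star c = -((1 : ℝ) : ℂ) * c → ‖c‖ = 1 →
      ∀ x s t, (x, s) ∈ S → (x, t) ∈ T →
        ‖s‖ ≤ M * (‖x‖ + ‖s + c • t‖) ∧ ‖t‖ ≤ M * (‖x‖ + ‖s + c • t‖)) (hκ : 0 ≤ κ)
    (hq : ∀ x s t y s' t', (x, s) ∈ S → (x, t) ∈ T → (y, s') ∈ S → (y, t') ∈ T →
      ‖⟪s', t⟫ - ((1 : ℝ) : ℂ) • ⟪t', s⟫‖ ≤ κ * ‖y‖ * (‖s‖ + ‖x‖)) {τ l ε : ℝ}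
    (hτ : |τ| = 1) (hl : |l| = 1) (hε : 0 < ε) {z dz x s t w : E} (hz : (z, dz) ∈ D.graph)
    (hs : (x, s) ∈ S) (ht : (x, t) ∈ T) (hw : (s + Complex.I • t, w) ∈ relAdj B D.graph)
    (hx : s + (τ : ℂ) • t + (Complex.I * l * ((2 * κ * (2 * M + 1) + 1 : ℝ) : ℂ) : ℂ) • x
      + (Complex.I * l * ε : ℂ) • (x + w) = z) :
    ε * ‖x + w‖ ^ 2 ≤ (2 * κ * (2 * M + 1) + 1) * (‖z‖ + ‖dz‖) ^ 2 := by
  set K : ℝ := 2 * κ * (2 * M + 1) with hK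
  have hK0 : 0 ≤ K := by positivity
  have hI : star Complex.I = -((1 : ℝ) : ℂ) * Complex.I := by simp
  have hI' : star Complex.I = -Complex.I := Complex.conj_I
  obtain ⟨b1, b2⟩ := hb Complex.I hI Complex.norm_I x s t hs ht
  set d := s + Complex.I • t with hd
  have hxd : (x, d) ∈ D.graph := by
    rw [h.graph_eq]
    exact ⟨s, t, hs, ht, rfl⟩
  obtain ⟨s', t', hs', ht', hw'⟩ : (d, w) ∈ relComb S T (-Complex.I) := h.adj_eq ▸ hw
  change (d, s') ∈ S at hs'
  change (d, t') ∈ T at ht'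
  change w = s' + (-Complex.I) • t' at hw'
  have q1 := hq x s t d s' t' hs ht hs' ht'
  set Q := ⟪s', t⟫ - ((1 : ℝ) : ℂ) • ⟪t', s⟫ with hQ
  have w1 := hw _ hxd
  have w1' := congrArg star w1
  have w2 := hw _ hz
  have w2' := congrArg star w2
  simp only [CStarModule.star_inner] at w1 w1' w2 w2'
  have s1 := inner_symm_of_le h.left.relAdj_eq.ge hs hs
  have s2 := inner_symm_of_le h.right.relAdj_eq.ge ht ht
  have s3 := inner_symm_of_le h.left.relAdj_eq.ge hs' hs'
  have s4 := inner_symm_of_le h.right.relAdj_eq.ge ht' ht'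
  have e0 : ∀ (a : ℝ), star (Complex.I * l * a : ℂ) = -(Complex.I * l * a : ℂ) := by
    intro a; simp
  have e00 : ∀ (a : ℝ), star (a : ℂ) = (a : ℂ) := fun a => Complex.conj_ofReal a
  -- the two sides of the equation, paired with `u = (1 + D* D) x`
  have c1 : ⟪x + w, z⟫ = ⟪x, z⟫ + ⟪d, dz⟫ := by rw [CStarModule.inner_add_left, ← w2]
  have c2 : ⟪x + w, x⟫ = ⟪x, x⟫ + ⟪d, d⟫ := by rw [CStarModule.inner_add_left, ← w1]
  have c3 : ⟪w, s + (τ : ℂ) • t⟫ = ⟪s' + (τ : ℂ) • t', d⟫ + ((τ : ℂ) - Complex.I) • Q := by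
    rw [hw', hd, hQ]
    simp only [CStarModule.inner_add_right, CStarModule.inner_add_left,
      CStarModule.inner_smul_right_complex, CStarModule.inner_smul_left_complex, e00, star_neg, hI',
      Complex.ofReal_one, one_smul]
    module
  have c4 : star ⟪s' + (τ : ℂ) • t', d⟫ = ⟪s' + (τ : ℂ) • t', d⟫ := by
    rw [CStarModule.star_inner]
    simp only [CStarModule.inner_add_right, CStarModule.inner_add_left,
      CStarModule.inner_smul_right_complex, CStarModule.inner_smul_left_complex, e00, s3, s4]
  have c5 : star ⟪x, s + (τ : ℂ) • t⟫ = ⟪x, s + (τ : ℂ) • t⟫ := by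
    rw [CStarModule.star_inner]
    simp only [CStarModule.inner_add_right, CStarModule.inner_add_left,
      CStarModule.inner_smul_right_complex, CStarModule.inner_smul_left_complex, e00, s1, s2]
  set b := ((τ : ℂ) - Complex.I) • Q with hb'
  set P := ((K + 1 : ℝ) : ℂ) • (⟪x, x⟫ + ⟪d, d⟫) + ((ε : ℝ) : ℂ) • ⟪x + w, x + w⟫ with hP
  have c6 : ⟪x + w, z⟫ = ⟪x, s + (τ : ℂ) • t⟫ + (⟪s' + (τ : ℂ) • t', d⟫ + b)
      + (Complex.I * l) • P := by
    rw [← c3, ← hx, hP, ← c2]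
    simp only [CStarModule.inner_add_right (x := x + w), CStarModule.inner_smul_right_complex]
    rw [CStarModule.inner_add_left (y := w) (z := s), CStarModule.inner_add_left (y := w) (z := t)]
    simp only [CStarModule.inner_add_right (x := x), CStarModule.inner_add_right (x := w),
      CStarModule.inner_smul_right_complex]
    module
  have hPs : star P = P := by
    rw [hP]
    simp only [star_add, star_smul, CStarModule.star_inner, e00]
  -- the anti-self-adjoint part of the equation
  have c7 : (2 * Complex.I * l : ℂ) • P = (⟪x, z⟫ - star ⟪x, z⟫) + (⟪d, dz⟫ - star ⟪d, dz⟫)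
      - (b - star b) := by
    have h1 : ⟪x, z⟫ + ⟪d, dz⟫ = _ := c1.symm.trans c6
    have h2 := congrArg star h1
    simp only [star_add, star_smul, c4, c5, hPs] at h2
    have h3 : star (Complex.I * l : ℂ) = -(Complex.I * l : ℂ) := by simp
    rw [h3] at h2
    have h4 : (⟪x, z⟫ - star ⟪x, z⟫) + (⟪d, dz⟫ - star ⟪d, dz⟫)
        = (⟪x, z⟫ + ⟪d, dz⟫) - (star ⟪x, z⟫ + star ⟪d, dz⟫) := by abel
    rw [h4, h1, h2]
    module
  set n := √‖⟪x, x⟫ + ⟪d, d⟫‖ with hn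
  have hn2 : n ^ 2 = ‖⟪x, x⟫ + ⟪d, d⟫‖ := Real.sq_sqrt (norm_nonneg _)
  have hn0 : 0 ≤ n := Real.sqrt_nonneg _
  have n1 : ‖x‖ ≤ n := by
    refine le_of_sq_le_sq ?_ hn0
    rw [hn2]
    exact norm_sq_le_of_inner_add x CStarModule.inner_self_nonneg
  have n2 : ‖d‖ ≤ n := by
    refine le_of_sq_le_sq ?_ hn0
    rw [hn2, add_comm]
    exact norm_sq_le_of_inner_add d CStarModule.inner_self_nonneg
  have n3 : ‖b‖ ≤ K * n ^ 2 := by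
    rw [hb', norm_smul]
    have h1 : ‖(τ : ℂ) - Complex.I‖ ≤ 2 := by
      refine (norm_sub_le _ _).trans ?_
      rw [Complex.norm_real, Real.norm_eq_abs, hτ, Complex.norm_I]
      norm_num
    calc _ ≤ 2 * (κ * n * (M * (n + n) + n)) := by
          gcongr
          refine q1.trans ?_
          gcongr
          exact b1.trans (by gcongr)
      _ = _ := by rw [hK]; ring
  have n4 : ‖P‖ ≤ n * (‖z‖ + ‖dz‖) + K * n ^ 2 := by
    have h1 : ‖(2 * Complex.I * l : ℂ) • P‖ = 2 * ‖P‖ := by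
      rw [norm_smul]
      simp [hl]
    have h2 : ‖(2 * Complex.I * l : ℂ) • P‖ ≤
        2 * ‖⟪x, z⟫‖ + 2 * ‖⟪d, dz⟫‖ + 2 * ‖b‖ := by
      rw [c7]
      refine (norm_sub_le _ _).trans (add_le_add ((norm_add_le _ _).trans (add_le_add ?_ ?_)) ?_)
        <;> exact norm_sub_star_le _
    have h3 : ‖⟪x, z⟫‖ ≤ n * ‖z‖ := (norm_inner_le' x z).trans (by gcongr)
    have h4 : ‖⟪d, dz⟫‖ ≤ n * ‖dz‖ := (norm_inner_le' d dz).trans (by gcongr)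
    linarith
  have p1 : 0 ≤ ((K + 1 : ℝ) : ℂ) • (⟪x, x⟫ + ⟪d, d⟫) := by
    rw [smul_add]
    exact add_nonneg (smul_inner_self_nonneg (by positivity) x)
      (smul_inner_self_nonneg (by positivity) d)
  have p2 := smul_inner_self_nonneg (B := B) hε.le (x + w)
  have n5 : (K + 1) * n ^ 2 ≤ ‖P‖ := by
    have := norm_le_norm_of_add p1 p2
    rwa [norm_smul, Complex.norm_real, Real.norm_of_nonneg (by positivity), ← hn2] at this
  have n6 : ε * ‖x + w‖ ^ 2 ≤ ‖P‖ := by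
    have := norm_le_norm_of_add p2 p1
    rwa [norm_smul_inner_self hε.le, add_comm (((ε : ℝ) : ℂ) • _)] at this
  have hZ : 0 ≤ ‖z‖ + ‖dz‖ := by positivity
  set Z := ‖z‖ + ‖dz‖
  have n7 : n ≤ Z := by
    by_contra hcon
    push Not at hcon
    nlinarith
  calc _ ≤ n * Z + K * n ^ 2 := n6.trans n4
    _ ≤ Z * Z + K * Z ^ 2 := by gcongr
    _ = _ := by ring

/-- The operators `S ± T` of an almost commuting pair are essentially self-adjoint and regular on
`Dom S ∩ Dom T`.  Nelson's commutator argument: the commutator of `H = S ± T` with `1 + D* D` is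
bounded in the sense of forms, so the solutions `x` of the regularised equation satisfy
`ε ‖(1 + D* D) x‖² = O(1)`, and therefore `(H + iλμ) x` approximates the right hand side. -/
theorem IsCartesian.isSelfAdjRegular_closure (h : IsCartesian B D S T) {τ : ℝ} (hτ : |τ| = 1) :
    IsSelfAdjRegular B (relComb S T (τ : ℂ)).topologicalClosure := by
  obtain ⟨M, hM, hb⟩ := h.commutator.exists_norm_bound h.left h.right (by norm_num)
  obtain ⟨κ, hκ, hq⟩ := h.commutator.exists_form_bound h.left h.right (by norm_num)
  have hI : star Complex.I = -((1 : ℝ) : ℂ) * Complex.I := by simp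
  have e00 : ∀ (a : ℝ), star (a : ℂ) = (a : ℂ) := fun a => Complex.conj_ofReal a
  have hsymm : relComb S T (τ : ℂ) ≤ relAdj B (relComb S T (τ : ℂ)) := by
    have := relComb_le_relAdj h.left.relAdj_eq.ge h.right.relAdj_eq.ge (τ : ℂ)
    rwa [e00] at this
  have hsymm' : (relComb S T (τ : ℂ)).topologicalClosure
      ≤ relAdj B (relComb S T (τ : ℂ)).topologicalClosure := by
    rw [relAdj_topologicalClosure]
    exact Submodule.topologicalClosure_minimal _ hsymm (isClosed_relAdj _)
  set K : ℝ := 2 * κ * (2 * M + 1) with hK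
  have hK0 : 0 ≤ K := by positivity
  have hdense : Dense {x : E | ∃ y, (x, y) ∈ D.graph} := by
    rw [← coe_domain_eq]
    exact h.regular.dense_domain
  have key : ∀ l : ℝ, |l| = 1 → SurjAt (relComb S T (τ : ℂ)).topologicalClosure (-(l * (K + 1))) := by
    intro l hl
    have hl0 : l ≠ 0 := by rintro rfl; simp at hl
    refine surjAt_of_dense (B := B) (Submodule.isClosed_topologicalClosure _) hsymm'
      (neg_ne_zero.2 (mul_ne_zero hl0 (by positivity))) ?_
    set Y : Set E := {z : E | ∃ x, (x, z + (Complex.I * ((-(l * (K + 1)) : ℝ) : ℂ)) • x) ∈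
      relComb S T (τ : ℂ)} with hY
    suffices hYd : Dense Y by
      refine hYd.mono ?_
      rintro z ⟨x, hx⟩
      exact ⟨x, Submodule.le_topologicalClosure _ hx⟩
    refine dense_closure.1 (hdense.mono ?_)
    rintro z ⟨dz, hz⟩
    rw [Metric.mem_closure_iff]
    intro δ hδ
    set Z := ‖z‖ + ‖dz‖ with hZ
    have hZ0 : 0 ≤ Z := by positivity
    -- By the commutator estimate, the regularising term `εu` satisfies `‖εu‖² ≤ ε (K + 1) Z²`, which is
    -- less than `δ²` for this choice.
    set ε := δ ^ 2 / (2 * ((K + 1) * Z ^ 2 + 1)) with hε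
    have hε0 : 0 < ε := by positivity
    have hεδ : ε * ((K + 1) * Z ^ 2) < δ ^ 2 := by
      rw [hε, div_mul_eq_mul_div, div_lt_iff₀ (by positivity)]
      have : 0 < δ ^ 2 := by positivity
      have : 0 ≤ (K + 1) * Z ^ 2 := by positivity
      nlinarith
    obtain ⟨x, s, t, w, hs, ht, hw, hx⟩ :=
      h.exists_regularised hτ hl (μ := K + 1) (by positivity) hε0 z
    have hbound := h.norm_regularised hM hb hκ hq hτ hl hε0 hz hs ht hw hx
    refine ⟨z - (Complex.I * l * ε : ℂ) • (x + w), ⟨x, s, t, hs, ht, ?_⟩, ?_⟩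
    · change z - (Complex.I * l * ε : ℂ) • (x + w)
        + (Complex.I * ((-(l * (K + 1)) : ℝ) : ℂ)) • x = s + (τ : ℂ) • t
      rw [← hx]
      push_cast
      module
    · rw [dist_eq_norm, sub_sub_cancel, norm_smul]
      have : ‖(Complex.I * l * ε : ℂ)‖ = ε := by simp [hl, abs_of_pos hε0]
      rw [this]
      refine lt_of_pow_lt_pow_left₀ 2 hδ.le (lt_of_le_of_lt ?_ hεδ)
      rw [mul_pow, pow_two, mul_assoc]
      exact mul_le_mul_of_nonneg_left hbound hε0.le
  have hd : Dense {x : E | ∃ y, (x, y) ∈ (relComb S T (τ : ℂ)).topologicalClosure} := by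
    refine hdense.mono ?_
    rintro x ⟨y, hy⟩
    rw [h.graph_eq] at hy
    obtain ⟨s, t, hs, ht, -⟩ := hy
    exact ⟨_, Submodule.le_topologicalClosure _
      (mem_relComb (p := (x, s + (τ : ℂ) • t)).2 ⟨s, t, hs, ht, rfl⟩)⟩
  refine isSelfAdjRegular_of_surjAt hd hsymm' (μ := K + 1) (by positivity) ?_ ?_
  · simpa using key (-1) (by simp)
  · simpa using key 1 (by simp)

end Cartesian

/-! ### Linear combinations of relations -/

section LinearCombinations

variable {B : Type*} {E : Type*} [NonUnitalCStarAlgebra B] [PartialOrder B] [StarOrderedRing B]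
  [NormedAddCommGroup E] [NormedSpace ℂ E] [SMul Bᵐᵒᵖ E] [CStarModule Bᵐᵒᵖ E]

local notation "⟪" x "," y "⟫" => inner Bᵐᵒᵖ x y

/-- The graph of `α S + β T` on `Dom S ∩ Dom T`. -/
def relLin (S T : Submodule ℂ (E × E)) (α β : ℂ) : Submodule ℂ (E × E) where
  carrier := {p | ∃ s t, (p.1, s) ∈ S ∧ (p.1, t) ∈ T ∧ p.2 = α • s + β • t}
  zero_mem' := ⟨0, 0, S.zero_mem, T.zero_mem, by simp⟩
  add_mem' := by
    rintro p q ⟨s, t, hs, ht, h⟩ ⟨s', t', hs', ht', h'⟩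
    refine ⟨s + s', t + t', S.add_mem hs hs', T.add_mem ht ht', ?_⟩
    rw [Prod.snd_add, h, h']
    module
  smul_mem' := by
    rintro a p ⟨s, t, hs, ht, h⟩
    refine ⟨a • s, a • t, S.smul_mem a hs, T.smul_mem a ht, ?_⟩
    rw [Prod.smul_snd, h]
    module

/-- The graph of `k T`. -/
def relSMul (k : ℂ) (T : Submodule ℂ (E × E)) : Submodule ℂ (E × E) where
  carrier := {p | ∃ t, (p.1, t) ∈ T ∧ p.2 = k • t}
  zero_mem' := ⟨0, T.zero_mem, by simp⟩
  add_mem' := by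
    rintro p q ⟨t, ht, h⟩ ⟨t', ht', h'⟩
    exact ⟨t + t', T.add_mem ht ht', by rw [Prod.snd_add, h, h', smul_add]⟩
  smul_mem' := by
    rintro a p ⟨t, ht, h⟩
    exact ⟨a • t, T.smul_mem a ht, by rw [Prod.smul_snd, h, smul_comm]⟩

variable {S T G H : Submodule ℂ (E × E)}

theorem mem_relLin {α β : ℂ} {p : E × E} :
    p ∈ relLin S T α β ↔ ∃ s t, (p.1, s) ∈ S ∧ (p.1, t) ∈ T ∧ p.2 = α • s + β • t := Iff.rfl

theorem mk_mem_relSMul {k : ℂ} {x t : E} (h : (x, t) ∈ T) : (x, k • t) ∈ relSMul k T :=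
  ⟨t, h, rfl⟩

theorem relComb_eq (c : ℂ) : relComb S T c = relLin S T 1 c := by
  ext p
  simp [mem_relComb, mem_relLin]

theorem relLin_comm (α β : ℂ) : relLin S T α β = relLin T S β α := by
  ext p
  constructor
  · rintro ⟨s, t, hs, ht, h⟩
    exact ⟨t, s, ht, hs, by rw [h, add_comm]⟩
  · rintro ⟨s, t, hs, ht, h⟩
    exact ⟨t, s, ht, hs, by rw [h, add_comm]⟩

theorem relSMul_relLin (k α β : ℂ) :
    relSMul k (relLin S T α β) = relLin S T (k * α) (k * β) := by
  ext p
  constructor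
  · rintro ⟨_, ⟨s, t, hs, ht, rfl⟩, h⟩
    exact ⟨s, t, hs, ht, by rw [h]; module⟩
  · rintro ⟨s, t, hs, ht, h⟩
    exact ⟨α • s + β • t, ⟨s, t, hs, ht, rfl⟩, by rw [h]; module⟩

theorem relSMul_inv_mem {k : ℂ} (hk : k ≠ 0) {p : E × E} :
    p ∈ relSMul k T ↔ (p.1, k⁻¹ • p.2) ∈ T := by
  constructor
  · rintro ⟨t, ht, h⟩
    rwa [h, smul_smul, inv_mul_cancel₀ hk, one_smul]
  · intro h
    exact ⟨_, h, by rw [smul_smul, mul_inv_cancel₀ hk, one_smul]⟩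

theorem relSMul_topologicalClosure {k : ℂ} (hk : k ≠ 0) :
    (relSMul k T).topologicalClosure = relSMul k T.topologicalClosure := by
  refine le_antisymm (Submodule.topologicalClosure_minimal _ ?_ ?_) ?_
  · rintro p ⟨t, ht, h⟩
    exact ⟨t, T.le_topologicalClosure ht, h⟩
  · have : (relSMul k T.topologicalClosure : Set (E × E)) =
        (fun p : E × E => (p.1, k⁻¹ • p.2)) ⁻¹' (T.topologicalClosure : Set (E × E)) := by
      ext p
      exact relSMul_inv_mem hk
    rw [this]
    exact T.isClosed_topologicalClosure.preimage (by fun_prop)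
  · rintro ⟨x, _⟩ ⟨t, ht, rfl⟩
    exact map_mem_closure (f := fun p : E × E => (p.1, k • p.2)) (by fun_prop) ht
      fun p hp => mk_mem_relSMul hp

theorem relAdj_relSMul {k : ℂ} (hk : k ≠ 0) :
    relAdj B (relSMul k T) = relSMul (star k) (relAdj B T) := by
  have hk' : star k ≠ 0 := star_ne_zero.2 hk
  ext ⟨y, w⟩
  rw [relSMul_inv_mem hk']
  have key : ∀ x t : E, ⟪y, k • t⟫ = ⟪w, x⟫ ↔ ⟪y, t⟫ = ⟪(star k)⁻¹ • w, x⟫ := by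
    intro x t
    simp only [CStarModule.inner_smul_right_complex, CStarModule.inner_smul_left_complex,
      star_inv₀, star_star]
    rw [eq_comm, ← inv_smul_eq_iff₀ hk, eq_comm]
  constructor
  · rintro h ⟨x, t⟩ ht
    exact (key x t).1 (h _ (mk_mem_relSMul ht))
  · rintro h ⟨x, _⟩ ⟨t, ht, rfl⟩
    exact (key x t).2 (h _ ht)

theorem relDom_relLin (α β : ℂ) : relDom (relLin S T α β) = relDom S ⊓ relDom T := by
  ext x
  simp only [mem_relDom, Submodule.mem_inf]
  constructor
  · rintro ⟨_, s, t, hs, ht, -⟩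
    exact ⟨⟨s, hs⟩, ⟨t, ht⟩⟩
  · rintro ⟨⟨s, hs⟩, ⟨t, ht⟩⟩
    exact ⟨_, s, t, hs, ht, rfl⟩

theorem relDom_relSMul (k : ℂ) : relDom (relSMul k T) = relDom T := by
  ext x
  simp only [mem_relDom]
  constructor
  · rintro ⟨_, t, ht, -⟩
    exact ⟨t, ht⟩
  · rintro ⟨t, ht⟩
    exact ⟨_, t, ht, rfl⟩

theorem coe_relDom (G : Submodule ℂ (E × E)) : (relDom G : Set E) = {x | ∃ y, (x, y) ∈ G} := by
  ext x
  exact mem_relDom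

end LinearCombinations

/-! ### Off-diagonal operators on the double of a Hilbert module -/

section Doubles

variable (B : Type*) {E : Type*} [NonUnitalCStarAlgebra B] [PartialOrder B] [StarOrderedRing B]
  [NormedAddCommGroup E] [NormedSpace ℂ E] [SMul Bᵐᵒᵖ E] [CStarModule Bᵐᵒᵖ E]

local notation "⟪" x "," y "⟫" => inner Bᵐᵒᵖ x y

/-- The vector `(a, b)` of `E ⊕ E`, as a continuous linear function of `(a, b)`. -/
def pairL : E × E →L[ℂ] Sum₂ B E :=
  (WithCStarModule.equivL (R := ℂ) (A := Bᵐᵒᵖ) (E := E × E)).symm.toContinuousLinearMap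

/-- The first component of a vector of `E ⊕ E`. -/
def fstL : Sum₂ B E →L[ℂ] E :=
  (ContinuousLinearMap.fst ℂ E E).comp
    (WithCStarModule.equivL (R := ℂ) (A := Bᵐᵒᵖ) (E := E × E)).toContinuousLinearMap

/-- The second component of a vector of `E ⊕ E`. -/
def sndL : Sum₂ B E →L[ℂ] E :=
  (ContinuousLinearMap.snd ℂ E E).comp
    (WithCStarModule.equivL (R := ℂ) (A := Bᵐᵒᵖ) (E := E × E)).toContinuousLinearMap

variable {B}

@[simp] theorem pairL_fst (p : E × E) : (pairL B p).1 = p.1 := rfl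

@[simp] theorem pairL_snd (p : E × E) : (pairL B p).2 = p.2 := rfl

theorem sum_ext {p q : Sum₂ B E} (h1 : p.1 = q.1) (h2 : p.2 = q.2) : p = q := Prod.ext h1 h2

theorem sum_inner (p q : Sum₂ B E) : ⟪p, q⟫ = ⟪p.1, q.1⟫ + ⟪p.2, q.2⟫ := rfl

theorem continuous_sum_fst : Continuous fun p : Sum₂ B E => p.1 := (fstL B).continuous

theorem continuous_sum_snd : Continuous fun p : Sum₂ B E => p.2 := (sndL B).continuous

/-- The operator matrix `[[0, X], [Y, 0]]` for linear relations `X` and `Y`. -/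
def relOff (X Y : Submodule ℂ (E × E)) : Submodule ℂ (Sum₂ B E × Sum₂ B E) where
  carrier := {p | (p.1.2, p.2.1) ∈ X ∧ (p.1.1, p.2.2) ∈ Y}
  zero_mem' := ⟨X.zero_mem, Y.zero_mem⟩
  add_mem' := fun hp hq => ⟨X.add_mem hp.1 hq.1, Y.add_mem hp.2 hq.2⟩
  smul_mem' := fun c _ hp => ⟨X.smul_mem c hp.1, Y.smul_mem c hp.2⟩

/-- The subspace `V ⊕ V` of `E ⊕ E`. -/
def sumSub (V : Submodule ℂ E) : Submodule ℂ (Sum₂ B E) where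
  carrier := {p | p.1 ∈ V ∧ p.2 ∈ V}
  zero_mem' := ⟨V.zero_mem, V.zero_mem⟩
  add_mem' := fun hp hq => ⟨V.add_mem hp.1 hq.1, V.add_mem hp.2 hq.2⟩
  smul_mem' := fun c _ hp => ⟨V.smul_mem c hp.1, V.smul_mem c hp.2⟩

variable {X Y X' Y' : Submodule ℂ (E × E)}

theorem mem_relOff {p : Sum₂ B E × Sum₂ B E} :
    p ∈ relOff X Y ↔ (p.1.2, p.2.1) ∈ X ∧ (p.1.1, p.2.2) ∈ Y := Iff.rfl

theorem mem_sumSub {V : Submodule ℂ E} {p : Sum₂ B E} : p ∈ sumSub V ↔ p.1 ∈ V ∧ p.2 ∈ V := Iff.rfl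

/-- The embedding of `X` into `[[0, X], [Y, 0]]`. -/
def offUpper : E × E →L[ℂ] Sum₂ B E × Sum₂ B E :=
  ((pairL B).comp ((0 : E × E →L[ℂ] E).prod (ContinuousLinearMap.fst ℂ E E))).prod
    ((pairL B).comp ((ContinuousLinearMap.snd ℂ E E).prod (0 : E × E →L[ℂ] E)))

/-- The embedding of `Y` into `[[0, X], [Y, 0]]`. -/
def offLower : E × E →L[ℂ] Sum₂ B E × Sum₂ B E :=
  ((pairL B).comp ((ContinuousLinearMap.fst ℂ E E).prod (0 : E × E →L[ℂ] E))).prod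
    ((pairL B).comp ((0 : E × E →L[ℂ] E).prod (ContinuousLinearMap.snd ℂ E E)))

theorem offUpper_mem {p : E × E} (h : p ∈ X) : offUpper (B := B) p ∈ relOff X Y :=
  ⟨h, Y.zero_mem⟩

theorem offLower_mem {p : E × E} (h : p ∈ Y) : offLower (B := B) p ∈ relOff X Y :=
  ⟨X.zero_mem, h⟩

theorem mem_of_offUpper_mem {p : E × E} (h : offUpper (B := B) p ∈ relOff X Y) : p ∈ X := h.1

theorem mem_of_offLower_mem {p : E × E} (h : offLower (B := B) p ∈ relOff X Y) : p ∈ Y := h.2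

theorem relOff_injective (h : relOff (B := B) X Y = relOff X' Y') : X = X' ∧ Y = Y' := by
  constructor
  · ext p
    exact ⟨fun hp => mem_of_offUpper_mem (B := B) (h ▸ offUpper_mem hp),
      fun hp => mem_of_offUpper_mem (B := B) (h.symm ▸ offUpper_mem hp)⟩
  · ext p
    exact ⟨fun hp => mem_of_offLower_mem (B := B) (h ▸ offLower_mem hp),
      fun hp => mem_of_offLower_mem (B := B) (h.symm ▸ offLower_mem hp)⟩

theorem offDiag_graph (X Y : E →ₗ.[ℂ] E) :
    (offDiag B X Y).graph = relOff X.graph Y.graph := by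
  ext ⟨p, q⟩
  constructor
  · intro h
    obtain ⟨y, rfl, rfl⟩ := (LinearPMap.mem_graph_iff _).1 h
    exact ⟨X.mem_graph ⟨_, y.2.2⟩, Y.mem_graph ⟨_, y.2.1⟩⟩
  · rintro ⟨h1, h2⟩
    have h1' := LinearPMap.mem_domain_of_mem_graph h1
    have h2' := LinearPMap.mem_domain_of_mem_graph h2
    refine (LinearPMap.mem_graph_iff _).2 ⟨⟨p, h2', h1'⟩, rfl, ?_⟩
    exact sum_ext (apply_eq_of_mem_graph h1 h1') (apply_eq_of_mem_graph h2 h2')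

theorem isClosed_relOff (hX : IsClosed (X : Set (E × E))) (hY : IsClosed (Y : Set (E × E))) :
    IsClosed (relOff (B := B) X Y : Set (Sum₂ B E × Sum₂ B E)) := by
  have h1 : Continuous fun p : Sum₂ B E × Sum₂ B E => (p.1.2, p.2.1) :=
    (continuous_sum_snd.comp continuous_fst).prodMk (continuous_sum_fst.comp continuous_snd)
  have h2 : Continuous fun p : Sum₂ B E × Sum₂ B E => (p.1.1, p.2.2) :=
    (continuous_sum_fst.comp continuous_fst).prodMk (continuous_sum_snd.comp continuous_snd)
  exact (hX.preimage h1).inter (hY.preimage h2)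

theorem relOff_topologicalClosure :
    (relOff (B := B) X Y).topologicalClosure =
      relOff X.topologicalClosure Y.topologicalClosure := by
  refine le_antisymm (Submodule.topologicalClosure_minimal _ ?_ ?_) ?_
  · exact fun p hp => ⟨X.le_topologicalClosure hp.1, Y.le_topologicalClosure hp.2⟩
  · exact isClosed_relOff X.isClosed_topologicalClosure Y.isClosed_topologicalClosure
  · rintro p ⟨h1, h2⟩
    have e : p = offUpper (B := B) (p.1.2, p.2.1) + offLower (B := B) (p.1.1, p.2.2) :=
      Prod.ext (sum_ext (zero_add p.1.1).symm (add_zero p.1.2).symm)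
        (sum_ext (add_zero p.2.1).symm (zero_add p.2.2).symm)
    rw [e]
    refine Submodule.add_mem _ ?_ ?_
    · exact map_mem_closure offUpper.continuous h1 fun p hp => offUpper_mem hp
    · exact map_mem_closure offLower.continuous h2 fun p hp => offLower_mem hp

theorem relAdj_relOff : relAdj B (relOff (B := B) X Y) = relOff (relAdj B Y) (relAdj B X) := by
  ext ⟨p, q⟩
  constructor
  · intro h
    constructor
    · intro y hy
      have := h _ (offLower_mem (B := B) (X := X) hy)
      simpa [sum_inner, offLower] using this
    · intro x hx
      have := h _ (offUpper_mem (B := B) (Y := Y) hx)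
      simpa [sum_inner, offUpper] using this
  · rintro ⟨h1, h2⟩ ⟨p', q'⟩ ⟨h3, h4⟩
    have e1 := h1 _ h4
    have e2 := h2 _ h3
    change ⟪p.1, q'.1⟫ + ⟪p.2, q'.2⟫ = ⟪q.1, p'.1⟫ + ⟪q.2, p'.2⟫
    rw [e1, e2, add_comm]

theorem relRestrict_relOff (V : Submodule ℂ E) :
    relRestrict (relOff (B := B) X Y) (sumSub V) = relOff (relRestrict X V) (relRestrict Y V) := by
  ext p
  simp only [mem_relRestrict, mem_relOff, mem_sumSub]
  tauto

theorem relLin_relOff (α β : ℂ) : relLin (relOff (B := B) X Y) (relOff X' Y') α β =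
    relOff (relLin X X' α β) (relLin Y Y' α β) := by
  ext ⟨p, q⟩
  constructor
  · rintro ⟨s, t, ⟨h1, h2⟩, ⟨h3, h4⟩, rfl⟩
    exact ⟨⟨s.1, t.1, h1, h3, rfl⟩, ⟨s.2, t.2, h2, h4, rfl⟩⟩
  · rintro ⟨⟨s, t, hs, ht, h⟩, ⟨s', t', hs', ht', h'⟩⟩
    exact ⟨pairL B (s, s'), pairL B (t, t'), ⟨hs, hs'⟩, ⟨ht, ht'⟩, sum_ext h h'⟩

theorem mem_relDom_relOff {p : Sum₂ B E} :
    p ∈ relDom (relOff X Y) ↔ p.1 ∈ relDom Y ∧ p.2 ∈ relDom X := by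
  simp only [mem_relDom]
  constructor
  · rintro ⟨q, h1, h2⟩
    exact ⟨⟨_, h2⟩, ⟨_, h1⟩⟩
  · rintro ⟨⟨b, hb⟩, ⟨a, ha⟩⟩
    exact ⟨pairL B (a, b), ha, hb⟩

theorem dense_relDom_relOff (hX : Dense (relDom X : Set E)) (hY : Dense (relDom Y : Set E)) :
    Dense (relDom (relOff (B := B) X Y) : Set (Sum₂ B E)) := by
  have h1 : DenseRange (pairL B : E × E → Sum₂ B E) :=
    Function.Surjective.denseRange fun p => ⟨(p.1, p.2), rfl⟩
  refine (h1.dense_image (pairL B).continuous (hY.prod hX)).mono ?_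
  rintro _ ⟨⟨a, b⟩, ⟨ha, hb⟩, rfl⟩
  exact mem_relDom_relOff.2 ⟨ha, hb⟩

theorem dense_relDom_of_relOff (h : Dense (relDom (relOff (B := B) X Y) : Set (Sum₂ B E))) :
    Dense (relDom X : Set E) ∧ Dense (relDom Y : Set E) := by
  constructor
  · have h1 : DenseRange (sndL B : Sum₂ B E → E) :=
      Function.Surjective.denseRange fun x => ⟨pairL B (0, x), rfl⟩
    refine (h1.dense_image (sndL B).continuous h).mono ?_
    rintro _ ⟨p, hp, rfl⟩
    exact (mem_relDom_relOff.1 hp).2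
  · have h1 : DenseRange (fstL B : Sum₂ B E → E) :=
      Function.Surjective.denseRange fun x => ⟨pairL B (x, 0), rfl⟩
    refine (h1.dense_image (fstL B).continuous h).mono ?_
    rintro _ ⟨p, hp, rfl⟩
    exact (mem_relDom_relOff.1 hp).1

/-- The polar decomposition `ω = n e`. The phase `e` enters the unitary that diagonalises
`[[0, ωX], [ω̄X, 0]]`, and the modulus `n` rescales the spectral parameter. -/
theorem exists_polar {ω : ℂ} (hω : ω ≠ 0) : ∃ (n : ℝ) (e : ℂ), 0 < n ∧ star e * e = 1 ∧
    ω = n * e ∧ star ω = n * star e ∧ ω⁻¹ = (n : ℂ)⁻¹ * star e ∧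
    (star ω)⁻¹ = (n : ℂ)⁻¹ * e := by
  have hn : (0 : ℝ) < ‖ω‖ := norm_pos_iff.2 hω
  have hn' : ((‖ω‖ : ℝ) : ℂ) ≠ 0 := Complex.ofReal_ne_zero.2 hn.ne'
  have h1 : star ω * ω = (‖ω‖ : ℂ) * ‖ω‖ := by
    rw [Complex.star_def, mul_comm, Complex.mul_conj, Complex.normSq_eq_norm_sq]
    push_cast
    ring
  have h2 : star ((‖ω‖ : ℂ)⁻¹) = (‖ω‖ : ℂ)⁻¹ := by
    rw [star_inv₀, Complex.star_def, Complex.conj_ofReal]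
  have hω' : star ω ≠ 0 := star_ne_zero.2 hω
  refine ⟨‖ω‖, (‖ω‖ : ℂ)⁻¹ * ω, hn, ?_, ?_, ?_, ?_, ?_⟩
  · rw [star_mul', h2]
    field_simp
    linear_combination h1
  · field_simp
  · rw [star_mul', h2]
    field_simp
  · rw [star_mul', h2]
    field_simp
    linear_combination -h1
  · field_simp
    linear_combination -h1

/-- If `X` is regular self-adjoint and `ω ≠ 0`, then so is `[[0, ω X], [ω̄ X, 0]]`: after a rescaling
of the second summand, sums and differences of the components diagonalise it. -/
theorem IsSelfAdjRegular.relOff (h : IsSelfAdjRegular B X) {ω : ℂ} (hω : ω ≠ 0) :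
    IsSelfAdjRegular B (relOff (B := B) (relSMul ω X) (relSMul (star ω) X)) := by
  have hω' : star ω ≠ 0 := star_ne_zero.2 hω
  have hd : Dense (relDom X : Set E) := by
    rw [coe_relDom]
    exact h.dense
  refine ⟨?_, ?_, fun μ hμ z => ?_⟩
  · rw [← coe_relDom]
    refine dense_relDom_relOff ?_ ?_ <;> rwa [relDom_relSMul]
  · rw [relAdj_relOff, relAdj_relSMul hω, relAdj_relSMul hω', h.relAdj_eq, star_star]
  · obtain ⟨n, e, hn, he, -, -, e1, e2⟩ := exists_polar hω
    have hn' : (n : ℂ) ≠ 0 := Complex.ofReal_ne_zero.2 hn.ne'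
    obtain ⟨P, hP⟩ := h.surjAt (μ / n) (div_ne_zero hμ hn.ne') ((n : ℂ)⁻¹ • (z.1 + e • z.2))
    obtain ⟨Q, hQ⟩ := h.surjAt (-μ / n) (div_ne_zero (neg_ne_zero.2 hμ) hn.ne')
      ((n : ℂ)⁻¹ • (z.1 - e • z.2))
    refine ⟨pairL B ((1 / 2 : ℂ) • (P - Q), (star e / 2 : ℂ) • (P + Q)), ?_, ?_⟩
    · rw [relSMul_inv_mem hω, e1]
      convert X.smul_mem (star e / 2) (X.add_mem hP hQ) using 1
      refine Prod.ext rfl ?_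
      change ((n : ℂ)⁻¹ * star e) • (z.1 + (Complex.I * (μ : ℂ)) • ((1 / 2 : ℂ) • (P - Q))) =
        (star e / 2 : ℂ) • (_ + _)
      push_cast
      module
    · rw [relSMul_inv_mem hω', e2]
      convert X.smul_mem (1 / 2) (X.sub_mem hP hQ) using 1
      refine Prod.ext rfl ?_
      change ((n : ℂ)⁻¹ * e) • (z.2 + (Complex.I * (μ : ℂ)) • ((star e / 2 : ℂ) • (P + Q))) =
        (1 / 2 : ℂ) • (_ - _)
      push_cast
      linear_combination (norm := module) he • (((n : ℂ)⁻¹ * (Complex.I * (μ : ℂ)) / 2) • (P + Q))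

/-- The converse of `IsSelfAdjRegular.relOff`. -/
theorem isSelfAdjRegular_of_relOff {ω : ℂ} (hω : ω ≠ 0)
    (h : IsSelfAdjRegular B (relOff (B := B) (relSMul ω X) (relSMul (star ω) X))) :
    IsSelfAdjRegular B X := by
  have hω' : star ω ≠ 0 := star_ne_zero.2 hω
  refine ⟨?_, ?_, fun μ hμ z => ?_⟩
  · have h1 := h.dense
    rw [← coe_relDom] at h1 ⊢
    have := (dense_relDom_of_relOff h1).1
    rwa [relDom_relSMul] at this
  · have h1 := h.relAdj_eq
    rw [relAdj_relOff, relAdj_relSMul hω, relAdj_relSMul hω', star_star] at h1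
    have h2 := (relOff_injective h1).1
    ext ⟨x, y⟩
    have h3 := (SetLike.ext_iff.1 h2 (x, ω • y))
    simpa only [relSMul_inv_mem hω, smul_smul, inv_mul_cancel₀ hω, one_smul] using h3
  · obtain ⟨n, e, hn, he, -, -, e1, e2⟩ := exists_polar hω
    have hn' : (n : ℂ) ≠ 0 := Complex.ofReal_ne_zero.2 hn.ne'
    obtain ⟨p, hp1, hp2⟩ := h.surjAt (n * μ) (mul_ne_zero hn.ne' hμ) (pairL B ((n : ℂ) • z, 0))
    rw [relSMul_inv_mem hω, e1] at hp1
    rw [relSMul_inv_mem hω', e2] at hp2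
    refine ⟨p.1 + e • p.2, ?_⟩
    convert X.add_mem hp2 (X.smul_mem e hp1) using 1
    refine Prod.ext rfl ?_
    change z + (Complex.I * (μ : ℂ)) • (p.1 + e • p.2) =
      ((n : ℂ)⁻¹ * e) • ((0 : E) + (Complex.I * ((n * μ : ℝ) : ℂ)) • p.2) +
      e • ((n : ℂ)⁻¹ * star e) • ((n : ℂ) • z + (Complex.I * ((n * μ : ℝ) : ℂ)) • p.1)
    have hn2 : (n : ℂ)⁻¹ * n = 1 := inv_mul_cancel₀ hn'
    have h3 : ((n : ℂ)⁻¹ * e) • ((0 : E) + (Complex.I * ((n * μ : ℝ) : ℂ)) • p.2) =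
        (((n : ℂ)⁻¹ * n) * (e * (Complex.I * μ))) • p.2 := by push_cast; module
    have h4 : e • ((n : ℂ)⁻¹ * star e) • ((n : ℂ) • z + (Complex.I * ((n * μ : ℝ) : ℂ)) • p.1) =
        (((n : ℂ)⁻¹ * n) * (star e * e)) • z +
        (((n : ℂ)⁻¹ * n) * (star e * e) * (Complex.I * μ)) • p.1 := by push_cast; module
    rw [h3, h4, hn2, he]
    module

/-- The operator matrix `[[0, X], [Y, 0]]` of regular operators is regular. -/
theorem IsRegular.offDiag [CompleteSpace E] {S T : E →ₗ.[ℂ] E} (hS : IsRegular B S)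
    (hT : IsRegular B T) : IsRegular B (offDiag B S T) := by
  have hd : ∀ S T : E →ₗ.[ℂ] E, Dense (S.domain : Set E) → Dense (T.domain : Set E) →
      Dense ((HilbertModule.offDiag B S T).domain : Set (Sum₂ B E)) := by
    intro S T hS hT
    rw [← relDom_graph, offDiag_graph]
    refine dense_relDom_relOff ?_ ?_ <;> rwa [relDom_graph]
  have hadj : relAdj B (HilbertModule.offDiag B S T).graph =
      (HilbertModule.offDiag B (HilbertModule.adj B T) (HilbertModule.adj B S)).graph := by
    rw [offDiag_graph, offDiag_graph, relAdj_relOff, adj_graph hS.dense_domain,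
      adj_graph hT.dense_domain]
  have hd1 := hd S T hS.dense_domain hT.dense_domain
  refine (isRegular_iff ?_ hd1 ?_).2 ⟨?_, fun u => ?_⟩
  · rw [LinearPMap.IsClosed, offDiag_graph]
    exact isClosed_relOff hS.closed hT.closed
  · rw [← relDom_graph, adj_graph hd1, hadj, relDom_graph]
    exact hd _ _ hT.dense_adj_domain hS.dense_adj_domain
  · rw [offDiag_graph]
    rintro b x t ⟨h1, h2⟩
    exact ⟨hS.smul_mem b h1, hT.smul_mem b h2⟩
  · obtain ⟨x₁, t₁, w₁, h1, h2, h3⟩ := hT.exists_add_adj u.1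
    obtain ⟨x₂, t₂, w₂, h4, h5, h6⟩ := hS.exists_add_adj u.2
    rw [offDiag_graph, relAdj_relOff]
    exact ⟨pairL B (x₁, x₂), pairL B (t₂, t₁), pairL B (w₁, w₂), ⟨h4, h1⟩, ⟨h2, h5⟩, sum_ext h3 h6⟩

end Doubles

/-! ### Commutators, anti-commutators and doubling -/

section Commutators

variable {B : Type*} {E : Type*} [NonUnitalCStarAlgebra B] [PartialOrder B] [StarOrderedRing B]
  [NormedAddCommGroup E] [NormedSpace ℂ E] [SMul Bᵐᵒᵖ E] [CStarModule Bᵐᵒᵖ E]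

local notation "⟪" x "," y "⟫" => inner Bᵐᵒᵖ x y

variable {S T : Submodule ℂ (E × E)} {σ : ℝ}

/-- The core of `T` in the definition of almost (anti-)commuting pairs may be taken to be
`Dom T`. -/
theorem HasTwistedCommutator.exists_on_domain [CompleteSpace E] (h : HasTwistedCommutator B σ S T)
    (hS : IsSelfAdjRegular B S) (hT : IsSelfAdjRegular B T) (hσ : σ * σ = 1) {μ : ℝ} (hμ : μ ≠ 0) :
    ∃ C : E →ₗ[ℂ] E, IsAdjointable B C ∧ ∀ ξ ∈ relDom T, ∃ η s t u v, (η, s) ∈ S ∧ (η, t) ∈ T ∧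
      (t, u) ∈ S ∧ (s, v) ∈ T ∧ s - (Complex.I * (μ : ℂ)) • η = ξ ∧ C ξ = u - (σ : ℂ) • v := by
  have hσ0 : σ ≠ 0 := by rintro rfl; simp at hσ
  have hσ' : (σ : ℂ) * σ = 1 := by exact_mod_cast hσ
  obtain ⟨r, hr⟩ := hS.exists_resolvent
  obtain ⟨C, hC, h1⟩ := h.exists_adjointable hT hr hσ hμ
  refine ⟨C, hC, fun ξ hξ => ?_⟩
  obtain ⟨t₀, ht₀⟩ := mem_relDom.1 hξ
  have h2 := h1 ξ t₀ ht₀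
  refine ⟨_, _, _, _, _, hr.mem μ hμ ξ, h2, hr.mem (σ * μ) (mul_ne_zero hσ0 hμ) _,
    T.add_mem ht₀ (T.smul_mem (Complex.I * (μ : ℂ)) h2), by simp, ?_⟩
  set w := r (σ * μ) (C ξ + (σ : ℂ) • t₀)
  change C ξ = C ξ + (σ : ℂ) • t₀ + (Complex.I * ((σ * μ : ℝ) : ℂ)) • w -
    (σ : ℂ) • (t₀ + (Complex.I * (μ : ℂ)) • w)
  push_cast
  module

/-- The difference of the components of `C (x, x)` defines an adjointable operator on `E`. In this way a
commutator on `E` is extracted from a doubled anti-commutator. -/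
theorem IsAdjointable.comp_pair {C : Sum₂ B E →ₗ[ℂ] Sum₂ B E} (hC : IsAdjointable B C) (k : ℂ) :
    ∃ C' : E →ₗ[ℂ] E, IsAdjointable B C' ∧
      ∀ x, C' x = k • ((C (pairL B (x, x))).2 - (C (pairL B (x, x))).1) := by
  obtain ⟨C', hC'⟩ := hC
  refine ⟨k • ((sndL B - fstL B : Sum₂ B E →L[ℂ] E) : Sum₂ B E →ₗ[ℂ] E) ∘ₗ C ∘ₗ
    ((pairL B : E × E →L[ℂ] Sum₂ B E) : E × E →ₗ[ℂ] Sum₂ B E) ∘ₗ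
      (LinearMap.id.prod LinearMap.id), ⟨star k • ((fstL B + sndL B : Sum₂ B E →L[ℂ] E) :
        Sum₂ B E →ₗ[ℂ] E) ∘ₗ C' ∘ₗ ((pairL B : E × E →L[ℂ] Sum₂ B E) : E × E →ₗ[ℂ] Sum₂ B E) ∘ₗ
      ((-LinearMap.id).prod LinearMap.id), fun x y => ?_⟩, fun x => rfl⟩
  have h := hC' (pairL B (x, x)) (pairL B (-y, y))
  rw [sum_inner, sum_inner] at h
  simp only [pairL_fst, pairL_snd, CStarModule.inner_neg_right] at h
  change ⟪k • ((C (pairL B (x, x))).2 - (C (pairL B (x, x))).1), y⟫ =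
    ⟪x, star k • ((C' (pairL B (-y, y))).1 + (C' (pairL B (-y, y))).2)⟫
  simp only [CStarModule.inner_smul_left_complex, CStarModule.inner_smul_right_complex,
    CStarModule.inner_sub_left, CStarModule.inner_add_right]
  rw [← h]
  module

/-- An adjointable operator on `E ⊕ E` that maps sums of the two components to differences by a
multiple of `C₁`, and differences to sums by a multiple of `C₂`. It assembles a doubled
anti-commutator from commutators on `E`. -/
theorem IsAdjointable.off_pair {C₁ C₂ : E →ₗ[ℂ] E} (h₁ : IsAdjointable B C₁)
    (h₂ : IsAdjointable B C₂) (k : ℂ) :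
    ∃ C : Sum₂ B E →ₗ[ℂ] Sum₂ B E, IsAdjointable B C ∧
      ∀ p, C p = pairL B (k • (C₁ (p.1 + p.2) - C₂ (p.1 - p.2)),
        -(k • (C₁ (p.1 + p.2) + C₂ (p.1 - p.2)))) := by
  obtain ⟨C₁', h₁⟩ := h₁
  obtain ⟨C₂', h₂⟩ := h₂
  let f : Sum₂ B E →ₗ[ℂ] E := (fstL B : Sum₂ B E →L[ℂ] E)
  let g : Sum₂ B E →ₗ[ℂ] E := (sndL B : Sum₂ B E →L[ℂ] E)
  let P : E × E →ₗ[ℂ] Sum₂ B E := (pairL B : E × E →L[ℂ] Sum₂ B E)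
  refine ⟨P ∘ₗ (k • (C₁ ∘ₗ (f + g) - C₂ ∘ₗ (f - g))).prod (-(k • (C₁ ∘ₗ (f + g) + C₂ ∘ₗ (f - g)))),
    ⟨P ∘ₗ (star k • (C₁' ∘ₗ (f - g) - C₂' ∘ₗ (f + g))).prod
      (star k • (C₁' ∘ₗ (f - g) + C₂' ∘ₗ (f + g))), fun p q => ?_⟩, fun p => rfl⟩
  change ⟪k • (C₁ (p.1 + p.2) - C₂ (p.1 - p.2)), q.1⟫ +
      ⟪-(k • (C₁ (p.1 + p.2) + C₂ (p.1 - p.2))), q.2⟫ =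
    ⟪p.1, star k • (C₁' (q.1 - q.2) - C₂' (q.1 + q.2))⟫ +
      ⟪p.2, star k • (C₁' (q.1 - q.2) + C₂' (q.1 + q.2))⟫
  simp only [CStarModule.inner_smul_left_complex, CStarModule.inner_smul_right_complex,
    CStarModule.inner_sub_left, CStarModule.inner_add_right, CStarModule.inner_add_left,
    CStarModule.inner_sub_right, CStarModule.inner_neg_left, h₁, h₂, map_add, map_sub]
  module

theorem mk_mem_relOff {X Y : Submodule ℂ (E × E)} {a b a' b' : E} (h1 : (b, a') ∈ X)
    (h2 : (a, b') ∈ Y) : (pairL B (a, b), pairL B (a', b')) ∈ relOff X Y := ⟨h1, h2⟩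

/-- If `S` and `T` almost commute, then `ρ [[0, S], [S, 0]]` and `ρ [[0, -iT], [iT, 0]]` almost
anti-commute. -/
theorem HasTwistedCommutator.double (h : HasTwistedCommutator B 1 S T) {ρ : ℝ} (hρ : 0 < ρ) :
    HasTwistedCommutator B (-1) (relOff (B := B) (relSMul (ρ : ℂ) S) (relSMul (ρ : ℂ) S))
      (relOff (relSMul (-(Complex.I * ρ)) T) (relSMul (Complex.I * ρ) T)) := by
  have hρ' : (ρ : ℂ) ≠ 0 := Complex.ofReal_ne_zero.2 hρ.ne'
  have hI : Complex.I * (ρ : ℂ) ≠ 0 := mul_ne_zero Complex.I_ne_zero hρ'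
  obtain ⟨V, hV, h⟩ := h
  refine ⟨sumSub V, ?_, fun μ hμ => ?_⟩
  · have h1 : ∀ k : ℂ, relRestrict (relSMul k T) V = relSMul k (relRestrict T V) := by
      intro k
      ext p
      constructor
      · rintro ⟨⟨t, ht, e⟩, hp⟩
        exact ⟨t, ⟨ht, hp⟩, e⟩
      · rintro ⟨t, ⟨ht, hp⟩, e⟩
        exact ⟨⟨t, ht, e⟩, hp⟩
    rw [relRestrict_relOff, relOff_topologicalClosure, h1, h1,
      relSMul_topologicalClosure (neg_ne_zero.2 hI), relSMul_topologicalClosure hI, hV]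
  · obtain ⟨C₁, hC₁, h1⟩ := h (μ / ρ) (div_ne_zero hμ hρ.ne')
    obtain ⟨C₂, hC₂, h2⟩ := h (-μ / ρ) (div_ne_zero (neg_ne_zero.2 hμ) hρ.ne')
    -- On sums and differences of the two components, `[[0, ρS], [ρS, 0]]` acts as `ρS` and `-ρS`. Its
    -- resolvent at `iμ` is thus given by those of `S` at `±iμ / ρ`.
    obtain ⟨C, hC, hC'⟩ := hC₁.off_pair hC₂ (Complex.I * ρ / 2)
    refine ⟨C, hC, fun ξ hξ => ?_⟩
    obtain ⟨η₁, s₁, t₁, u₁, v₁, a1, a2, a3, a4, a5, a6⟩ := h1 (ξ.1 + ξ.2) (V.add_mem hξ.1 hξ.2)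
    obtain ⟨η₂, s₂, t₂, u₂, v₂, b1, b2, b3, b4, b5, b6⟩ := h2 (ξ.1 - ξ.2) (V.sub_mem hξ.1 hξ.2)
    have key : ∀ {X : Submodule ℂ (E × E)} {x y z w : E} {k c : ℂ} (a b : ℂ), (x, y) ∈ X →
        (z, w) ∈ X → ∀ {x' y' : E}, x' = c • (a • x + b • z) → y' = (k * c) • (a • y + b • w) →
        (x', y') ∈ relSMul k X := by
      rintro X x y z w k c a b hx hz x' y' rfl rfl
      exact ⟨_, X.smul_mem c (X.add_mem (X.smul_mem a hx) (X.smul_mem b hz)), mul_smul _ _ _⟩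
    refine ⟨pairL B ((1 / (2 * ρ) : ℂ) • (η₁ - η₂), (1 / (2 * ρ) : ℂ) • (η₁ + η₂)),
      pairL B ((1 / 2 : ℂ) • (s₁ + s₂), (1 / 2 : ℂ) • (s₁ - s₂)),
      pairL B ((-Complex.I / 2) • (t₁ + t₂), (Complex.I / 2) • (t₁ - t₂)),
      pairL B ((ρ * Complex.I / 2) • (u₁ - u₂), -((ρ * Complex.I / 2) • (u₁ + u₂))),
      pairL B (-((ρ * Complex.I / 2) • (v₁ - v₂)), (ρ * Complex.I / 2) • (v₁ + v₂)),
      mk_mem_relOff (key 1 1 a1 b1 (c := 1 / (2 * ρ)) ?_ ?_)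
        (key 1 (-1) a1 b1 (c := 1 / (2 * ρ)) ?_ ?_),
      mk_mem_relOff (key 1 1 a2 b2 (c := 1 / (2 * ρ)) ?_ ?_)
        (key 1 (-1) a2 b2 (c := 1 / (2 * ρ)) ?_ ?_),
      mk_mem_relOff (key 1 (-1) a3 b3 (c := Complex.I / 2) ?_ ?_)
        (key 1 1 a3 b3 (c := -Complex.I / 2) ?_ ?_),
      mk_mem_relOff (key 1 (-1) a4 b4 (c := 1 / 2) ?_ ?_)
        (key 1 1 a4 b4 (c := 1 / 2) ?_ ?_), ?_, ?_⟩
    · module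
    · match_scalars <;> field_simp
    · module
    · match_scalars <;> field_simp
    · module
    · match_scalars <;> field_simp
    · module
    · match_scalars <;> field_simp
    · module
    · match_scalars <;> ring
    · module
    · match_scalars <;> ring
    · module
    · match_scalars <;> ring
    · module
    · match_scalars <;> ring
    · refine sum_ext ?_ ?_
      · have : ξ.1 = (1 / 2 : ℂ) • ((ξ.1 + ξ.2) + (ξ.1 - ξ.2)) := by module
        refine Eq.trans ?_ this.symm
        rw [← a5, ← b5]
        change (1 / 2 : ℂ) • (s₁ + s₂) -
          (Complex.I * (μ : ℂ)) • ((1 / (2 * ρ) : ℂ) • (η₁ - η₂)) = _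
        push_cast
        match_scalars <;> field_simp
      · have : ξ.2 = (1 / 2 : ℂ) • ((ξ.1 + ξ.2) - (ξ.1 - ξ.2)) := by module
        refine Eq.trans ?_ this.symm
        rw [← a5, ← b5]
        change (1 / 2 : ℂ) • (s₁ - s₂) -
          (Complex.I * (μ : ℂ)) • ((1 / (2 * ρ) : ℂ) • (η₁ + η₂)) = _
        push_cast
        match_scalars <;> field_simp
    · rw [hC', a6, b6]
      refine sum_ext ?_ ?_
      · change (Complex.I * ρ / 2) • ((u₁ - ((1 : ℝ) : ℂ) • v₁) - (u₂ - ((1 : ℝ) : ℂ) • v₂)) =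
          (ρ * Complex.I / 2) • (u₁ - u₂) -
            ((-1 : ℝ) : ℂ) • -((ρ * Complex.I / 2) • (v₁ - v₂))
        push_cast
        module
      · change -((Complex.I * ρ / 2) • ((u₁ - ((1 : ℝ) : ℂ) • v₁) + (u₂ - ((1 : ℝ) : ℂ) • v₂))) =
          -((ρ * Complex.I / 2) • (u₁ + u₂)) -
            ((-1 : ℝ) : ℂ) • ((ρ * Complex.I / 2) • (v₁ + v₂))
        push_cast
        module

/-- The converse of `HasTwistedCommutator.double`. -/
theorem hasTwistedCommutator_of_double [CompleteSpace E] {ρ : ℝ} (hρ : 0 < ρ)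
    (hS : IsSelfAdjRegular B S) (hT : IsSelfAdjRegular B T)
    (h : HasTwistedCommutator B (-1) (relOff (B := B) (relSMul (ρ : ℂ) S) (relSMul (ρ : ℂ) S))
      (relOff (relSMul (-(Complex.I * ρ)) T) (relSMul (Complex.I * ρ) T))) :
    HasTwistedCommutator B 1 S T := by
  have hρ' : (ρ : ℂ) ≠ 0 := Complex.ofReal_ne_zero.2 hρ.ne'
  have hI : Complex.I * (ρ : ℂ) ≠ 0 := mul_ne_zero Complex.I_ne_zero hρ'
  have hS' := hS.relOff hρ'
  have hT' := hT.relOff (neg_ne_zero.2 hI)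
  have e1 : star (ρ : ℂ) = ρ := Complex.conj_ofReal ρ
  have e2 : star (-(Complex.I * (ρ : ℂ))) = Complex.I * ρ := by
    rw [star_neg, star_I_mul, neg_neg]
  rw [e1] at hS'
  rw [e2] at hT'
  refine ⟨relDom T, ?_, fun μ hμ => ?_⟩
  · have : relRestrict T (relDom T) = T :=
      le_antisymm inf_le_left fun p hp => ⟨hp, mem_relDom.2 ⟨_, hp⟩⟩
    rw [this]
    exact hT.isClosed.submodule_topologicalClosure_eq
  · obtain ⟨C, hC, h⟩ := h.exists_on_domain hS' hT' (by norm_num) (mul_ne_zero hρ.ne' hμ)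
    obtain ⟨C', hC', e⟩ := hC.comp_pair (Complex.I / (2 * ρ))
    refine ⟨C', hC', fun ξ hξ => ?_⟩
    obtain ⟨η, s, t, u, v, ⟨a1, a1'⟩, ⟨a2, a2'⟩, ⟨a3, a3'⟩, ⟨a4, a4'⟩, a5, a6⟩ :=
      h (pairL B (ξ, ξ)) (mem_relDom_relOff.2 ⟨by rwa [relDom_relSMul], by rwa [relDom_relSMul]⟩)
    rw [relSMul_inv_mem hρ'] at a1 a1' a3 a3'
    rw [relSMul_inv_mem (neg_ne_zero.2 hI)] at a2 a4
    rw [relSMul_inv_mem hI] at a2' a4'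
    have key : ∀ {X : Submodule ℂ (E × E)} {x y z w : E} (c a b : ℂ), (x, y) ∈ X →
        (z, w) ∈ X → ∀ {x' y' : E}, x' = c • (a • x + b • z) → y' = c • (a • y + b • w) →
        (x', y') ∈ X := by
      rintro X x y z w c a b hx hz x' y' rfl rfl
      exact X.smul_mem c (X.add_mem (X.smul_mem a hx) (X.smul_mem b hz))
    dsimp only at a1 a1' a2 a2' a3 a3' a4 a4'
    have h5 := congrArg (fun p : Sum₂ B E => p.1) a5
    have h5' := congrArg (fun p : Sum₂ B E => p.2) a5
    replace h5 : s.1 - (Complex.I * ((ρ * μ : ℝ) : ℂ)) • η.1 = ξ := h5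
    replace h5' : s.2 - (Complex.I * ((ρ * μ : ℝ) : ℂ)) • η.2 = ξ := h5'
    refine ⟨(ρ / 2 : ℂ) • (η.1 + η.2), (1 / 2 : ℂ) • (s.1 + s.2),
      (Complex.I / 2) • (t.1 - t.2), (Complex.I / (2 * ρ)) • (u.2 - u.1),
      (Complex.I / (2 * ρ)) • (v.1 - v.2),
      key (ρ / 2) 1 1 a1 a1' ?_ ?_, key (ρ / 2) 1 1 a2 a2' ?_ ?_,
      key (Complex.I / 2) 1 (-1) a3' a3 ?_ ?_, key (1 / 2) 1 1 a4' a4 ?_ ?_, ?_, ?_⟩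
    · module
    · match_scalars <;> field_simp
    · module
    · match_scalars <;> field_simp <;> simp
    · module
    · match_scalars <;> field_simp
    · module
    · match_scalars <;> field_simp <;> simp
    · have : ξ = (1 / 2 : ℂ) • (ξ + ξ) := by module
      refine Eq.trans ?_ this.symm
      nth_rw 1 [← h5, ← h5']
      push_cast
      module
    · rw [e, a6]
      change (Complex.I / (2 * ρ)) • ((u.2 - ((-1 : ℝ) : ℂ) • v.2) - (u.1 - ((-1 : ℝ) : ℂ) • v.1)) =
        (Complex.I / (2 * ρ)) • (u.2 - u.1) -
          ((1 : ℝ) : ℂ) • ((Complex.I / (2 * ρ)) • (v.1 - v.2))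
      push_cast
      module

/-! ### From operators to graphs -/

/-- The graph of a self-adjoint operator is automatically a `B`-submodule, as adjoint relations are. -/
theorem IsSelfAdjRegular.regular_selfAdj [CompleteSpace E] {T : E →ₗ.[ℂ] E}
    (h : IsSelfAdjRegular B T.graph) : IsRegular B T ∧ IsSelfAdj B T := by
  refine isRegular_and_isSelfAdj_iff.2 ⟨fun b x t hx => ?_, h⟩
  rw [← h.relAdj_eq] at hx ⊢
  intro q hq
  simp only [CStarModule.inner_op_smul_left]
  rw [hx q hq]

theorem IsSelfAdj.isEssSelfAdjOn {T : E →ₗ.[ℂ] E} (h : IsSelfAdj B T) {V : Submodule ℂ E}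
    (hV : T.HasCore V) : IsEssSelfAdjOn B T V :=
  ⟨hV.1, by rwa [hV.2]⟩

theorem hasCore_domain {T : E →ₗ.[ℂ] E} (hT : T.IsClosed) : T.HasCore T.domain := by
  have : relRestrict T.graph T.domain = T.graph :=
    le_antisymm inf_le_left fun p hp => ⟨hp, LinearPMap.mem_domain_of_mem_graph hp⟩
  exact (hasCore_iff hT).2 ⟨le_rfl, by rw [this]; exact hT.submodule_topologicalClosure_eq⟩

variable [CompleteSpace E] {P Q : E →ₗ.[ℂ] E}

theorem isAlmostCommuting_iff : IsAlmostCommuting B P Q ↔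
    IsSelfAdjRegular B P.graph ∧ IsSelfAdjRegular B Q.graph ∧
      HasTwistedCommutator B 1 P.graph Q.graph := by
  constructor
  · rintro ⟨h1, h2, h3, h4, V, -, hV, h5⟩
    refine ⟨(isRegular_and_isSelfAdj_iff.1 ⟨h1, h2⟩).2, (isRegular_and_isSelfAdj_iff.1 ⟨h3, h4⟩).2,
      V, ((hasCore_iff h3.closed).1 hV).2, fun μ hμ => ?_⟩
    obtain ⟨C, hC, h6⟩ := h5 μ hμ
    refine ⟨C, hC, fun ξ hξ => ?_⟩
    obtain ⟨η, hS, hT, hTS, hST, e1, e2⟩ := h6 ξ hξ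
    exact ⟨η, _, _, _, _, P.mem_graph ⟨η, hS⟩, Q.mem_graph ⟨η, hT⟩, P.mem_graph ⟨_, hTS⟩,
      Q.mem_graph ⟨_, hST⟩, e1, by rw [e2, Complex.ofReal_one, one_smul]⟩
  · rintro ⟨h1, h2, h3⟩
    have h1' := h1.regular_selfAdj
    have h2' := h2.regular_selfAdj
    refine ⟨h1'.1, h1'.2, h2'.1, h2'.2, Q.domain, fun b x hx => ?_, hasCore_domain h2'.1.closed,
      fun μ hμ => ?_⟩
    · exact LinearPMap.mem_domain_of_mem_graph (h2'.1.smul_mem b (Q.mem_graph ⟨x, hx⟩))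
    · obtain ⟨C, hC, h4⟩ := h3.exists_on_domain h1 h2 (by norm_num) hμ
      refine ⟨C, hC, fun ξ hξ => ?_⟩
      rw [← relDom_graph] at hξ
      obtain ⟨η, s, t, u, v, a1, a2, a3, a4, a5, a6⟩ := h4 ξ hξ
      have hS := LinearPMap.mem_domain_of_mem_graph a1
      have hT := LinearPMap.mem_domain_of_mem_graph a2
      obtain rfl := apply_eq_of_mem_graph a1 hS
      obtain rfl := apply_eq_of_mem_graph a2 hT
      have hTS := LinearPMap.mem_domain_of_mem_graph a3
      have hST := LinearPMap.mem_domain_of_mem_graph a4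
      refine ⟨η, hS, hT, hTS, hST, a5, ?_⟩
      rw [apply_eq_of_mem_graph a3 hTS, apply_eq_of_mem_graph a4 hST, a6, Complex.ofReal_one,
        one_smul]

theorem isAlmostAntiCommuting_iff : IsAlmostAntiCommuting B P Q ↔
    IsSelfAdjRegular B P.graph ∧ IsSelfAdjRegular B Q.graph ∧
      HasTwistedCommutator B (-1) P.graph Q.graph := by
  constructor
  · rintro ⟨h1, h2, h3, h4, V, -, hV, h5⟩
    refine ⟨(isRegular_and_isSelfAdj_iff.1 ⟨h1, h2⟩).2, (isRegular_and_isSelfAdj_iff.1 ⟨h3, h4⟩).2,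
      V, ((hasCore_iff h3.closed).1 hV).2, fun μ hμ => ?_⟩
    obtain ⟨C, hC, h6⟩ := h5 μ hμ
    refine ⟨C, hC, fun ξ hξ => ?_⟩
    obtain ⟨η, hS, hT, hTS, hST, e1, e2⟩ := h6 ξ hξ
    exact ⟨η, _, _, _, _, P.mem_graph ⟨η, hS⟩, Q.mem_graph ⟨η, hT⟩, P.mem_graph ⟨_, hTS⟩,
      Q.mem_graph ⟨_, hST⟩, e1, by simp [e2]⟩
  · rintro ⟨h1, h2, h3⟩
    have h1' := h1.regular_selfAdj
    have h2' := h2.regular_selfAdj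
    refine ⟨h1'.1, h1'.2, h2'.1, h2'.2, Q.domain, fun b x hx => ?_, hasCore_domain h2'.1.closed,
      fun μ hμ => ?_⟩
    · exact LinearPMap.mem_domain_of_mem_graph (h2'.1.smul_mem b (Q.mem_graph ⟨x, hx⟩))
    · obtain ⟨C, hC, h4⟩ := h3.exists_on_domain h1 h2 (by norm_num) hμ
      refine ⟨C, hC, fun ξ hξ => ?_⟩
      rw [← relDom_graph] at hξ
      obtain ⟨η, s, t, u, v, a1, a2, a3, a4, a5, a6⟩ := h4 ξ hξ
      have hS := LinearPMap.mem_domain_of_mem_graph a1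
      have hT := LinearPMap.mem_domain_of_mem_graph a2
      obtain rfl := apply_eq_of_mem_graph a1 hS
      obtain rfl := apply_eq_of_mem_graph a2 hT
      have hTS := LinearPMap.mem_domain_of_mem_graph a3
      have hST := LinearPMap.mem_domain_of_mem_graph a4
      refine ⟨η, hS, hT, hTS, hST, a5, ?_⟩
      rw [apply_eq_of_mem_graph a3 hTS, apply_eq_of_mem_graph a4 hST, a6]
      simp

end Commutators

/-! ### Representation of functionals on graph domains -/

section Riesz

variable {B : Type*} {E : Type*} [NonUnitalCStarAlgebra B] [PartialOrder B] [StarOrderedRing B]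
  [NormedAddCommGroup E] [NormedSpace ℂ E] [SMul Bᵐᵒᵖ E] [CStarModule Bᵐᵒᵖ E] [CompleteSpace E]

local notation "⟪" x "," y "⟫" => inner Bᵐᵒᵖ x y

variable {T : E →ₗ.[ℂ] E}

theorem norm_sq_le_of_inner_add' (x : E) {a : Bᵐᵒᵖ} (ha : 0 ≤ a) :
    ‖x‖ ^ 2 ≤ ‖a + ⟪x, x⟫‖ := by
  rw [add_comm]
  exact norm_sq_le_of_inner_add x ha

/-- Functionals of the form `x ↦ ⟪u, x⟫ + ⟪v, T x⟫` are represented in the graph inner product of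
a regular operator `T`. -/
theorem IsRegular.exists_graph_riesz (hT : IsRegular B T) (u v : E) :
    ∃ w d, (w, d) ∈ T.graph ∧ ∀ x t, (x, t) ∈ T.graph →
      ⟪u, x⟫ + ⟪v, t⟫ = ⟪w, x⟫ + ⟪d, t⟫ := by
  obtain ⟨x₀, t₀, y₀, w₀, h1, h2, rfl, rfl⟩ := hT.exists_decomp u v
  refine ⟨x₀, t₀, h1, fun x t hx => ?_⟩
  have h3 := h2 _ hx
  dsimp only at h3
  rw [CStarModule.inner_add_left, CStarModule.inner_sub_left, h3]
  abel

/-- Coercivity of the inner products on the domain of an operator, where `a` is the contribution of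
further operators. -/
theorem norm_le_of_graph_inner {w d : E} {K : ℝ} (hK : 0 ≤ K) {a : Bᵐᵒᵖ} (ha : 0 ≤ a)
    (h : ‖⟪w, w⟫ + ⟪d, d⟫ + a‖ ≤ K * (‖w‖ + ‖d‖)) : ‖w‖ ≤ 2 * K ∧ ‖d‖ ≤ 2 * K := by
  have h1 : ‖w‖ ^ 2 ≤ K * (‖w‖ + ‖d‖) := by
    refine le_trans ?_ h
    rw [add_assoc]
    exact norm_sq_le_of_inner_add w (add_nonneg (inner_self_nonneg' _) ha)
  have h2 : ‖d‖ ^ 2 ≤ K * (‖w‖ + ‖d‖) := by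
    refine le_trans ?_ h
    rw [add_right_comm]
    exact norm_sq_le_of_inner_add' d (add_nonneg (inner_self_nonneg' _) ha)
  have hw := norm_nonneg w
  have hd := norm_nonneg d
  rcases le_total ‖w‖ ‖d‖ with h3 | h3
  · have : ‖d‖ ≤ 2 * K := by
      by_contra hc
      nlinarith
    exact ⟨h3.trans this, this⟩
  · have : ‖w‖ ≤ 2 * K := by
      by_contra hc
      nlinarith
    exact ⟨this, h3.trans this⟩

variable {M : ℝ}

/-- If `Dom T ⊆ Dom T*`, then `T* : Dom T → E` has an adjoint for the graph inner product of `T`. The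
adjoint is defined on the dense subspace `Dom T`, and it is bounded. -/
theorem IsRegular.exists_adjoint_riesz (hT : IsRegular B T) (hM : 0 ≤ M)
    (hb : ∀ x t t', (x, t) ∈ T.graph → (x, t') ∈ relAdj B T.graph → ‖t'‖ ≤ M * (‖x‖ + ‖t‖))
    (hdom : ∀ x t, (x, t) ∈ T.graph → ∃ t', (x, t') ∈ relAdj B T.graph) (z : E) :
    ∃ w d, (w, d) ∈ T.graph ∧ ∀ x t t', (x, t) ∈ T.graph → (x, t') ∈ relAdj B T.graph →
      ⟪z, t'⟫ = ⟪w, x⟫ + ⟪d, t⟫ := by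
  let P : Submodule ℂ (E × E × E) :=
    { carrier := {p | (p.2.1, p.2.2) ∈ T.graph ∧ ∀ x t t', (x, t) ∈ T.graph →
        (x, t') ∈ relAdj B T.graph → ⟪p.1, t'⟫ = ⟪p.2.1, x⟫ + ⟪p.2.2, t⟫}
      zero_mem' := ⟨T.graph.zero_mem, fun x t t' _ _ => by simp⟩
      add_mem' := fun {p q} hp hq => ⟨T.graph.add_mem hp.1 hq.1, fun x t t' h h' => by
        simp only [Prod.fst_add, Prod.snd_add, CStarModule.inner_add_left]
        rw [hp.2 x t t' h h', hq.2 x t t' h h']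
        abel⟩
      smul_mem' := fun c p hp => ⟨T.graph.smul_mem c hp.1, fun x t t' h h' => by
        simp only [Prod.smul_fst, Prod.smul_snd, CStarModule.inner_smul_left_complex]
        rw [hp.2 x t t' h h', smul_add]⟩ }
  have hP : IsClosed (P : Set (E × E × E)) := by
    have h1 : IsClosed {p : E × E × E | (p.2.1, p.2.2) ∈ T.graph} :=
      hT.closed.preimage (f := fun p : E × E × E => (p.2.1, p.2.2)) (by fun_prop)
    have h2 : IsClosed {p : E × E × E | ∀ x t t', (x, t) ∈ T.graph →
        (x, t') ∈ relAdj B T.graph → ⟪p.1, t'⟫ = ⟪p.2.1, x⟫ + ⟪p.2.2, t⟫} := by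
      simp only [Set.ofPred_forall]
      refine isClosed_iInter fun x => isClosed_iInter fun t => isClosed_iInter fun t' =>
        isClosed_iInter fun _ => isClosed_iInter fun _ => isClosed_eq ?_ ?_
      · exact (continuous_inner_right t').comp continuous_fst
      · exact ((continuous_inner_right x).comp (continuous_fst.comp continuous_snd)).add
          ((continuous_inner_right t).comp (continuous_snd.comp continuous_snd))
    exact h1.inter h2
  have : CompleteSpace P := hP.completeSpace_coe
  let f : P →L[ℂ] E := (ContinuousLinearMap.fst ℂ E (E × E)).comp P.subtypeL
  have hf : Function.Surjective f := by
    refine surjective_of_bound_of_denseRange f (1 + 2 * M) ?_ ?_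
    · rintro ⟨⟨z, w, d⟩, h1, h2⟩
      change ‖(z, w, d)‖ ≤ (1 + 2 * M) * ‖z‖
      obtain ⟨d', hd'⟩ := hdom _ _ h1
      have h3 := h2 _ _ _ h1 hd'
      have h4 := norm_le_of_graph_inner (B := B) (w := w) (d := d) (K := M * ‖z‖) (by positivity)
        le_rfl (by
          rw [add_zero]
          rw [← h3]
          refine (norm_inner_le' _ _).trans ?_
          have := mul_le_mul_of_nonneg_left (hb _ _ _ h1 hd') (norm_nonneg z)
          linarith)
      have h5 : 0 ≤ M * ‖z‖ := by positivity
      refine norm_prod_le_iff.2 ⟨by linarith, norm_prod_le_iff.2 ⟨?_, ?_⟩⟩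
      · linarith [h4.1, norm_nonneg z]
      · linarith [h4.2, norm_nonneg z]
    · refine hT.dense_domain.mono ?_
      intro z hz
      have hz' := T.mem_graph ⟨z, hz⟩
      obtain ⟨w, d, h1, h2⟩ := hT.exists_graph_riesz (T ⟨z, hz⟩) 0
      refine ⟨⟨(z, w, d), h1, fun x t t' h h' => ?_⟩, rfl⟩
      have h3 := h2 x t h
      rw [CStarModule.inner_zero_left, add_zero] at h3
      rw [← h3]
      have := congrArg star (h' _ hz')
      simpa using this.symm
  obtain ⟨⟨⟨z', w, d⟩, h1, h2⟩, h3⟩ := hf z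
  obtain rfl : z' = z := h3
  exact ⟨w, d, h1, h2⟩

/-- If `Dom T ⊆ Dom T*`, then all functionals of the form `x ↦ ⟪u, x⟫ + ⟪v, T x⟫ + ⟪v', T* x⟫` are
represented in each of the inner products `⟪x, y⟫ + (1 + α) ⟪T x, T y⟫ + β ⟪T* x, T* y⟫`. -/
theorem IsRegular.exists_riesz (hT : IsRegular B T) (hM : 0 ≤ M)
    (hb : ∀ x t t', (x, t) ∈ T.graph → (x, t') ∈ relAdj B T.graph → ‖t'‖ ≤ M * (‖x‖ + ‖t‖))
    (hdom : ∀ x t, (x, t) ∈ T.graph → ∃ t', (x, t') ∈ relAdj B T.graph)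
    {α β : ℝ} (hα : 0 ≤ α) (hβ : 0 ≤ β) (u v v' : E) :
    ∃ w d d', (w, d) ∈ T.graph ∧ (w, d') ∈ relAdj B T.graph ∧
      ∀ x t t', (x, t) ∈ T.graph → (x, t') ∈ relAdj B T.graph → ⟪u, x⟫ + ⟪v, t⟫ + ⟪v', t'⟫ =
        ⟪w, x⟫ + ((1 + α : ℝ) : ℂ) • ⟪d, t⟫ + (β : ℂ) • ⟪d', t'⟫ := by
  set G := T.graph with hG
  set H := relAdj B G with hH
  -- every functional is represented in the graph inner product of `T`
  have hrep : ∀ u v v' : E, ∃ w d, (w, d) ∈ G ∧ ∀ x t t', (x, t) ∈ G → (x, t') ∈ H →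
      ⟪u, x⟫ + ⟪v, t⟫ + ⟪v', t'⟫ = ⟪w, x⟫ + ⟪d, t⟫ := by
    intro u v v'
    obtain ⟨w, d, h1, h2⟩ := hT.exists_graph_riesz u v
    obtain ⟨w', d', h1', h2'⟩ := hT.exists_adjoint_riesz hM hb hdom v'
    refine ⟨w + w', d + d', G.add_mem h1 h1', fun x t t' h h' => ?_⟩
    rw [h2 x t h, h2' x t t' h h', CStarModule.inner_add_left, CStarModule.inner_add_left]
    abel
  have hGc : IsClosed (G : Set (E × E)) := hT.closed
  have hHc : IsClosed (H : Set (E × E)) := isClosed_relAdj G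
  have hG0 : ∀ d, (0, d) ∈ G → d = 0 := fun d hd => T.mem_graph_snd_inj hd G.zero_mem rfl
  have hH0 : ∀ d, (0, d) ∈ H → d = 0 := by
    intro d hd
    refine eq_zero_of_mem_relAdj ?_ (B := B) hd
    rw [← coe_domain_eq]
    exact hT.dense_domain
  -- the perturbation `A` of the graph inner product, defined on tuples `(w, T w, T* w, A w, T A w)`
  let P : Submodule ℂ (E × E × E × E × E) :=
    { carrier := {p | (p.1, p.2.1) ∈ G ∧ (p.1, p.2.2.1) ∈ H ∧ (p.2.2.2.1, p.2.2.2.2) ∈ G ∧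
        ∀ x t t', (x, t) ∈ G → (x, t') ∈ H → ⟪p.2.2.2.1, x⟫ + ⟪p.2.2.2.2, t⟫ =
          (α : ℂ) • ⟪p.2.1, t⟫ + (β : ℂ) • ⟪p.2.2.1, t'⟫}
      zero_mem' := ⟨G.zero_mem, H.zero_mem, G.zero_mem, fun x t t' _ _ => by simp⟩
      add_mem' := fun {p q} hp hq => ⟨G.add_mem hp.1 hq.1, H.add_mem hp.2.1 hq.2.1,
        G.add_mem hp.2.2.1 hq.2.2.1, fun x t t' h h' => by
          have e1 := hp.2.2.2 x t t' h h'
          have e2 := hq.2.2.2 x t t' h h'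
          simp only [Prod.fst_add, Prod.snd_add, CStarModule.inner_add_left]
          rw [add_add_add_comm, e1, e2]
          module⟩
      smul_mem' := fun c p hp => ⟨G.smul_mem c hp.1, H.smul_mem c hp.2.1,
        G.smul_mem c hp.2.2.1, fun x t t' h h' => by
          have e1 := hp.2.2.2 x t t' h h'
          simp only [Prod.smul_fst, Prod.smul_snd, CStarModule.inner_smul_left_complex]
          rw [← smul_add, e1]
          module⟩ }
  have hP : IsClosed (P : Set (E × E × E × E × E)) := by
    have h1 : IsClosed {p : E × E × E × E × E | (p.1, p.2.1) ∈ G} :=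
      hGc.preimage (f := fun p : E × E × E × E × E => (p.1, p.2.1)) (by fun_prop)
    have h2 : IsClosed {p : E × E × E × E × E | (p.1, p.2.2.1) ∈ H} :=
      hHc.preimage (f := fun p : E × E × E × E × E => (p.1, p.2.2.1)) (by fun_prop)
    have h3 : IsClosed {p : E × E × E × E × E | (p.2.2.2.1, p.2.2.2.2) ∈ G} :=
      hGc.preimage (f := fun p : E × E × E × E × E => (p.2.2.2.1, p.2.2.2.2)) (by fun_prop)
    have h4 : IsClosed {p : E × E × E × E × E | ∀ x t t', (x, t) ∈ G → (x, t') ∈ H →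
        ⟪p.2.2.2.1, x⟫ + ⟪p.2.2.2.2, t⟫ = (α : ℂ) • ⟪p.2.1, t⟫ + (β : ℂ) • ⟪p.2.2.1, t'⟫} := by
      simp only [Set.ofPred_forall]
      refine isClosed_iInter fun x => isClosed_iInter fun t => isClosed_iInter fun t' =>
        isClosed_iInter fun _ => isClosed_iInter fun _ => isClosed_eq ?_ ?_
      · exact ((continuous_inner_right x).comp (by fun_prop)).add
          ((continuous_inner_right t).comp (by fun_prop))
      · have c1 : Continuous fun p : E × E × E × E × E => ⟪p.2.1, t⟫ :=
          (continuous_inner_right t).comp (by fun_prop)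
        have c2 : Continuous fun p : E × E × E × E × E => ⟪p.2.2.1, t'⟫ :=
          (continuous_inner_right t').comp (by fun_prop)
        exact (c1.const_smul (α : ℂ)).add (c2.const_smul (β : ℂ))
    exact h1.inter (h2.inter (h3.inter h4))
  have : CompleteSpace P := hP.completeSpace_coe
  have : CompleteSpace G := hGc.completeSpace_coe
  let C : P →L[ℂ] G := (((ContinuousLinearMap.fst ℂ _ _).prod ((ContinuousLinearMap.fst ℂ _ _).comp
    (ContinuousLinearMap.snd ℂ _ _))).comp P.subtypeL).codRestrict G fun p => p.2.1
  let A : P →L[ℂ] G := (((ContinuousLinearMap.snd ℂ _ _).comp ((ContinuousLinearMap.snd ℂ _ _).comp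
    (ContinuousLinearMap.snd ℂ _ _))).comp P.subtypeL).codRestrict G fun p => p.2.2.2.1
  have hC : Function.Bijective C := by
    constructor
    · rw [injective_iff_map_eq_zero]
      rintro ⟨⟨w, d, d', y, y'⟩, h1, h2, h3, h4⟩ h5
      obtain ⟨h6, h7⟩ : w = 0 ∧ d = 0 := Prod.ext_iff.1 (congrArg Subtype.val h5)
      dsimp only at h1 h2 h3 h4
      subst h6 h7
      obtain rfl := hH0 _ h2
      obtain ⟨t', ht'⟩ := hdom _ _ h3
      have h8 := h4 _ _ _ h3 ht'
      have h9 := norm_le_of_graph_inner (B := B) (w := y) (d := y') le_rfl (le_refl 0)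
        (by rw [add_zero, h8]; simp)
      rw [mul_zero, norm_le_zero_iff, norm_le_zero_iff] at h9
      obtain ⟨rfl, rfl⟩ := h9
      rfl
    · rintro ⟨⟨w, d⟩, h1⟩
      obtain ⟨d', h2⟩ := hdom _ _ h1
      obtain ⟨y, y', h3, h4⟩ := hrep 0 ((α : ℂ) • d) ((β : ℂ) • d')
      refine ⟨⟨(w, d, d', y, y'), h1, h2, h3, fun x t t' h h' => ?_⟩, rfl⟩
      rw [← h4 x t t' h h']
      simp
  have hsurj : Function.Surjective (A + C) := by
    refine surjective_of_bound_segment_of_bijective A C hC (k := 1 / 4) (by norm_num) fun s hs0 hs1 p => ?_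
    obtain ⟨⟨w, d, d', y, y'⟩, h1, h2, h3, h4⟩ := p
    change 1 / 4 * ‖(w, d)‖ ≤ ‖((s : ℂ) • y + w, (s : ℂ) • y' + d)‖
    dsimp only at h1 h2 h3 h4
    set q := ((s : ℂ) • y + w, (s : ℂ) • y' + d) with hq
    have e : ⟪q.1, w⟫ + ⟪q.2, d⟫ = ⟪w, w⟫ + ⟪d, d⟫ +
        (((s * α : ℝ) : ℂ) • ⟪d, d⟫ + ((s * β : ℝ) : ℂ) • ⟪d', d'⟫) := by
      have h5 : star (s : ℂ) = s := Complex.conj_ofReal s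
      simp only [hq, CStarModule.inner_add_left, CStarModule.inner_smul_left_complex, h5]
      have h6 := h4 _ _ _ h1 h2
      push_cast
      linear_combination (norm := module) (s : ℂ) • h6
    have h7 := norm_le_of_graph_inner (B := B) (w := w) (d := d) (K := ‖q‖) (norm_nonneg _)
      (add_nonneg (smul_inner_self_nonneg (mul_nonneg hs0 hα) d)
        (smul_inner_self_nonneg (mul_nonneg hs0 hβ) d')) (by
        rw [← e]
        refine (norm_add_le _ _).trans ?_
        have a1 := (norm_inner_le' (B := B) q.1 w).trans
          (mul_le_mul_of_nonneg_right (norm_fst_le q) (norm_nonneg w))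
        have a2 := (norm_inner_le' (B := B) q.2 d).trans
          (mul_le_mul_of_nonneg_right (norm_snd_le q) (norm_nonneg d))
        linarith)
    have h8 : ‖(w, d)‖ ≤ 2 * ‖q‖ := norm_prod_le_iff.2 h7
    have := norm_nonneg q
    linarith
  obtain ⟨w₀, d₀, h1, h2⟩ := hrep u v v'
  obtain ⟨⟨⟨w, d, d', y, y'⟩, h3, h4, h5, h6⟩, h7⟩ := hsurj ⟨(w₀, d₀), h1⟩
  obtain ⟨h8, h9⟩ : y + w = w₀ ∧ y' + d = d₀ := Prod.ext_iff.1 (congrArg Subtype.val h7)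
  refine ⟨w, d, d', h3, h4, fun x t t' h h' => ?_⟩
  have h10 := h6 x t t' h h'
  dsimp only at h10
  rw [h2 x t t' h h', ← h8, ← h9, CStarModule.inner_add_left, CStarModule.inner_add_left,
    add_add_add_comm, h10]
  push_cast
  module

end Riesz

/-! ### Compactness on graph domains -/

section Compactness

variable (B : Type*) {E : Type*} [NonUnitalCStarAlgebra B] [PartialOrder B] [StarOrderedRing B]
  [NormedAddCommGroup E] [NormedSpace ℂ E] [SMul Bᵐᵒᵖ E] [CStarModule Bᵐᵒᵖ E]

local notation "⟪" x "," y "⟫" => inner Bᵐᵒᵖ x y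

/-- Compactness of the operator `a : Dom S ∩ Dom T → E`, where `S` and `T` have the graphs `G` and
`H`. In contrast to `IsCompactOnDomain`, the functionals in the rank one operators are
`x ↦ ⟪u, x⟫ + ⟪v, S x⟫ + ⟪v', T x⟫` for arbitrary vectors `u`, `v`, `v'`, so that the notion does not
depend on the choice of an inner product on `Dom S ∩ Dom T`. -/
def IsCompactRel (G H : Submodule ℂ (E × E)) (a : E →ₗ[ℂ] E) : Prop :=
  ∀ ε : ℝ, 0 < ε → ∃ (ι : Type) (_ : Fintype ι) (e u v v' : ι → E),
    ∀ x t t', (x, t) ∈ G → (x, t') ∈ H →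
      ‖a x - ∑ i, (⟪u i, x⟫ + ⟪v i, t⟫ + ⟪v' i, t'⟫) • e i‖ ≤ ε * (‖x‖ + ‖t‖ + ‖t'‖)

variable {B}

theorem sqrt_norm_inner_le (x t t' : E) :
    √‖⟪x, x⟫ + ⟪t, t⟫ + ⟪t', t'⟫‖ ≤ ‖x‖ + ‖t‖ + ‖t'‖ := by
  refine Real.sqrt_le_iff.2 ⟨by positivity, ?_⟩
  refine (norm_add₃_le).trans ?_
  rw [norm_inner_self_eq, norm_inner_self_eq, norm_inner_self_eq]
  nlinarith [norm_nonneg x, norm_nonneg t, norm_nonneg t', mul_nonneg (norm_nonneg x) (norm_nonneg t),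
    mul_nonneg (norm_nonneg x) (norm_nonneg t'), mul_nonneg (norm_nonneg t) (norm_nonneg t')]

theorem le_sqrt_norm_inner (x t t' : E) :
    ‖x‖ + ‖t‖ + ‖t'‖ ≤ 3 * √‖⟪x, x⟫ + ⟪t, t⟫ + ⟪t', t'⟫‖ := by
  have hx := inner_self_nonneg' (B := B) x
  have ht := inner_self_nonneg' (B := B) t
  have ht' := inner_self_nonneg' (B := B) t'
  have h1 : ‖x‖ ≤ √‖⟪x, x⟫ + ⟪t, t⟫ + ⟪t', t'⟫‖ := by
    refine Real.le_sqrt_of_sq_le ?_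
    rw [add_assoc]
    exact norm_sq_le_of_inner_add x (add_nonneg ht ht')
  have h2 : ‖t‖ ≤ √‖⟪x, x⟫ + ⟪t, t⟫ + ⟪t', t'⟫‖ := by
    refine Real.le_sqrt_of_sq_le ?_
    rw [add_comm ⟪x, x⟫, add_assoc]
    exact norm_sq_le_of_inner_add t (add_nonneg hx ht')
  have h3 : ‖t'‖ ≤ √‖⟪x, x⟫ + ⟪t, t⟫ + ⟪t', t'⟫‖ := by
    refine Real.le_sqrt_of_sq_le ?_
    rw [add_comm]
    exact norm_sq_le_of_inner_add t' (add_nonneg hx ht)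
  linarith

theorem graphInner_eq {S T : E →ₗ.[ℂ] E} {x s t : E} (hs : (x, s) ∈ S.graph) (ht : (x, t) ∈ T.graph)
    (w : ↥(S.domain ⊓ T.domain)) (hx : x ∈ S.domain ⊓ T.domain) :
    graphInner B S T w ⟨x, hx⟩ = ⟪(w : E), x⟫ + ⟪S ⟨w, w.2.1⟩, s⟫ + ⟪T ⟨w, w.2.2⟩, t⟫ := by
  rw [graphInner, ← apply_eq_of_mem_graph hs hx.1, ← apply_eq_of_mem_graph ht hx.2]

theorem graphNorm_eq {S T : E →ₗ.[ℂ] E} {x s t : E} (hs : (x, s) ∈ S.graph) (ht : (x, t) ∈ T.graph)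
    (hx : x ∈ S.domain ⊓ T.domain) :
    graphNorm B S T ⟨x, hx⟩ = √‖⟪x, x⟫ + ⟪s, s⟫ + ⟪t, t⟫‖ := by
  rw [graphNorm, graphInner, ← apply_eq_of_mem_graph hs hx.1, ← apply_eq_of_mem_graph ht hx.2]

theorem IsCompactOnDomain.isCompactRel {S T : E →ₗ.[ℂ] E} {a : E →ₗ[ℂ] E}
    (h : IsCompactOnDomain B S T (a.comp (S.domain ⊓ T.domain).subtype)) :
    IsCompactRel B S.graph T.graph a := by
  intro ε hε
  obtain ⟨n, e, w, h⟩ := h ε hε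
  refine ⟨Fin n, inferInstance, e, fun i => w i, fun i => S ⟨w i, (w i).2.1⟩,
    fun i => T ⟨w i, (w i).2.2⟩, fun x t t' hx hx' => ?_⟩
  have hm : x ∈ S.domain ⊓ T.domain :=
    ⟨LinearPMap.mem_domain_of_mem_graph hx, LinearPMap.mem_domain_of_mem_graph hx'⟩
  have h1 := h ⟨x, hm⟩
  rw [graphNorm_eq hx hx'] at h1
  simp only [graphInner_eq hx hx'] at h1
  exact h1.trans (mul_le_mul_of_nonneg_left (sqrt_norm_inner_le x t t') hε.le)

/-- The converse of `IsCompactOnDomain.isCompactRel` holds if all functionals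
`x ↦ ⟪u, x⟫ + ⟪v, S x⟫ + ⟪v', T x⟫` are represented in the inner product `graphInner`. -/
theorem IsCompactRel.isCompactOnDomain {S T : E →ₗ.[ℂ] E} {a : E →ₗ[ℂ] E}
    (h : IsCompactRel B S.graph T.graph a)
    (hr : ∀ u v v' : E, ∃ w s t, (w, s) ∈ S.graph ∧ (w, t) ∈ T.graph ∧
      ∀ x s' t', (x, s') ∈ S.graph → (x, t') ∈ T.graph →
        ⟪u, x⟫ + ⟪v, s'⟫ + ⟪v', t'⟫ = ⟪w, x⟫ + ⟪s, s'⟫ + ⟪t, t'⟫) :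
    IsCompactOnDomain B S T (a.comp (S.domain ⊓ T.domain).subtype) := by
  intro ε hε
  obtain ⟨ι, _, e, u, v, v', h⟩ := h (ε / 3) (by positivity)
  choose w s t h1 h2 h3 using fun i => hr (u i) (v i) (v' i)
  have hm : ∀ i, w i ∈ S.domain ⊓ T.domain := fun i =>
    ⟨LinearPMap.mem_domain_of_mem_graph (h1 i), LinearPMap.mem_domain_of_mem_graph (h2 i)⟩
  let f := (Fintype.equivFin ι).symm
  refine ⟨Fintype.card ι, fun i => e (f i), fun i => ⟨w (f i), hm _⟩, fun x => ?_⟩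
  obtain ⟨x, hx⟩ := x
  have hs := S.mem_graph ⟨x, hx.1⟩
  have ht := T.mem_graph ⟨x, hx.2⟩
  have h4 := h _ _ _ hs ht
  have h5 : ∑ i, graphInner B S T ⟨w (f i), hm _⟩ ⟨x, hx⟩ • e (f i) =
      ∑ i, (⟪u i, x⟫ + ⟪v i, S ⟨x, hx.1⟩⟫ + ⟪v' i, T ⟨x, hx.2⟩⟫) • e i := by
    rw [← Equiv.sum_comp f]
    refine Finset.sum_congr rfl fun i _ => ?_
    rw [graphInner_eq hs ht, h3 (f i) _ _ _ hs ht, apply_eq_of_mem_graph (h1 _),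
      apply_eq_of_mem_graph (h2 _)]
  rw [h5]
  refine h4.trans ?_
  rw [graphNorm_eq hs ht]
  have := mul_le_mul_of_nonneg_left (le_sqrt_norm_inner (B := B) x (S ⟨x, hx.1⟩) (T ⟨x, hx.2⟩))
    (by positivity : 0 ≤ ε / 3)
  linarith

/-- Compactness passes to a stronger norm on a smaller domain, provided that the functionals given by
the old operators are also given by the new ones. -/
theorem IsCompactRel.of_le {G H G' H' : Submodule ℂ (E × E)} {a : E →ₗ[ℂ] E}
    (h : IsCompactRel B G H a) {K : ℝ} (hK : 0 ≤ K)
    (h1 : ∀ x t t', (x, t) ∈ G' → (x, t') ∈ H' → ∃ s s', (x, s) ∈ G ∧ (x, s') ∈ H ∧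
      ‖s‖ + ‖s'‖ ≤ K * (‖x‖ + ‖t‖ + ‖t'‖))
    (h2 : ∀ u v v' : E, ∃ w z z' : E, ∀ x t t' s s', (x, t) ∈ G' → (x, t') ∈ H' → (x, s) ∈ G →
      (x, s') ∈ H → ⟪u, x⟫ + ⟪v, s⟫ + ⟪v', s'⟫ = ⟪w, x⟫ + ⟪z, t⟫ + ⟪z', t'⟫) :
    IsCompactRel B G' H' a := by
  intro ε hε
  obtain ⟨ι, _, e, u, v, v', h⟩ := h (ε / (1 + K)) (by positivity)
  choose w z z' h3 using fun i => h2 (u i) (v i) (v' i)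
  refine ⟨ι, inferInstance, e, w, z, z', fun x t t' hx hx' => ?_⟩
  obtain ⟨s, s', hs, hs', hb⟩ := h1 x t t' hx hx'
  have h4 := h x s s' hs hs'
  simp only [h3 _ x t t' s s' hx hx' hs hs'] at h4
  refine h4.trans ?_
  rw [div_mul_eq_mul_div, div_le_iff₀ (by positivity)]
  have h5 : ‖x‖ + ‖s‖ + ‖s'‖ ≤ (1 + K) * (‖x‖ + ‖t‖ + ‖t'‖) := by
    linarith [norm_nonneg t, norm_nonneg t']
  have := mul_le_mul_of_nonneg_left h5 hε.le
  linarith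

/-- Compactness passes from the domain of `G` and `H` to that of `G'` and `H'`, if `G` and `H` extend
linear combinations of `G'` and `H'`. -/
theorem IsCompactRel.of_combination {G H G' H' : Submodule ℂ (E × E)} {a : E →ₗ[ℂ] E}
    (h : IsCompactRel B G H a) (hG : ∀ x s s', (x, s) ∈ G → (x, s') ∈ G → s = s')
    (hH : ∀ x s s', (x, s) ∈ H → (x, s') ∈ H → s = s') (α β γ δ : ℂ)
    (h1 : ∀ x t t', (x, t) ∈ G' → (x, t') ∈ H' → (x, α • t + β • t') ∈ G ∧
      (x, γ • t + δ • t') ∈ H) : IsCompactRel B G' H' a := by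
  refine h.of_le (K := ‖α‖ + ‖β‖ + ‖γ‖ + ‖δ‖) (by positivity) (fun x t t' hx hx' => ?_)
    fun u v v' => ⟨u, star α • v + star γ • v', star β • v + star δ • v', ?_⟩
  · refine ⟨_, _, (h1 x t t' hx hx').1, (h1 x t t' hx hx').2, ?_⟩
    have e1 := norm_add_le (α • t) (β • t')
    have e2 := norm_add_le (γ • t) (δ • t')
    rw [norm_smul, norm_smul] at e1 e2
    have : 0 ≤ (‖α‖ + ‖β‖ + ‖γ‖ + ‖δ‖) * ‖x‖ := by positivity
    have : 0 ≤ ‖α‖ * ‖t'‖ + ‖γ‖ * ‖t'‖ + ‖β‖ * ‖t‖ + ‖δ‖ * ‖t‖ := by positivity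
    linarith
  · intro x t t' s s' hx hx' hs hs'
    rw [hG _ _ _ hs (h1 x t t' hx hx').1, hH _ _ _ hs' (h1 x t t' hx hx').2]
    simp only [CStarModule.inner_add_left, CStarModule.inner_add_right,
      CStarModule.inner_smul_left_complex, CStarModule.inner_smul_right_complex, star_star]
    abel

variable {X Y X' Y' : Submodule ℂ (E × E)} {a : E →ₗ[ℂ] E}

theorem norm_fst_le_sum (p : Sum₂ B E) : ‖p.1‖ ≤ ‖p‖ :=
  (le_max_left _ _).trans (WithCStarModule.max_le_prod_norm p)

theorem norm_snd_le_sum (p : Sum₂ B E) : ‖p.2‖ ≤ ‖p‖ :=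
  (le_max_right _ _).trans (WithCStarModule.max_le_prod_norm p)

theorem norm_pair_le (x y : E) : ‖pairL B (x, y)‖ ≤ ‖x‖ + ‖y‖ :=
  WithCStarModule.prod_norm_le_norm_add _

theorem sum_fst {ι : Type} [Fintype ι] (c : ι → Bᵐᵒᵖ) (p : ι → Sum₂ B E) :
    (∑ i, c i • p i).1 = ∑ i, c i • (p i).1 := map_sum (fstL B) _ _

theorem sum_snd {ι : Type} [Fintype ι] (c : ι → Bᵐᵒᵖ) (p : ι → Sum₂ B E) :
    (∑ i, c i • p i).2 = ∑ i, c i • (p i).2 := map_sum (sndL B) _ _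

/-- Compactness on the domain of off-diagonal operator matrices reduces to compactness on the
domains of the entries. -/
theorem isCompactRel_relOff_iff :
    IsCompactRel B (relOff (B := B) X Y) (relOff X' Y') (diag B a a) ↔
      IsCompactRel B Y Y' a ∧ IsCompactRel B X X' a := by
  constructor
  · intro h
    constructor
    · intro ε hε
      obtain ⟨ι, _, e, u, v, v', h⟩ := h ε hε
      refine ⟨ι, inferInstance, fun i => (e i).1, fun i => (u i).1, fun i => (v i).2,
        fun i => (v' i).2, fun x t t' hx hx' => ?_⟩
      have h1 := h (pairL B (x, 0)) (pairL B (0, t)) (pairL B (0, t')) ⟨X.zero_mem, hx⟩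
        ⟨X'.zero_mem, hx'⟩
      have h2 := (norm_fst_le_sum _).trans h1
      rw [WithCStarModule.sub_fst, sum_fst] at h2
      simp only [sum_inner, pairL_fst, pairL_snd, CStarModule.inner_zero_right, add_zero,
        zero_add] at h2
      refine h2.trans (mul_le_mul_of_nonneg_left ?_ hε.le)
      have e1 := norm_pair_le (B := B) x 0
      have e2 := norm_pair_le (B := B) 0 t
      have e3 := norm_pair_le (B := B) 0 t'
      rw [norm_zero] at e1 e2 e3
      linarith
    · intro ε hε
      obtain ⟨ι, _, e, u, v, v', h⟩ := h ε hε
      refine ⟨ι, inferInstance, fun i => (e i).2, fun i => (u i).2, fun i => (v i).1,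
        fun i => (v' i).1, fun x t t' hx hx' => ?_⟩
      have h1 := h (pairL B (0, x)) (pairL B (t, 0)) (pairL B (t', 0)) ⟨hx, Y.zero_mem⟩
        ⟨hx', Y'.zero_mem⟩
      have h2 := (norm_snd_le_sum _).trans h1
      rw [WithCStarModule.sub_snd, sum_snd] at h2
      simp only [sum_inner, pairL_fst, pairL_snd, CStarModule.inner_zero_right, add_zero,
        zero_add] at h2
      refine h2.trans (mul_le_mul_of_nonneg_left ?_ hε.le)
      have e1 := norm_pair_le (B := B) 0 x
      have e2 := norm_pair_le (B := B) t 0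
      have e3 := norm_pair_le (B := B) t' 0
      rw [norm_zero] at e1 e2 e3
      linarith
  · rintro ⟨h1, h2⟩ ε hε
    obtain ⟨ι₁, _, e₁, u₁, v₁, v₁', h1⟩ := h1 (ε / 2) (by positivity)
    obtain ⟨ι₂, _, e₂, u₂, v₂, v₂', h2⟩ := h2 (ε / 2) (by positivity)
    refine ⟨ι₁ ⊕ ι₂, inferInstance,
      Sum.elim (fun i => pairL B (e₁ i, 0)) (fun i => pairL B (0, e₂ i)),
      Sum.elim (fun i => pairL B (u₁ i, 0)) (fun i => pairL B (0, u₂ i)),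
      Sum.elim (fun i => pairL B (0, v₁ i)) (fun i => pairL B (v₂ i, 0)),
      Sum.elim (fun i => pairL B (0, v₁' i)) (fun i => pairL B (v₂' i, 0)), ?_⟩
    rintro p q q' ⟨hp1, hp2⟩ ⟨hp1', hp2'⟩
    have a1 := h1 _ _ _ hp2 hp2'
    have a2 := h2 _ _ _ hp1 hp1'
    refine (WithCStarModule.prod_norm_le_norm_add _).trans ?_
    rw [WithCStarModule.sub_fst, WithCStarModule.sub_snd, sum_fst, sum_snd]
    simp only [Fintype.sum_sum_type, Sum.elim_inl, Sum.elim_inr, sum_inner, pairL_fst, pairL_snd,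
      CStarModule.inner_zero_left, zero_add, add_zero]
    have z : ∀ c : Bᵐᵒᵖ, c • (0 : E) = 0 := by
      intro c
      refine eq_of_inner_left_eq (B := B) fun x => ?_
      rw [CStarModule.inner_op_smul_right]
      simp
    simp only [z, Finset.sum_const_zero, zero_add, add_zero]
    refine (add_le_add a1 a2).trans ?_
    have b1 := norm_fst_le_sum p
    have b2 := norm_snd_le_sum p
    have b3 := norm_fst_le_sum q
    have b4 := norm_snd_le_sum q
    have b5 := norm_fst_le_sum q'
    have b6 := norm_snd_le_sum q'
    have b7 : ‖p.1‖ + ‖q.2‖ + ‖q'.2‖ + (‖p.2‖ + ‖q.1‖ + ‖q'.1‖) ≤ 2 * (‖p‖ + ‖q‖ + ‖q'‖) := by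
      linarith
    have := mul_le_mul_of_nonneg_left b7 hε.le
    dsimp only at this ⊢
    linarith

end Compactness

/-! ### Cores and commutators -/

section CoresCommutators

variable {B : Type*} {E : Type*} [NonUnitalCStarAlgebra B] [PartialOrder B] [StarOrderedRing B]
  [NormedAddCommGroup E] [NormedSpace ℂ E] [SMul Bᵐᵒᵖ E] [CStarModule Bᵐᵒᵖ E]

local notation "⟪" x "," y "⟫" => inner Bᵐᵒᵖ x y

theorem hasCore_mono {T : E →ₗ.[ℂ] E} (hT : T.IsClosed) {V W : Submodule ℂ E} (hV : T.HasCore V)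
    (h : V ≤ W) (hW : W ≤ T.domain) : T.HasCore W := by
  rw [hasCore_iff hT] at hV ⊢
  refine ⟨hW, le_antisymm (Submodule.topologicalClosure_minimal _ inf_le_left hT) ?_⟩
  exact hV.2.ge.trans (Submodule.topologicalClosure_mono fun p hp => ⟨hp.1, h hp.2⟩)

theorem dense_of_hasCore {T : E →ₗ.[ℂ] E} (hT : T.IsClosed) (hd : Dense (T.domain : Set E))
    {V : Submodule ℂ E} (hV : T.HasCore V) : Dense (V : Set E) := by
  rw [hasCore_iff hT] at hV
  refine dense_closure.1 (hd.mono fun x hx => ?_)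
  have h1 : (x, T ⟨x, hx⟩) ∈ (relRestrict T.graph V).topologicalClosure := by
    rw [hV.2]
    exact T.mem_graph ⟨x, hx⟩
  exact map_mem_closure continuous_fst h1 fun p hp => hp.2

theorem HasBoundedCommutatorOn.mono {T : E →ₗ.[ℂ] E} {a : E →ₗ[ℂ] E} {V W : Submodule ℂ E}
    (h : HasBoundedCommutatorOn T a W) (hV : V ≤ W) : HasBoundedCommutatorOn T a V := by
  obtain ⟨C, h⟩ := h
  exact ⟨C, fun x hx => h x (hV hx)⟩

theorem hasBoundedCommutatorOn_iff {T : E →ₗ.[ℂ] E} {a : E →ₗ[ℂ] E} {V : Submodule ℂ E} :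
    HasBoundedCommutatorOn T a V ↔ ∃ C : ℝ, ∀ x ∈ V, ∃ t t', (x, t) ∈ T.graph ∧
      (a x, t') ∈ T.graph ∧ ‖t' - a t‖ ≤ C * ‖x‖ := by
  refine exists_congr fun C => forall₂_congr fun x hx => ?_
  constructor
  · rintro ⟨h, h', hb⟩
    exact ⟨_, _, T.mem_graph ⟨x, h⟩, T.mem_graph ⟨a x, h'⟩, hb⟩
  · rintro ⟨t, t', h, h', hb⟩
    refine ⟨LinearPMap.mem_domain_of_mem_graph h, LinearPMap.mem_domain_of_mem_graph h', ?_⟩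
    rwa [apply_eq_of_mem_graph h, apply_eq_of_mem_graph h']

/-- A commutator with a bounded operator which is bounded on a core is bounded on the domain. -/
theorem HasBoundedCommutatorOn.of_core [CompleteSpace E] {T : E →ₗ.[ℂ] E} (hT : T.IsClosed)
    {a : E →ₗ[ℂ] E} (ha : Continuous a) {V : Submodule ℂ E} (hV : T.HasCore V)
    (h : HasBoundedCommutatorOn T a V) : HasBoundedCommutatorOn T a T.domain := by
  rw [hasBoundedCommutatorOn_iff] at h ⊢
  rw [hasCore_iff hT] at hV
  obtain ⟨C, h⟩ := h
  let A : E →L[ℂ] E := ⟨a, ha⟩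
  have hA : ∀ x, ‖a x‖ ≤ ‖A‖ * ‖x‖ := A.le_opNorm
  refine ⟨C, fun x hx => ?_⟩
  have hx1 : (x, T ⟨x, hx⟩) ∈ (relRestrict T.graph V).topologicalClosure := by
    rw [hV.2]
    exact T.mem_graph ⟨x, hx⟩
  obtain ⟨p, hp, hlim⟩ := mem_closure_iff_seq_limit.1 hx1
  have hp1 : Tendsto (fun n => (p n).1) atTop (𝓝 x) := (continuous_fst.tendsto _).comp hlim
  have hp2 : Tendsto (fun n => (p n).2) atTop (𝓝 (T ⟨x, hx⟩)) :=
    (continuous_snd.tendsto _).comp hlim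
  choose t t' h1 h2 h3 using fun n => h (p n).1 (hp n).2
  have ht : ∀ n, t n = (p n).2 := fun n => T.mem_graph_snd_inj (h1 n) (hp n).1 rfl
  -- the values `T a xₙ` form a Cauchy sequence, as the commutator is bounded
  have hK : ∀ n m, ‖t' n - t' m‖ ≤ (|C| + ‖A‖) * ‖p n - p m‖ := by
    intro n m
    obtain ⟨s, s', b1, b2, b3⟩ := h _ (V.sub_mem (hp n).2 (hp m).2)
    have e1 : s = (p n).2 - (p m).2 :=
      T.mem_graph_snd_inj b1 (T.graph.sub_mem (hp n).1 (hp m).1) rfl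
    have e2 : s' = t' n - t' m := by
      refine T.mem_graph_snd_inj b2 (T.graph.sub_mem (h2 n) (h2 m)) ?_
      exact map_sub a _ _
    have e3 : t' n - t' m = (s' - a s) + a s := by rw [e2]; abel
    rw [e3]
    refine (norm_add_le _ _).trans ?_
    have c1 : ‖(p n).1 - (p m).1‖ ≤ ‖p n - p m‖ := norm_fst_le (p n - p m)
    have c2 : ‖(p n).2 - (p m).2‖ ≤ ‖p n - p m‖ := norm_snd_le (p n - p m)
    have c3 := hA s
    rw [e1] at c3
    have c4 : C * ‖(p n).1 - (p m).1‖ ≤ |C| * ‖p n - p m‖ :=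
      (mul_le_mul_of_nonneg_right (le_abs_self C) (norm_nonneg _)).trans
        (mul_le_mul_of_nonneg_left c1 (abs_nonneg C))
    have c5 := mul_le_mul_of_nonneg_left c2 (norm_nonneg A)
    rw [e1] at b3 ⊢
    change ‖s' - a ((p n).2 - (p m).2)‖ ≤ C * ‖(p n).1 - (p m).1‖ at b3
    linarith
  have hcau : CauchySeq t' := by
    have hc := hlim.cauchySeq
    rw [Metric.cauchySeq_iff] at hc ⊢
    intro ε hε
    have hpos : 0 < |C| + ‖A‖ + 1 := by positivity
    obtain ⟨N, hN⟩ := hc (ε / (|C| + ‖A‖ + 1)) (by positivity)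
    refine ⟨N, fun m hm n hn => ?_⟩
    have h4 := hN m hm n hn
    rw [dist_eq_norm] at h4 ⊢
    rw [lt_div_iff₀ hpos] at h4
    have := hK m n
    linarith [norm_nonneg (p m - p n)]
  obtain ⟨y, hy⟩ := cauchySeq_tendsto_of_complete hcau
  refine ⟨T ⟨x, hx⟩, y, T.mem_graph ⟨x, hx⟩, ?_, ?_⟩
  · exact hT.mem_of_tendsto (((ha.tendsto _).comp hp1).prodMk_nhds hy) (Eventually.of_forall h2)
  · refine le_of_tendsto_of_tendsto (hy.sub ((ha.tendsto _).comp hp2)).norm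
      (hp1.norm.const_mul C) (Eventually.of_forall fun n => ?_)
    have := h3 n
    rwa [ht] at this

/-- Bounded commutators with `S` and `T` give bounded commutators with `αS + βT`. -/
theorem HasBoundedCommutatorOn.of_combination {S T P : E →ₗ.[ℂ] E} {a : E →ₗ[ℂ] E}
    {V : Submodule ℂ E} {α β : ℂ} (hP : relLin S.graph T.graph α β ≤ P.graph)
    (hS : HasBoundedCommutatorOn S a V) (hT : HasBoundedCommutatorOn T a V) :
    HasBoundedCommutatorOn P a V := by
  rw [hasBoundedCommutatorOn_iff] at hS hT ⊢
  obtain ⟨C, hS⟩ := hS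
  obtain ⟨C', hT⟩ := hT
  refine ⟨‖α‖ * C + ‖β‖ * C', fun x hx => ?_⟩
  obtain ⟨s, s', h1, h2, h3⟩ := hS x hx
  obtain ⟨t, t', h4, h5, h6⟩ := hT x hx
  refine ⟨_, _, hP ⟨s, t, h1, h4, rfl⟩, hP ⟨s', t', h2, h5, rfl⟩, ?_⟩
  have e : α • s' + β • t' - a (α • s + β • t) = α • (s' - a s) + β • (t' - a t) := by
    rw [map_add, map_smul, map_smul]
    module
  rw [e]
  refine (norm_add_le _ _).trans ?_
  rw [norm_smul, norm_smul]
  have := mul_le_mul_of_nonneg_left h3 (norm_nonneg α)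
  have := mul_le_mul_of_nonneg_left h6 (norm_nonneg β)
  linarith

theorem hasBoundedCommutatorOn_offDiag_iff {X Y : E →ₗ.[ℂ] E} {a : E →ₗ[ℂ] E}
    {V : Submodule ℂ E} : HasBoundedCommutatorOn (offDiag B X Y) (diag B a a) (sumSub V) ↔
      HasBoundedCommutatorOn X a V ∧ HasBoundedCommutatorOn Y a V := by
  simp only [hasBoundedCommutatorOn_iff, offDiag_graph]
  constructor
  · rintro ⟨C, h⟩
    constructor
    · refine ⟨|C|, fun x hx => ?_⟩
      obtain ⟨q, q', ⟨h1, -⟩, ⟨h2, -⟩, h3⟩ := h (pairL B (0, x)) ⟨V.zero_mem, hx⟩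
      refine ⟨_, _, h1, h2, (norm_fst_le_sum (B := B) (q' - diag B a a q)).trans (h3.trans ?_)⟩
      have := norm_pair_le (B := B) 0 x
      rw [norm_zero, zero_add] at this
      exact (mul_le_mul_of_nonneg_right (le_abs_self C) (norm_nonneg _)).trans
        (mul_le_mul_of_nonneg_left this (abs_nonneg C))
    · refine ⟨|C|, fun x hx => ?_⟩
      obtain ⟨q, q', ⟨-, h1⟩, ⟨-, h2⟩, h3⟩ := h (pairL B (x, 0)) ⟨hx, V.zero_mem⟩
      refine ⟨_, _, h1, h2, (norm_snd_le_sum (B := B) (q' - diag B a a q)).trans (h3.trans ?_)⟩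
      have := norm_pair_le (B := B) x 0
      rw [norm_zero, add_zero] at this
      exact (mul_le_mul_of_nonneg_right (le_abs_self C) (norm_nonneg _)).trans
        (mul_le_mul_of_nonneg_left this (abs_nonneg C))
  · rintro ⟨⟨C, hX⟩, ⟨C', hY⟩⟩
    refine ⟨|C| + |C'|, fun p hp => ?_⟩
    obtain ⟨s, s', h1, h2, h3⟩ := hX p.2 hp.2
    obtain ⟨t, t', h4, h5, h6⟩ := hY p.1 hp.1
    refine ⟨pairL B (s, t), pairL B (s', t'), ⟨h1, h4⟩, ⟨h2, h5⟩, ?_⟩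
    refine (norm_pair_le (B := B) (s' - a s) (t' - a t)).trans ?_
    have c1 := (mul_le_mul_of_nonneg_right (le_abs_self C) (norm_nonneg p.2)).trans
      (mul_le_mul_of_nonneg_left (norm_snd_le_sum p) (abs_nonneg C))
    have c2 := (mul_le_mul_of_nonneg_right (le_abs_self C') (norm_nonneg p.1)).trans
      (mul_le_mul_of_nonneg_left (norm_fst_le_sum p) (abs_nonneg C'))
    linarith

end CoresCommutators

/-! ### The doubled bimodule -/

section DoubledBimodule

variable {A B E : Type*} [NonUnitalCStarAlgebra A]
  [NonUnitalCStarAlgebra B] [PartialOrder B] [StarOrderedRing B]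
  [NormedAddCommGroup E] [NormedSpace ℂ E] [SMul Bᵐᵒᵖ E] [CStarModule Bᵐᵒᵖ E]

theorem isCountablyGenerated_sum (h : IsCountablyGenerated B E) :
    IsCountablyGenerated B (Sum₂ B E) := by
  obtain ⟨s, hs, hd⟩ := h
  let i₁ : E →L[ℂ] Sum₂ B E := (pairL B).comp ((ContinuousLinearMap.id ℂ E).prod 0)
  let i₂ : E →L[ℂ] Sum₂ B E :=
    (pairL B).comp ((0 : E →L[ℂ] E).prod (ContinuousLinearMap.id ℂ E))
  have z : ∀ c : Bᵐᵒᵖ, c • (0 : E) = 0 := by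
    intro c
    refine eq_of_inner_left_eq (B := B) fun x => ?_
    rw [CStarModule.inner_op_smul_right]
    simp
  refine ⟨i₁ '' s ∪ i₂ '' s, (hs.image _).union (hs.image _), ?_⟩
  set M := Submodule.span ℂ {y : Sum₂ B E | ∃ x ∈ i₁ '' s ∪ i₂ '' s, ∃ b : Bᵐᵒᵖ, y = b • x}
  have h1 : ∀ x, i₁ x ∈ closure (M : Set (Sum₂ B E)) := fun x => by
    refine map_mem_closure i₁.continuous (hd x) fun y hy => ?_
    refine (Submodule.span_le (p := M.comap (i₁ : E →ₗ[ℂ] Sum₂ B E))).2 ?_ hy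
    rintro _ ⟨x, hx, b, rfl⟩
    exact Submodule.subset_span ⟨i₁ x, Or.inl ⟨x, hx, rfl⟩, b, sum_ext rfl (z b).symm⟩
  have h2 : ∀ x, i₂ x ∈ closure (M : Set (Sum₂ B E)) := fun x => by
    refine map_mem_closure i₂.continuous (hd x) fun y hy => ?_
    refine (Submodule.span_le (p := M.comap (i₂ : E →ₗ[ℂ] Sum₂ B E))).2 ?_ hy
    rintro _ ⟨x, hx, b, rfl⟩
    exact Submodule.subset_span ⟨i₂ x, Or.inr ⟨x, hx, rfl⟩, b, sum_ext (z b).symm rfl⟩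
  intro p
  have e : p = i₁ p.1 + i₂ p.2 := sum_ext (add_zero p.1).symm (zero_add p.2).symm
  rw [e]
  exact M.topologicalClosure.add_mem (h1 _) (h2 _)

theorem IsBimoduleData.sum {π : Rep A B E} {𝒜 : NonUnitalStarSubalgebra ℂ A}
    (h : IsBimoduleData π 𝒜) : IsBimoduleData π.sum 𝒜 :=
  ⟨isCountablyGenerated_sum h.countablyGenerated, h.separable, h.dense⟩

theorem isGrading_sumGrading : IsGrading B (sumGrading B E) where
  involutive x := sum_ext rfl (neg_neg x.2)
  map_smul b x := by
    refine sum_ext rfl ?_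
    change -(b • x.2) = b • -x.2
    refine eq_of_inner_left_eq (B := B) fun y => ?_
    simp [CStarModule.inner_op_smul_right, CStarModule.inner_neg_right]
  inner_map x y := by
    change inner Bᵐᵒᵖ x.1 y.1 + inner Bᵐᵒᵖ (-x.2) (-y.2) = inner Bᵐᵒᵖ x.1 y.1 + inner Bᵐᵒᵖ x.2 y.2
    rw [CStarModule.inner_neg_left, CStarModule.inner_neg_right, neg_neg]

theorem sumGrading_even (π : Rep A B E) (a : A) (x : Sum₂ B E) :
    sumGrading B E (π.sum.hom a x) = π.sum.hom a (sumGrading B E x) :=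
  sum_ext rfl (map_neg (π.hom a) x.2).symm

theorem isOdd_offDiag (X Y : E →ₗ.[ℂ] E) : IsOdd (sumGrading B E) (offDiag B X Y) := by
  intro p
  have h := (offDiag B X Y).mem_graph p
  rw [offDiag_graph] at h
  have h1 : (sumGrading B E p, -sumGrading B E (offDiag B X Y p)) ∈ (offDiag B X Y).graph := by
    rw [offDiag_graph]
    refine ⟨X.graph.neg_mem h.1, ?_⟩
    have := h.2
    rw [← neg_neg (offDiag B X Y p).2] at this
    exact this
  exact ⟨LinearPMap.mem_domain_of_mem_graph h1, apply_eq_of_mem_graph h1 _⟩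

theorem Rep.continuous [CompleteSpace E] (π : Rep A B E) (a : A) : Continuous (π.hom a) := by
  have h : IsAdjointable B (π.hom a) := ⟨π.hom (star a), π.hom_star a⟩
  obtain ⟨K, hK⟩ := h.exists_continuous
  have : (π.hom a : E → E) = K := funext fun x => (hK x).symm
  rw [this]
  exact K.continuous

theorem Rep.sum_hom (π : Rep A B E) (a : A) : π.sum.hom a = diag B (π.hom a) (π.hom a) := rfl

end DoubledBimodule

/-! ### Real parts, imaginary parts and Wick rotations -/

section Parts

variable {B : Type*} {E : Type*} [NonUnitalCStarAlgebra B] [PartialOrder B] [StarOrderedRing B]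
  [NormedAddCommGroup E] [NormedSpace ℂ E] [SMul Bᵐᵒᵖ E] [CStarModule Bᵐᵒᵖ E]

local notation "⟪" x "," y "⟫" => inner Bᵐᵒᵖ x y

/-- The combinations `αD + βD*` and `β̄D + ᾱD*` are formally adjoint to each other. -/
theorem relLin_le_relAdj (G : Submodule ℂ (E × E)) (α β : ℂ) :
    relLin G (relAdj B G) α β ≤ relAdj B (relLin G (relAdj B G) (star β) (star α)) := by
  rintro ⟨y, _⟩ ⟨s, t, hs, ht, rfl⟩ ⟨x, _⟩ ⟨s', t', hs', ht', rfl⟩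
  have h1 := ht _ hs'
  have h2 := congrArg star (ht' _ hs)
  simp only [CStarModule.star_inner] at h1 h2
  simp only [CStarModule.inner_add_left, CStarModule.inner_add_right,
    CStarModule.inner_smul_left_complex, CStarModule.inner_smul_right_complex, h1, h2]
  module

theorem relAdj_symm_closure {G : Submodule ℂ (E × E)} (h : G ≤ relAdj B G) :
    G.topologicalClosure ≤ relAdj B G.topologicalClosure := by
  rw [relAdj_topologicalClosure]
  exact G.topologicalClosure_minimal h (isClosed_relAdj G)

variable {D : E →ₗ.[ℂ] E}

theorem graph_smul_add (hD : Dense (D.domain : Set E)) (k : ℂ) :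
    (k • (D + adj B D)).graph = relLin D.graph (relAdj B D.graph) k k := by
  ext p
  rw [graph_smul]
  constructor
  · rintro ⟨t, ht, hp⟩
    obtain ⟨d, d', h1, h2, h3⟩ := (graph_add _ _).1 ht
    rw [adj_graph hD] at h2
    refine ⟨d, d', h1, h2, ?_⟩
    rw [hp, ← smul_add]
    exact congrArg _ h3
  · rintro ⟨d, d', h1, h2, hp⟩
    rw [← adj_graph hD] at h2
    exact ⟨d + d', (graph_add _ _).2 ⟨d, d', h1, h2, rfl⟩, by rw [hp, smul_add]⟩

theorem graph_smul_sub (hD : Dense (D.domain : Set E)) (k : ℂ) :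
    (k • (D - adj B D)).graph = relLin D.graph (relAdj B D.graph) k (-k) := by
  ext p
  rw [graph_smul]
  constructor
  · rintro ⟨t, ht, hp⟩
    obtain ⟨d, d', h1, h2, h3⟩ := (graph_sub _ _).1 ht
    rw [adj_graph hD] at h2
    refine ⟨d, d', h1, h2, ?_⟩
    rw [hp, neg_smul, ← sub_eq_add_neg, ← smul_sub]
    exact congrArg _ h3
  · rintro ⟨d, d', h1, h2, hp⟩
    rw [← adj_graph hD] at h2
    exact ⟨d - d', (graph_sub _ _).2 ⟨d, d', h1, h2, rfl⟩, by rw [hp]; module⟩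

theorem graph_closure_of_eq {T : E →ₗ.[ℂ] E} {G : Submodule ℂ (E × E)} (hT : T.graph = G)
    (hd : Dense (relDom G : Set E)) (hs : G ≤ relAdj B G) :
    T.closure.graph = G.topologicalClosure := by
  rw [graph_closure_of_symm (B := B) (T := T) (by rwa [← relDom_graph, hT]) (by rwa [hT]), hT]

theorem star_half : star (1 / 2 : ℂ) = 1 / 2 := by simp

theorem star_neg_I_half : star (-(Complex.I / 2) : ℂ) = -(-(Complex.I / 2)) := by
  simp [neg_div]

theorem rePart_graph (hD : Dense (D.domain : Set E))
    (hW : Dense ((relDom D.graph ⊓ relDom (relAdj B D.graph) : Submodule ℂ E) : Set E)) :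
    (rePart B D).graph =
      (relLin D.graph (relAdj B D.graph) (1 / 2) (1 / 2)).topologicalClosure := by
  refine graph_closure_of_eq (B := B) (graph_smul_add hD _) (by rwa [relDom_relLin]) ?_
  have := relLin_le_relAdj (B := B) D.graph (1 / 2) (1 / 2)
  rwa [star_half] at this

theorem imPart_graph (hD : Dense (D.domain : Set E))
    (hW : Dense ((relDom D.graph ⊓ relDom (relAdj B D.graph) : Submodule ℂ E) : Set E)) :
    (imPart B D).graph =
      (relLin D.graph (relAdj B D.graph) (-(Complex.I / 2)) (Complex.I / 2)).topologicalClosure := by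
  have e := graph_smul_sub hD (B := B) (-(Complex.I / 2))
  rw [neg_neg] at e
  refine graph_closure_of_eq (B := B) e (by rwa [relDom_relLin]) ?_
  have := relLin_le_relAdj (B := B) D.graph (-(Complex.I / 2)) (Complex.I / 2)
  rwa [star_neg_I_half, neg_neg, show star (Complex.I / 2) = -(Complex.I / 2) by simp [neg_div]]
    at this

theorem graph_add_eq (P Q : E →ₗ.[ℂ] E) : (P + Q).graph = relLin P.graph Q.graph 1 1 := by
  ext p
  rw [graph_add, mem_relLin]
  simp only [one_smul]

theorem graph_sub_eq (P Q : E →ₗ.[ℂ] E) : (P - Q).graph = relLin P.graph Q.graph 1 (-1) := by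
  ext p
  rw [graph_sub, mem_relLin]
  simp only [one_smul, neg_smul, ← sub_eq_add_neg]

theorem re_mem (hD : Dense (D.domain : Set E))
    (hW : Dense ((relDom D.graph ⊓ relDom (relAdj B D.graph) : Submodule ℂ E) : Set E))
    {x d d' : E} (h : (x, d) ∈ D.graph) (h' : (x, d') ∈ relAdj B D.graph) :
    (x, (1 / 2 : ℂ) • d + (1 / 2 : ℂ) • d') ∈ (rePart B D).graph := by
  rw [rePart_graph hD hW]
  exact Submodule.le_topologicalClosure _ ⟨d, d', h, h', rfl⟩

theorem im_mem (hD : Dense (D.domain : Set E))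
    (hW : Dense ((relDom D.graph ⊓ relDom (relAdj B D.graph) : Submodule ℂ E) : Set E))
    {x d d' : E} (h : (x, d) ∈ D.graph) (h' : (x, d') ∈ relAdj B D.graph) :
    (x, (-(Complex.I / 2)) • d + (Complex.I / 2) • d') ∈ (imPart B D).graph := by
  rw [imPart_graph hD hW]
  exact Submodule.le_topologicalClosure _ ⟨d, d', h, h', rfl⟩

theorem re_symm (hD : Dense (D.domain : Set E))
    (hW : Dense ((relDom D.graph ⊓ relDom (relAdj B D.graph) : Submodule ℂ E) : Set E)) :
    (rePart B D).graph ≤ relAdj B (rePart B D).graph := by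
  rw [rePart_graph hD hW]
  refine relAdj_symm_closure ?_
  have := relLin_le_relAdj (B := B) D.graph (1 / 2) (1 / 2)
  rwa [star_half] at this

theorem im_symm (hD : Dense (D.domain : Set E))
    (hW : Dense ((relDom D.graph ⊓ relDom (relAdj B D.graph) : Submodule ℂ E) : Set E)) :
    (imPart B D).graph ≤ relAdj B (imPart B D).graph := by
  rw [imPart_graph hD hW]
  refine relAdj_symm_closure ?_
  have := relLin_le_relAdj (B := B) D.graph (-(Complex.I / 2)) (Complex.I / 2)
  rwa [star_neg_I_half, neg_neg, show star (Complex.I / 2) = -(Complex.I / 2) by simp [neg_div]]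
    at this

theorem relLin_re_im_symm (hD : Dense (D.domain : Set E))
    (hW : Dense ((relDom D.graph ⊓ relDom (relAdj B D.graph) : Submodule ℂ E) : Set E))
    {c : ℂ} (hc : star c = c) : relLin (rePart B D).graph (imPart B D).graph 1 c ≤
      relAdj B (relLin (rePart B D).graph (imPart B D).graph 1 c) := by
  have := relComb_le_relAdj (re_symm hD hW) (im_symm hD hW) c
  rwa [hc, relComb_eq] at this

theorem dense_relDom_re_im (hD : Dense (D.domain : Set E))
    (hW : Dense ((relDom D.graph ⊓ relDom (relAdj B D.graph) : Submodule ℂ E) : Set E)) (c : ℂ) :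
    Dense (relDom (relLin (rePart B D).graph (imPart B D).graph 1 c) : Set E) := by
  rw [relDom_relLin]
  refine hW.mono ?_
  rintro x ⟨h1, h2⟩
  obtain ⟨d, hd⟩ := mem_relDom.1 h1
  obtain ⟨d', hd'⟩ := mem_relDom.1 h2
  exact ⟨mem_relDom.2 ⟨_, re_mem hD hW hd hd'⟩, mem_relDom.2 ⟨_, im_mem hD hW hd hd'⟩⟩

theorem wickPlus_graph (hD : Dense (D.domain : Set E))
    (hW : Dense ((relDom D.graph ⊓ relDom (relAdj B D.graph) : Submodule ℂ E) : Set E)) :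
    (wickPlus B D).graph =
      (relLin (rePart B D).graph (imPart B D).graph 1 1).topologicalClosure :=
  graph_closure_of_eq (graph_add_eq _ _) (dense_relDom_re_im hD hW _)
    (relLin_re_im_symm hD hW (by simp))

theorem wickMinus_graph (hD : Dense (D.domain : Set E))
    (hW : Dense ((relDom D.graph ⊓ relDom (relAdj B D.graph) : Submodule ℂ E) : Set E)) :
    (wickMinus B D).graph =
      (relLin (rePart B D).graph (imPart B D).graph 1 (-1)).topologicalClosure :=
  graph_closure_of_eq (graph_sub_eq _ _) (dense_relDom_re_im hD hW _)
    (relLin_re_im_symm hD hW (by simp))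

theorem hasCore_of_graph_eq {P : E →ₗ.[ℂ] E} {G : Submodule ℂ (E × E)}
    (h : P.graph = G.topologicalClosure) {V : Submodule ℂ E} (hV : relDom G = V) : P.HasCore V := by
  have hcl : P.IsClosed := by
    rw [LinearPMap.IsClosed, h]
    exact Submodule.isClosed_topologicalClosure _
  rw [hasCore_iff hcl, ← hV, ← relDom_graph, h]
  refine ⟨fun x hx => ?_, le_antisymm (Submodule.topologicalClosure_minimal _ inf_le_left
    (Submodule.isClosed_topologicalClosure _)) (Submodule.topologicalClosure_mono fun p hp => ?_)⟩
  · obtain ⟨y, hy⟩ := mem_relDom.1 hx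
    exact mem_relDom.2 ⟨y, G.le_topologicalClosure hy⟩
  · exact mem_relRestrict.2 ⟨G.le_topologicalClosure hp, mem_relDom.2 ⟨_, hp⟩⟩

theorem hasCore_rePart (hD : Dense (D.domain : Set E))
    (hW : Dense ((relDom D.graph ⊓ relDom (relAdj B D.graph) : Submodule ℂ E) : Set E)) :
    (rePart B D).HasCore (D.domain ⊓ (adj B D).domain) := by
  refine hasCore_of_graph_eq (rePart_graph hD hW) ?_
  rw [relDom_relLin, ← adj_graph hD, relDom_graph, relDom_graph]

theorem hasCore_imPart (hD : Dense (D.domain : Set E))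
    (hW : Dense ((relDom D.graph ⊓ relDom (relAdj B D.graph) : Submodule ℂ E) : Set E)) :
    (imPart B D).HasCore (D.domain ⊓ (adj B D).domain) := by
  refine hasCore_of_graph_eq (imPart_graph hD hW) ?_
  rw [relDom_relLin, ← adj_graph hD, relDom_graph, relDom_graph]

/-- The sum of `[[0, D*], [D, 0]]` and `[[0, D], [D*, 0]]` is `2 [[0, Re D], [Re D, 0]]`. -/
theorem pair_add_graph (hD : Dense (D.domain : Set E))
    (hW : Dense ((relDom D.graph ⊓ relDom (relAdj B D.graph) : Submodule ℂ E) : Set E)) :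
    (offDiag B (adj B D) D + offDiag B D (adj B D)).closure.graph =
      relOff (relSMul ((2 : ℝ) : ℂ) (rePart B D).graph)
        (relSMul ((2 : ℝ) : ℂ) (rePart B D).graph) := by
  have e : (offDiag B (adj B D) D + offDiag B D (adj B D)).graph =
      relOff (relLin D.graph (relAdj B D.graph) 1 1) (relLin D.graph (relAdj B D.graph) 1 1) := by
    rw [graph_add_eq, offDiag_graph, offDiag_graph, relLin_relOff, adj_graph hD, relLin_comm 1 1]
  have h1 := relLin_le_relAdj (B := B) D.graph 1 1
  rw [star_one] at h1
  rw [graph_closure_of_eq (B := B) e, relOff_topologicalClosure, rePart_graph hD hW,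
    ← relSMul_topologicalClosure (by norm_num), relSMul_relLin]
  · norm_num
  · refine dense_relDom_relOff ?_ ?_ <;> rwa [relDom_relLin]
  · rw [relAdj_relOff]
    exact fun p hp => ⟨h1 hp.1, h1 hp.2⟩

/-- The difference of `[[0, D*], [D, 0]]` and `[[0, D], [D*, 0]]` is
`2 [[0, -i Im D], [i Im D, 0]]`. -/
theorem pair_sub_graph (hD : Dense (D.domain : Set E))
    (hW : Dense ((relDom D.graph ⊓ relDom (relAdj B D.graph) : Submodule ℂ E) : Set E)) :
    (offDiag B (adj B D) D - offDiag B D (adj B D)).closure.graph =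
      relOff (relSMul (-(Complex.I * (2 : ℝ))) (imPart B D).graph)
        (relSMul (Complex.I * (2 : ℝ)) (imPart B D).graph) := by
  have e : (offDiag B (adj B D) D - offDiag B D (adj B D)).graph =
      relOff (relLin D.graph (relAdj B D.graph) (-1) 1)
        (relLin D.graph (relAdj B D.graph) 1 (-1)) := by
    rw [graph_sub_eq, offDiag_graph, offDiag_graph, relLin_relOff, adj_graph hD, relLin_comm 1 (-1)]
  have h1 := relLin_le_relAdj (B := B) D.graph 1 (-1)
  have h2 := relLin_le_relAdj (B := B) D.graph (-1) 1
  rw [star_one, star_neg, star_one] at h1 h2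
  have hI : Complex.I * ((2 : ℝ) : ℂ) ≠ 0 := by simp
  rw [graph_closure_of_eq (B := B) e, relOff_topologicalClosure, imPart_graph hD hW,
    ← relSMul_topologicalClosure hI, ← relSMul_topologicalClosure (neg_ne_zero.2 hI),
    relSMul_relLin, relSMul_relLin]
  · have e1 : Complex.I * ((2 : ℝ) : ℂ) * -(Complex.I / 2) = 1 := by
      push_cast
      linear_combination -Complex.I_mul_I
    have e2 : Complex.I * ((2 : ℝ) : ℂ) * (Complex.I / 2) = -1 := by
      push_cast
      linear_combination Complex.I_mul_I
    rw [neg_mul, neg_mul, e1, e2, neg_neg]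
  · refine dense_relDom_relOff ?_ ?_ <;> rwa [relDom_relLin]
  · rw [relAdj_relOff]
    exact fun p hp => ⟨h2 hp.1, h1 hp.2⟩

/-! ### Consequences of the Cartesian decomposition -/

variable {S T : Submodule ℂ (E × E)}

theorem IsCartesian.relDom_eq (h : IsCartesian B D S T) : relDom D.graph = relDom S ⊓ relDom T := by
  rw [h.graph_eq, relComb_eq, relDom_relLin]

theorem IsCartesian.relDom_adj_eq (h : IsCartesian B D S T) :
    relDom (relAdj B D.graph) = relDom S ⊓ relDom T := by
  rw [h.adj_eq, relComb_eq, relDom_relLin]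

theorem IsCartesian.exists_adj (h : IsCartesian B D S T) {x d : E} (hx : (x, d) ∈ D.graph) :
    ∃ d', (x, d') ∈ relAdj B D.graph := by
  rw [← mem_relDom, h.relDom_adj_eq, ← h.relDom_eq]
  exact mem_relDom.2 ⟨_, hx⟩

theorem IsCartesian.exists_of_adj (h : IsCartesian B D S T) {x d : E}
    (hx : (x, d) ∈ relAdj B D.graph) : ∃ d', (x, d') ∈ D.graph := by
  rw [← mem_relDom, h.relDom_eq, ← h.relDom_adj_eq]
  exact mem_relDom.2 ⟨_, hx⟩

theorem IsCartesian.eq_add (h : IsCartesian B D S T) {x d d' : E} (hx : (x, d) ∈ D.graph)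
    (hx' : (x, d') ∈ relAdj B D.graph) : ∃ s t, (x, s) ∈ S ∧ (x, t) ∈ T ∧
      d = s + Complex.I • t ∧ d' = s - Complex.I • t := by
  rw [h.graph_eq] at hx
  rw [h.adj_eq] at hx'
  obtain ⟨s, t, hs, ht, e⟩ := hx
  obtain ⟨s', t', hs', ht', e'⟩ := hx'
  obtain rfl := h.left.eq_of_mem hs hs'
  obtain rfl := h.right.eq_of_mem ht ht'
  exact ⟨s, t, hs, ht, e, by rw [sub_eq_add_neg, ← neg_smul]; exact e'⟩

variable [CompleteSpace E]

theorem IsCartesian.exists_graph_bound (h : IsCartesian B D S T) : ∃ M : ℝ, 0 ≤ M ∧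
    ∀ x d d', (x, d) ∈ D.graph → (x, d') ∈ relAdj B D.graph →
      ‖d'‖ ≤ M * (‖x‖ + ‖d‖) ∧ ‖d‖ ≤ M * (‖x‖ + ‖d'‖) := by
  obtain ⟨M, hM, hb⟩ := h.commutator.exists_norm_bound h.left h.right (by norm_num)
  refine ⟨2 * M, by positivity, fun x d d' hx hx' => ?_⟩
  obtain ⟨s, t, hs, ht, rfl, rfl⟩ := h.eq_add hx hx'
  have h1 := hb Complex.I (by simp) (by simp) x s t hs ht
  have h2 := hb (-Complex.I) (by simp) (by simp) x s t hs ht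
  rw [neg_smul, ← sub_eq_add_neg] at h2
  have e : ‖Complex.I • t‖ = ‖t‖ := by rw [norm_smul, Complex.norm_I, one_mul]
  have h3 := norm_sub_le s (Complex.I • t)
  have h4 := norm_add_le s (Complex.I • t)
  rw [e] at h3 h4
  constructor
  · linarith [h1.1, h1.2]
  · linarith [h2.1, h2.2]

/-- The domains of the Wick rotations intersect in `Dom S ∩ Dom T`. -/
theorem IsCartesian.mem_of_wick (h : IsCartesian B D S T) {x p m : E}
    (hp : (x, p) ∈ (relLin S T 1 1).topologicalClosure)
    (hm : (x, m) ∈ (relLin S T 1 (-1)).topologicalClosure) :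
    (x, (1 / 2 : ℂ) • p + (1 / 2 : ℂ) • m) ∈ S ∧ (x, (1 / 2 : ℂ) • p - (1 / 2 : ℂ) • m) ∈ T := by
  have h1 := (h.isSelfAdjRegular_closure (τ := 1) (by simp)).relAdj_eq
  have h2 := (h.isSelfAdjRegular_closure (τ := -1) (by simp)).relAdj_eq
  simp only [relComb_eq, Complex.ofReal_one, Complex.ofReal_neg] at h1 h2
  rw [← h1, relAdj_topologicalClosure] at hp
  rw [← h2, relAdj_topologicalClosure] at hm
  -- By symmetry of the Wick rotations, `x` is in the domain of the adjoints of the restrictions of `S`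
  -- and `T` to `Dom S ∩ Dom T`. These adjoints are `S` and `T`, as the intersection is a core.
  have key : ∀ y s t, (y, s) ∈ S → (y, t) ∈ T →
      ⟪x, s⟫ = ⟪(1 / 2 : ℂ) • p + (1 / 2 : ℂ) • m, y⟫ ∧
      ⟪x, t⟫ = ⟪(1 / 2 : ℂ) • p - (1 / 2 : ℂ) • m, y⟫ := by
    intro y s t hs ht
    have a1 := hp (y, (1 : ℂ) • s + (1 : ℂ) • t) ⟨s, t, hs, ht, rfl⟩
    have a2 := hm (y, (1 : ℂ) • s + (-1 : ℂ) • t) ⟨s, t, hs, ht, rfl⟩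
    simp only [one_smul, neg_smul, CStarModule.inner_add_right, CStarModule.inner_neg_right]
      at a1 a2
    simp only [CStarModule.inner_add_left, CStarModule.inner_sub_left,
      CStarModule.inner_smul_left_complex, star_half, ← a1, ← a2]
    constructor <;> module
  constructor
  · rw [← h.left.relAdj_eq, ← h.commutator.core_left h.left h.right (by norm_num),
      relAdj_topologicalClosure]
    rintro ⟨y, s⟩ ⟨hs, hy⟩
    obtain ⟨t, ht⟩ := mem_relDom.1 hy
    exact (key y s t hs ht).1
  · rw [← h.right.relAdj_eq, ← h.commutator.core_right h.left h.right (by norm_num),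
      relAdj_topologicalClosure]
    rintro ⟨y, t⟩ ⟨ht, hy⟩
    obtain ⟨s, hs⟩ := mem_relDom.1 hy
    exact (key y s t hs ht).2

/-- An operator `D` has a Cartesian decomposition if `Dom D ∩ Dom D*` is a core for `D` and `D*`, and
the real and imaginary parts of `D` are almost commuting. -/
theorem isCartesian_of_core (hD : IsRegular B D)
    (hc : D.HasCore (D.domain ⊓ (adj B D).domain))
    (hc' : (adj B D).HasCore (D.domain ⊓ (adj B D).domain))
    (hR : IsSelfAdjRegular B (rePart B D).graph) (hI : IsSelfAdjRegular B (imPart B D).graph)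
    (h : HasTwistedCommutator B 1 (rePart B D).graph (imPart B D).graph) :
    IsCartesian B D (rePart B D).graph (imPart B D).graph := by
  have hd := hD.dense_domain
  have hW : Dense ((relDom D.graph ⊓ relDom (relAdj B D.graph) : Submodule ℂ E) : Set E) := by
    rw [← adj_graph hd, relDom_graph, relDom_graph]
    exact dense_of_hasCore hD.closed hd hc
  have hmem : ∀ x ∈ D.domain ⊓ (adj B D).domain, ∀ {d d'}, (x, d) ∈ D.graph →
      (x, d') ∈ relAdj B D.graph → (x, d) ∈ relComb (rePart B D).graph (imPart B D).graph
        Complex.I ∧ (x, d') ∈ relComb (rePart B D).graph (imPart B D).graph (-Complex.I) := by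
    intro x _ d d' h h'
    refine ⟨⟨_, _, re_mem hd hW h h', im_mem hd hW h h', ?_⟩,
      ⟨_, _, re_mem hd hW h h', im_mem hd hW h h', ?_⟩⟩
    · dsimp only
      linear_combination (norm := module) (1 / 2 : ℂ) • Complex.I_mul_I • (d - d')
    · dsimp only
      linear_combination (norm := module) (-1 / 2 : ℂ) • Complex.I_mul_I • (d - d')
  refine isCartesian_of_le hD hR hI h ?_ ?_
  · rw [← ((hasCore_iff hD.closed).1 hc).2]
    refine Submodule.topologicalClosure_minimal _ ?_
      (h.isClosed_relComb hR hI (by norm_num) (by simp) (by simp))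
    rintro ⟨x, d⟩ ⟨hx, hx'⟩
    have := (adj B D).mem_graph ⟨x, hx'.2⟩
    rw [adj_graph hd] at this
    exact (hmem x hx' hx this).1
  · have e := ((hasCore_iff hD.adj.closed).1 hc').2
    rw [adj_graph hd] at e
    rw [← e]
    refine Submodule.topologicalClosure_minimal _ ?_
      (h.isClosed_relComb hR hI (by norm_num) (by simp) (by simp))
    rintro ⟨x, d⟩ ⟨hx, hx'⟩
    exact (hmem x hx' (D.mem_graph ⟨x, hx'.1⟩) hx).2

end Parts

/-! ### Kasparov modules -/

section KasparovConditions

variable {A B E : Type*} [NonUnitalCStarAlgebra A]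
  [NonUnitalCStarAlgebra B] [PartialOrder B] [StarOrderedRing B]
  [NormedAddCommGroup E] [NormedSpace ℂ E] [SMul Bᵐᵒᵖ E] [CStarModule Bᵐᵒᵖ E] [CompleteSpace E]

local notation "⟪" x "," y "⟫" => inner Bᵐᵒᵖ x y

/-- The analytic content common to the three descriptions of an indefinite Kasparov module, apart
from the conditions on the bimodule: the Cartesian decomposition of `D` into an almost commuting
pair, bounded commutators on `Dom D = Dom D*`, and compactness. -/
structure IsCartesianKasparov (π : Rep A B E) (𝒜 : NonUnitalStarSubalgebra ℂ A)
    (D : E →ₗ.[ℂ] E) : Prop where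
  cartesian : IsCartesian B D (rePart B D).graph (imPart B D).graph
  commutator : ∀ a ∈ 𝒜, HasBoundedCommutatorOn D (π.hom a) D.domain ∧
    HasBoundedCommutatorOn (adj B D) (π.hom a) (adj B D).domain
  compact : ∀ a : A, IsCompactRel B D.graph (relAdj B D.graph) (π.hom a)

variable {π : Rep A B E} {𝒜 : NonUnitalStarSubalgebra ℂ A} {D : E →ₗ.[ℂ] E}
  {S T : Submodule ℂ (E × E)}

theorem IsOddIndefiniteKasparovModule.isCartesianKasparov
    (h : IsOddIndefiniteKasparovModule π 𝒜 D) : IsCartesianKasparov π 𝒜 D := by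
  obtain ⟨V, hV, -, -, hcomm⟩ := h.exists_core
  have hD := h.regular
  obtain ⟨h1, h2, h3⟩ := isAlmostCommuting_iff.1 h.almostCommuting
  refine ⟨isCartesian_of_core hD (hasCore_mono hD.closed hV.core hV.le inf_le_left)
    (hasCore_mono hD.adj.closed hV.core_adj hV.le inf_le_right) h1 h2 h3, fun a ha => ?_, fun a => ?_⟩
  · exact ⟨(hcomm a ha).1.of_core hD.closed (π.continuous a) hV.core,
      (hcomm a ha).2.of_core hD.adj.closed (π.continuous a) hV.core_adj⟩
  · have := (h.locallyCompact a).isCompactRel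
    rwa [adj_graph hD.dense_domain] at this

theorem IsCartesian.dense_relDom (h : IsCartesian B D S T) :
    Dense ((relDom D.graph ⊓ relDom (relAdj B D.graph) : Submodule ℂ E) : Set E) := by
  rw [h.relDom_adj_eq, ← h.relDom_eq, inf_idem, relDom_graph]
  exact h.regular.dense_domain

theorem IsCartesian.domain_eq (h : IsCartesian B D S T) :
    (adj B D).domain = D.domain := by
  rw [← relDom_graph, ← relDom_graph, adj_graph h.regular.dense_domain, h.relDom_eq,
    h.relDom_adj_eq]

/-- Functionals on `Dom D = Dom D*` are represented in the inner products
`⟪x, y⟫ + (1 + α) ⟪D x, D y⟫ + β ⟪D* x, D* y⟫`. -/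
theorem IsCartesian.exists_riesz (h : IsCartesian B D S T) {α β : ℝ}
    (hα : 0 ≤ α) (hβ : 0 ≤ β) (u v v' : E) :
    ∃ w d d', (w, d) ∈ D.graph ∧ (w, d') ∈ relAdj B D.graph ∧
      ∀ x t t', (x, t) ∈ D.graph → (x, t') ∈ relAdj B D.graph → ⟪u, x⟫ + ⟪v, t⟫ + ⟪v', t'⟫ =
        ⟪w, x⟫ + ((1 + α : ℝ) : ℂ) • ⟪d, t⟫ + (β : ℂ) • ⟪d', t'⟫ := by
  obtain ⟨M, hM, hb⟩ := h.exists_graph_bound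
  exact h.regular.exists_riesz hM (fun x t t' hx hx' => (hb x t t' hx hx').1)
    (fun x t hx => h.exists_adj hx) hα hβ u v v'

theorem isCommonCore_self (hc : D.HasCore (D.domain ⊓ (adj B D).domain))
    (hc' : (adj B D).HasCore (D.domain ⊓ (adj B D).domain)) :
    IsCommonCore (B := B) D (D.domain ⊓ (adj B D).domain) where
  le := le_rfl
  dense x ε hε := ⟨x, x.2, by
    have : x - x = ⟨0, Submodule.zero_mem _⟩ := sub_self x
    rw [this, graphNorm_eq D.graph.zero_mem (adj B D).graph.zero_mem]
    simpa using hε⟩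
  core := hc
  core_adj := hc'

theorem IsCartesian.hasCore (h : IsCartesian B D S T) :
    D.HasCore (D.domain ⊓ (adj B D).domain) ∧
      (adj B D).HasCore (D.domain ⊓ (adj B D).domain) := by
  constructor
  · rw [h.domain_eq, inf_idem]
    exact hasCore_domain h.regular.closed
  · rw [← h.domain_eq, inf_idem]
    exact hasCore_domain h.regular.adj.closed

theorem IsCartesianKasparov.isOddIndefiniteKasparovModule (hdata : IsBimoduleData π 𝒜)
    (h : IsCartesianKasparov π 𝒜 D) : IsOddIndefiniteKasparovModule π 𝒜 D := by
  have hc := h.cartesian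
  have hD := hc.regular
  have hR := hc.left.regular_selfAdj
  have hI := hc.right.regular_selfAdj
  refine ⟨hdata, hD, hR.1, hI.1, isAlmostCommuting_iff.2 ⟨hc.left, hc.right, hc.commutator⟩,
    ⟨D.domain ⊓ (adj B D).domain, isCommonCore_self hc.hasCore.1 hc.hasCore.2,
      hR.2.isEssSelfAdjOn (hasCore_rePart hD.dense_domain hc.dense_relDom),
      hI.2.isEssSelfAdjOn (hasCore_imPart hD.dense_domain hc.dense_relDom), fun a ha => ?_⟩,
    fun a => ?_⟩
  · exact ⟨(h.commutator a ha).1.mono inf_le_left, (h.commutator a ha).2.mono inf_le_right⟩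
  · have hg := adj_graph (B := B) hD.dense_domain
    refine IsCompactRel.isCompactOnDomain (by rw [hg]; exact h.compact a) fun u v v' => ?_
    obtain ⟨w, d, d', h1, h2, h3⟩ := hc.exists_riesz le_rfl zero_le_one u v v'
    rw [hg]
    refine ⟨w, d, d', h1, h2, fun x s t hs ht => ?_⟩
    rw [h3 x s t hs ht]
    simp

/-! ### Pairs of Kasparov modules -/

/-- `[[0, X], [X*, 0]]` with `Dom X = Dom X*` is an unbounded Kasparov module. The self-adjointness of
this operator makes `⟪X x, X y⟫` occur twice in the inner product on its domain, whence the factor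
`2` in the representation of functionals. -/
theorem isKasparovModule_offDiag (hdata : IsBimoduleData π 𝒜) {X Y : E →ₗ.[ℂ] E}
    (hX : IsRegular B X) (hY : IsRegular B Y) (hXY : relAdj B X.graph = Y.graph)
    (hYX : relAdj B Y.graph = X.graph) (hdom : X.domain = Y.domain)
    (hcomm : ∀ a ∈ 𝒜, HasBoundedCommutatorOn X (π.hom a) X.domain ∧
      HasBoundedCommutatorOn Y (π.hom a) Y.domain)
    (hcomp : ∀ a, IsCompactRel B X.graph X.graph (π.hom a) ∧
      IsCompactRel B Y.graph Y.graph (π.hom a))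
    (hX' : ∀ u v : E, ∃ w d, (w, d) ∈ X.graph ∧ ∀ x t, (x, t) ∈ X.graph →
      ⟪u, x⟫ + ⟪v, t⟫ = ⟪w, x⟫ + (2 : ℂ) • ⟪d, t⟫)
    (hY' : ∀ u v : E, ∃ w d, (w, d) ∈ Y.graph ∧ ∀ x t, (x, t) ∈ Y.graph →
      ⟪u, x⟫ + ⟪v, t⟫ = ⟪w, x⟫ + (2 : ℂ) • ⟪d, t⟫) :
    IsKasparovModule (sumGrading B E) π.sum 𝒜 (offDiag B X Y) := by
  have hreg := hX.offDiag hY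
  have hadj : relAdj B (offDiag B X Y).graph = (offDiag B X Y).graph := by
    rw [offDiag_graph, relAdj_relOff, hXY, hYX]
  have hg : (adj B (offDiag B X Y)).graph = (offDiag B X Y).graph := by
    rw [adj_graph hreg.dense_domain, hadj]
  refine ⟨hdata.sum, isGrading_sumGrading, sumGrading_even π, hreg,
    isSelfAdj_iff.2 ⟨hreg.dense_domain, hadj⟩, isOdd_offDiag X Y, fun a ha => ?_, fun a => ?_⟩
  · have h1 : (offDiag B X Y).domain = sumSub X.domain := by
      rw [← relDom_graph, offDiag_graph]
      ext p
      rw [mem_relDom_relOff, relDom_graph, relDom_graph, ← hdom]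
      rfl
    rw [h1, Rep.sum_hom, hasBoundedCommutatorOn_offDiag_iff]
    exact ⟨(hcomm a ha).1, hdom ▸ (hcomm a ha).2⟩
  · refine IsCompactRel.isCompactOnDomain ?_ fun u v v' => ?_
    · rw [hg, offDiag_graph, Rep.sum_hom, isCompactRel_relOff_iff]
      exact ⟨(hcomp a).2, (hcomp a).1⟩
    · obtain ⟨w₁, d₁, h1, h2⟩ := hY' u.1 (v.2 + v'.2)
      obtain ⟨w₂, d₂, h3, h4⟩ := hX' u.2 (v.1 + v'.1)
      rw [hg, offDiag_graph]
      refine ⟨pairL B (w₁, w₂), pairL B (d₂, d₁), pairL B (d₂, d₁), ⟨h3, h1⟩, ⟨h3, h1⟩, ?_⟩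
      rintro p q q' ⟨b1, b2⟩ ⟨b1', b2'⟩
      have e1 : q'.1 = q.1 := X.mem_graph_snd_inj b1' b1 rfl
      have e2 : q'.2 = q.2 := Y.mem_graph_snd_inj b2' b2 rfl
      have e3 := h2 _ _ b2
      have e4 := h4 _ _ b1
      dsimp only at e3 e4
      simp only [CStarModule.inner_add_left] at e3 e4
      simp only [sum_inner, pairL_fst, pairL_snd, e1, e2]
      linear_combination (norm := module) e3 + e4

theorem IsCartesianKasparov.isPairOfKasparovModules (hdata : IsBimoduleData π 𝒜)
    (h : IsCartesianKasparov π 𝒜 D) : IsPairOfKasparovModules (sumGrading B E) π.sum 𝒜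
      (offDiag B (adj B D) D) (offDiag B D (adj B D)) := by
  have hc := h.cartesian
  have hD := hc.regular
  have hg := adj_graph (B := B) hD.dense_domain
  have hg1 : relAdj B D.graph = (adj B D).graph := hg.symm
  have hg2 : relAdj B (adj B D).graph = D.graph := by rw [hg, hD.relAdj_relAdj]
  have hdom := hc.domain_eq
  have hW := hc.dense_relDom
  obtain ⟨M, hM, hb⟩ := hc.exists_graph_bound
  -- the functionals on `Dom D = Dom D*` are represented by either of `D` and `D*`
  have hrD : ∀ u v : E, ∃ w d, (w, d) ∈ D.graph ∧ ∀ x t, (x, t) ∈ D.graph →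
      ⟪u, x⟫ + ⟪v, t⟫ = ⟪w, x⟫ + (2 : ℂ) • ⟪d, t⟫ := by
    intro u v
    obtain ⟨w, d, d', h1, h2, h3⟩ := hc.exists_riesz zero_le_one le_rfl u v 0
    refine ⟨w, d, h1, fun x t hx => ?_⟩
    obtain ⟨t', ht'⟩ := hc.exists_adj hx
    have := h3 x t t' hx ht'
    norm_num at this
    exact this
  have hrA : ∀ α : ℝ, 0 ≤ α → ∀ u v v' : E, ∃ w d, (w, d) ∈ relAdj B D.graph ∧
      ∀ x s t, (x, s) ∈ D.graph → (x, t) ∈ relAdj B D.graph →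
        ⟪u, x⟫ + ⟪v, t⟫ + ⟪v', s⟫ = ⟪w, x⟫ + ((1 + α : ℝ) : ℂ) • ⟪d, t⟫ := by
    intro α hα u v v'
    obtain ⟨w, d, d', h1, h2, h3⟩ := hD.adj.exists_riesz hM
      (fun x t t' hx hx' => by
        rw [hg2] at hx'
        rw [hg] at hx
        exact (hb x t' t hx' hx).2)
      (fun x t hx => by
        rw [hg2]
        rw [hg] at hx
        exact hc.exists_of_adj hx) hα le_rfl u v v'
    rw [hg2] at h3
    rw [hg] at h1 h3
    refine ⟨w, d, h1, fun x s t hs ht => ?_⟩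
    rw [h3 x t s ht hs]
    simp
  have hrD' : ∀ u v : E, ∃ w d, (w, d) ∈ (adj B D).graph ∧ ∀ x t, (x, t) ∈ (adj B D).graph →
      ⟪u, x⟫ + ⟪v, t⟫ = ⟪w, x⟫ + (2 : ℂ) • ⟪d, t⟫ := by
    intro u v
    obtain ⟨w, d, h1, h2⟩ := hrA 1 zero_le_one u v 0
    rw [hg]
    refine ⟨w, d, h1, fun x t hx => ?_⟩
    obtain ⟨s, hs⟩ := hc.exists_of_adj hx
    have := h2 x s t hs hx
    norm_num at this
    exact this
  -- The graph norms of `D` and `D*` are equivalent, and each of them defines the same functionals on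
  -- the common domain.
  have hcomp : ∀ a, IsCompactRel B D.graph D.graph (π.hom a) ∧
      IsCompactRel B (adj B D).graph (adj B D).graph (π.hom a) := by
    intro a
    rw [hg]
    constructor
    · refine (h.compact a).of_le (K := 1 + M) (by positivity) (fun x t t' hx hx' => ?_)
        fun u v v' => ?_
      · obtain ⟨s, hs⟩ := hc.exists_adj hx
        refine ⟨t, s, hx, hs, ?_⟩
        have h1 := (hb x t s hx hs).1
        have h2 : 0 ≤ (1 + M) * ‖t'‖ := by positivity
        have := norm_nonneg x
        linarith
      · obtain ⟨w, d, d', h1, h2, h3⟩ := hc.exists_riesz le_rfl le_rfl u v v'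
        refine ⟨w, d, 0, fun x t t' s s' hx hx' hs hs' => ?_⟩
        obtain rfl := D.mem_graph_snd_inj hx hs rfl
        rw [h3 x _ s' hs hs']
        simp
    · refine (h.compact a).of_le (K := 1 + M) (by positivity) (fun x t t' hx hx' => ?_)
        fun u v v' => ?_
      · obtain ⟨s, hs⟩ := hc.exists_of_adj hx
        refine ⟨s, t, hs, hx, ?_⟩
        have h1 := (hb x s t hs hx).2
        have h2 : 0 ≤ (1 + M) * ‖t'‖ := by positivity
        have := norm_nonneg x
        linarith
      · obtain ⟨w, d, h1, h2⟩ := hrA 0 le_rfl u v' v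
        refine ⟨w, d, 0, fun x t t' s s' hx hx' hs hs' => ?_⟩
        rw [← hg] at hx hs'
        obtain rfl := (adj B D).mem_graph_snd_inj hx hs' rfl
        rw [hg] at hx
        have := h2 x s t hs hx
        simp only [add_zero, Complex.ofReal_one, one_smul] at this
        rw [add_right_comm, this]
        simp
  have hR := hc.left.relOff (ω := ((2 : ℝ) : ℂ)) (by norm_num)
  have hI := hc.right.relOff (ω := -(Complex.I * (2 : ℝ))) (by simp)
  have e1 : star ((2 : ℝ) : ℂ) = ((2 : ℝ) : ℂ) := Complex.conj_ofReal 2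
  have e2 : star (-(Complex.I * (2 : ℝ))) = Complex.I * (2 : ℝ) := by simp
  rw [e1, ← pair_add_graph hD.dense_domain hW] at hR
  rw [e2, ← pair_sub_graph hD.dense_domain hW] at hI
  have hRI := hc.commutator.double (ρ := 2) two_pos
  rw [← pair_add_graph hD.dense_domain hW, ← pair_sub_graph hD.dense_domain hW] at hRI
  have hl := isKasparovModule_offDiag hdata hD.adj hD hg2 hg1 hdom
    (fun a ha => (h.commutator a ha).symm) (fun a => (hcomp a).symm) hrD' hrD
  have hr := isKasparovModule_offDiag hdata hD hD.adj hg1 hg2 hdom.symm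
    (fun a ha => h.commutator a ha) hcomp hrD hrD'
  have hd : (offDiag B (adj B D) D).domain = (offDiag B D (adj B D)).domain := by
    rw [← relDom_graph, ← relDom_graph, offDiag_graph, offDiag_graph]
    ext p
    simp only [mem_relDom_relOff, relDom_graph, hdom]
  -- The sum and the difference have the common domain of the summands, so the restriction to it in
  -- the definition of essential self-adjointness is no restriction.
  have hdr : ∀ (P Q : Sum₂ B E →ₗ.[ℂ] Sum₂ B E), Q.domain = P.domain →
      IsSelfAdj B P.closure → IsEssSelfAdjOn B P Q.domain := by
    intro P Q hPQ hP
    refine ⟨hPQ.le, ?_⟩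
    have : P.domRestrict Q.domain = P := by
      refine LinearPMap.eq_of_eq_graph ?_
      rw [graph_domRestrict, hPQ]
      exact le_antisymm inf_le_left fun p hp => ⟨hp, LinearPMap.mem_domain_of_mem_graph hp⟩
    rwa [this]
  refine ⟨hl, hr, hR.regular_selfAdj.1, hI.regular_selfAdj.1, ⟨(offDiag B (adj B D) D).domain,
    le_inf le_rfl hd.le, hasCore_domain hl.regular.closed,
    by rw [hd]; exact hasCore_domain hr.regular.closed,
    hdr _ _ ?_ hR.regular_selfAdj.2, hdr _ _ ?_ hI.regular_selfAdj.2⟩,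
    isAlmostAntiCommuting_iff.2 ⟨hR, hI, hRI⟩⟩
  · rw [LinearPMap.add_domain, ← hd, inf_idem]
  · rw [LinearPMap.sub_domain, ← hd, inf_idem]

end KasparovConditions

/-! ### Recovering the Cartesian decomposition from a pair of Kasparov modules -/

section PairsToCartesian

variable {A B E : Type*} [NonUnitalCStarAlgebra A]
  [NonUnitalCStarAlgebra B] [PartialOrder B] [StarOrderedRing B]
  [NormedAddCommGroup E] [NormedSpace ℂ E] [SMul Bᵐᵒᵖ E] [CStarModule Bᵐᵒᵖ E]

local notation "⟪" x "," y "⟫" => inner Bᵐᵒᵖ x y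

variable {π : Rep A B E} {𝒜 : NonUnitalStarSubalgebra ℂ A} {D : E →ₗ.[ℂ] E}

theorem offDiag_isClosed {X Y : E →ₗ.[ℂ] E} (hX : X.IsClosed) (hY : Y.IsClosed) :
    (offDiag B X Y).IsClosed := by
  rw [LinearPMap.IsClosed, offDiag_graph]
  exact isClosed_relOff hX hY

theorem hasCore_offDiag_iff {X Y : E →ₗ.[ℂ] E} (hX : X.IsClosed) (hY : Y.IsClosed)
    {V : Submodule ℂ E} : (offDiag B X Y).HasCore (sumSub V) ↔ X.HasCore V ∧ Y.HasCore V := by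
  have hcl := offDiag_isClosed (B := B) hX hY
  rw [hasCore_iff hcl, hasCore_iff hX, hasCore_iff hY, offDiag_graph,
    relRestrict_relOff, relOff_topologicalClosure]
  constructor
  · rintro ⟨h1, h2⟩
    obtain ⟨h3, h4⟩ := relOff_injective h2
    refine ⟨⟨fun x hx => ?_, h3⟩, fun x hx => ?_, h4⟩
    · exact (h1 (show pairL B (x, x) ∈ sumSub V from ⟨hx, hx⟩)).2
    · exact (h1 (show pairL B (x, x) ∈ sumSub V from ⟨hx, hx⟩)).1
  · rintro ⟨⟨h1, h2⟩, h3, h4⟩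
    exact ⟨fun p hp => ⟨h3 hp.1, h1 hp.2⟩, by rw [h2, h4]⟩

variable [CompleteSpace E]

theorem IsPairOfKasparovModules.isCartesianKasparov (hD : IsRegular B D)
    (h : IsPairOfKasparovModules (sumGrading B E) π.sum 𝒜
      (offDiag B (adj B D) D) (offDiag B D (adj B D))) : IsCartesianKasparov π 𝒜 D := by
  obtain ⟨V, hV, hV1, -, -, -⟩ := h.exists_core
  have hD' := hD.adj
  have hg := adj_graph (B := B) hD.dense_domain
  have hcl := offDiag_isClosed (B := B) hD'.closed hD.closed
  -- The common core `V` lies in `W ⊕ W` with `W = Dom D ∩ Dom D*`, so `W` is a core for `D` and `D*`.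
  have hsub : sumSub (D.domain ⊓ (adj B D).domain) ≤ (offDiag B (adj B D) D).domain := by
    rintro p ⟨h1, h2⟩
    exact ⟨h1.1, h2.2⟩
  obtain ⟨hc', hc⟩ := (hasCore_offDiag_iff (B := B) hD'.closed hD.closed).1
    (hasCore_mono hcl hV1 (W := sumSub (D.domain ⊓ (adj B D).domain))
      (fun p hp => mem_sumSub.2 ⟨⟨(hV hp).1.1, (hV hp).2.1⟩, (hV hp).2.2, (hV hp).1.2⟩)
      hsub)
  have hW : Dense ((relDom D.graph ⊓ relDom (relAdj B D.graph) : Submodule ℂ E) : Set E) := by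
    rw [← hg, relDom_graph, relDom_graph]
    exact dense_of_hasCore hD.closed hD.dense_domain hc
  obtain ⟨hR, hI, hRI⟩ := isAlmostAntiCommuting_iff.1 h.almostAntiCommuting
  rw [pair_add_graph hD.dense_domain hW] at hR hRI
  rw [pair_sub_graph hD.dense_domain hW] at hI hRI
  have e1 : star ((2 : ℝ) : ℂ) = ((2 : ℝ) : ℂ) := Complex.conj_ofReal 2
  have e2 : star (-(Complex.I * (2 : ℝ))) = Complex.I * (2 : ℝ) := by simp
  have hR' := isSelfAdjRegular_of_relOff (ω := ((2 : ℝ) : ℂ)) (by norm_num) (by rwa [e1])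
  have hI' := isSelfAdjRegular_of_relOff (ω := -(Complex.I * (2 : ℝ))) (by simp) (by rwa [e2])
  refine ⟨isCartesian_of_core hD hc hc' hR' hI'
    (hasTwistedCommutator_of_double two_pos hR' hI' hRI), fun a ha => ?_, fun a => ?_⟩
  · have h1 := (h.left.boundedCommutator a ha).mono
      hsub
    rw [Rep.sum_hom, hasBoundedCommutatorOn_offDiag_iff] at h1
    exact ⟨h1.2.of_core hD.closed (π.continuous a) hc,
      h1.1.of_core hD'.closed (π.continuous a) hc'⟩
  · have h1 := (h.left.locallyCompact a).isCompactRel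
    rw [h.left.selfAdj.2, offDiag_graph, Rep.sum_hom, isCompactRel_relOff_iff] at h1
    refine h1.1.of_combination (fun x s s' hs hs' => D.mem_graph_snd_inj hs hs' rfl)
      (fun x s s' hs hs' => D.mem_graph_snd_inj hs hs' rfl) 1 0 1 0 fun x t t' ht ht' => ?_
    simpa using ht

end PairsToCartesian

/-! ### Wick rotations of a Cartesian decomposition -/

section WickRotation

variable {A B E : Type*} [NonUnitalCStarAlgebra A]
  [NonUnitalCStarAlgebra B] [PartialOrder B] [StarOrderedRing B]
  [NormedAddCommGroup E] [NormedSpace ℂ E] [SMul Bᵐᵒᵖ E] [CStarModule Bᵐᵒᵖ E]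

local notation "⟪" x "," y "⟫" => inner Bᵐᵒᵖ x y

variable {D : E →ₗ.[ℂ] E}

variable {S T : Submodule ℂ (E × E)}

/-- The Wick rotations are the combinations `c D + c̄ D*` and `c̄ D + c D*` with `c = (1 - i) / 2`. -/
theorem IsCartesian.wick_mem (h : IsCartesian B D S T) {x d d' : E} (hd : (x, d) ∈ D.graph)
    (hd' : (x, d') ∈ relAdj B D.graph) :
    (x, ((1 - Complex.I) / 2) • d + ((1 + Complex.I) / 2) • d') ∈ relLin S T 1 1 ∧
      (x, ((1 + Complex.I) / 2) • d + ((1 - Complex.I) / 2) • d') ∈ relLin S T 1 (-1) := by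
  obtain ⟨s, t, hs, ht, rfl, rfl⟩ := h.eq_add hd hd'
  refine ⟨⟨s, t, hs, ht, ?_⟩, ⟨s, t, hs, ht, ?_⟩⟩
  · dsimp only
    match_scalars <;> first | ring1 | linear_combination (-Complex.I_sq)
  · dsimp only
    match_scalars <;> first | ring1 | linear_combination Complex.I_sq

variable [CompleteSpace E]

theorem IsCartesian.mem_of_wick_graph (h : IsCartesian B D S T) {x p m : E}
    (hp : (x, p) ∈ (relLin S T 1 1).topologicalClosure)
    (hm : (x, m) ∈ (relLin S T 1 (-1)).topologicalClosure) :
    (x, ((1 + Complex.I) / 2) • p + ((1 - Complex.I) / 2) • m) ∈ D.graph ∧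
      (x, ((1 - Complex.I) / 2) • p + ((1 + Complex.I) / 2) • m) ∈ relAdj B D.graph := by
  obtain ⟨hs, ht⟩ := h.mem_of_wick hp hm
  rw [h.adj_eq, h.graph_eq]
  refine ⟨⟨_, _, hs, ht, ?_⟩, ⟨_, _, hs, ht, ?_⟩⟩ <;> dsimp only <;> module

theorem IsCartesian.wick_re (h : IsCartesian B D S T) :
    (relLin (relLin S T 1 1).topologicalClosure (relLin S T 1 (-1)).topologicalClosure
      (1 / 2) (1 / 2)).topologicalClosure = S := by
  refine le_antisymm (Submodule.topologicalClosure_minimal _ ?_ h.left.isClosed) ?_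
  · rintro ⟨x, _⟩ ⟨p, m, hp, hm, rfl⟩
    exact (h.mem_of_wick hp hm).1
  · refine (h.commutator.core_left h.left h.right (by norm_num)).ge.trans ?_
    refine Submodule.topologicalClosure_mono ?_
    rintro ⟨x, s⟩ ⟨hs, ht⟩
    obtain ⟨t, ht⟩ := mem_relDom.1 ht
    refine ⟨s + t, s - t, Submodule.le_topologicalClosure _ ⟨s, t, hs, ht, ?_⟩,
      Submodule.le_topologicalClosure _ ⟨s, t, hs, ht, ?_⟩, ?_⟩ <;> dsimp only <;> module

theorem IsCartesian.wick_im (h : IsCartesian B D S T) :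
    (relLin (relLin S T 1 1).topologicalClosure (relLin S T 1 (-1)).topologicalClosure
      (1 / 2) (-(1 / 2))).topologicalClosure = T := by
  refine le_antisymm (Submodule.topologicalClosure_minimal _ ?_ h.right.isClosed) ?_
  · rintro ⟨x, _⟩ ⟨p, m, hp, hm, rfl⟩
    dsimp only at hp hm ⊢
    rw [neg_smul, ← sub_eq_add_neg]
    exact (h.mem_of_wick hp hm).2
  · refine (h.commutator.core_right h.left h.right (by norm_num)).ge.trans ?_
    refine Submodule.topologicalClosure_mono ?_
    rintro ⟨x, t⟩ ⟨ht, hs⟩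
    obtain ⟨s, hs⟩ := mem_relDom.1 hs
    refine ⟨s + t, s - t, Submodule.le_topologicalClosure _ ⟨s, t, hs, ht, ?_⟩,
      Submodule.le_topologicalClosure _ ⟨s, t, hs, ht, ?_⟩, ?_⟩ <;> dsimp only <;> module

/-- `⟪D₊ x, D₊ y⟫ + ⟪D₋ x, D₋ y⟫ = ⟪D x, D y⟫ + ⟪D* x, D* y⟫`, so that functionals on
`Dom D₊ ∩ Dom D₋` are represented in the inner product given by `D₊` and `D₋`. -/
theorem IsCartesian.exists_wick_riesz (h : IsCartesian B D S T) (u v v' : E) :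
    ∃ w p m, (w, p) ∈ (relLin S T 1 1).topologicalClosure ∧
      (w, m) ∈ (relLin S T 1 (-1)).topologicalClosure ∧
      ∀ x p' m', (x, p') ∈ (relLin S T 1 1).topologicalClosure →
        (x, m') ∈ (relLin S T 1 (-1)).topologicalClosure →
        ⟪u, x⟫ + ⟪v, p'⟫ + ⟪v', m'⟫ = ⟪w, x⟫ + ⟪p, p'⟫ + ⟪m, m'⟫ := by
  have hI : (starRingEnd ℂ) Complex.I = -Complex.I := Complex.conj_I
  obtain ⟨w, d, d', hd, hd', h1⟩ := h.exists_riesz le_rfl zero_le_one u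
    (((1 + Complex.I) / 2) • v + ((1 - Complex.I) / 2) • v')
    (((1 - Complex.I) / 2) • v + ((1 + Complex.I) / 2) • v')
  obtain ⟨h2, h3⟩ := h.wick_mem hd hd'
  refine ⟨w, _, _, Submodule.le_topologicalClosure _ h2, Submodule.le_topologicalClosure _ h3,
    fun x p m hp hm => ?_⟩
  obtain ⟨h4, h5⟩ := h.mem_of_wick_graph hp hm
  have h6 := h1 x _ _ h4 h5
  simp only [CStarModule.inner_add_left, CStarModule.inner_add_right,
    CStarModule.inner_smul_left_complex, CStarModule.inner_smul_right_complex, Complex.ofReal_one,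
    Complex.ofReal_add, Complex.ofReal_zero, star_div₀, star_add, star_sub, star_one, star_ofNat,
    Complex.star_def, hI] at h6 ⊢
  linear_combination (norm := skip) h6
  match_scalars <;> first
    | ring1
    | linear_combination (1 / 2 : ℂ) * Complex.I_sq
    | linear_combination (-(1 / 2) : ℂ) * Complex.I_sq

end WickRotation

/-! ### The doubled Wick rotation -/

section DoubledWickRotation

variable {A B E : Type*} [NonUnitalCStarAlgebra A]
  [NonUnitalCStarAlgebra B] [PartialOrder B] [StarOrderedRing B]
  [NormedAddCommGroup E] [NormedSpace ℂ E] [SMul Bᵐᵒᵖ E] [CStarModule Bᵐᵒᵖ E] [CompleteSpace E]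

local notation "⟪" x "," y "⟫" => inner Bᵐᵒᵖ x y

variable {D : E →ₗ.[ℂ] E} {S T : Submodule ℂ (E × E)}

theorem IsCartesian.isSelfAdjRegular_wick
    (h : IsCartesian B D (rePart B D).graph (imPart B D).graph) :
    IsSelfAdjRegular B (wickPlus B D).graph ∧ IsSelfAdjRegular B (wickMinus B D).graph := by
  have h1 := h.isSelfAdjRegular_closure (τ := 1) (by simp)
  have h2 := h.isSelfAdjRegular_closure (τ := -1) (by simp)
  simp only [relComb_eq, Complex.ofReal_one, Complex.ofReal_neg] at h1 h2
  rw [wickPlus_graph h.regular.dense_domain h.dense_relDom,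
    wickMinus_graph h.regular.dense_domain h.dense_relDom]
  exact ⟨h1, h2⟩

theorem IsCartesian.wick_domain
    (h : IsCartesian B D (rePart B D).graph (imPart B D).graph) :
    (wickPlus B D).domain ⊓ (wickMinus B D).domain = D.domain := by
  have hp := wickPlus_graph h.regular.dense_domain h.dense_relDom
  have hm := wickMinus_graph h.regular.dense_domain h.dense_relDom
  rw [← relDom_graph, ← relDom_graph, ← relDom_graph, hp, hm]
  ext x
  constructor
  · rintro ⟨h1, h2⟩
    obtain ⟨p, h1⟩ := mem_relDom.1 h1
    obtain ⟨m, h2⟩ := mem_relDom.1 h2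
    exact mem_relDom.2 ⟨_, (h.mem_of_wick_graph h1 h2).1⟩
  · intro hx
    obtain ⟨d, hd⟩ := mem_relDom.1 hx
    obtain ⟨d', hd'⟩ := h.exists_adj hd
    obtain ⟨h1, h2⟩ := h.wick_mem hd hd'
    exact ⟨mem_relDom.2 ⟨_, Submodule.le_topologicalClosure _ h1⟩,
      mem_relDom.2 ⟨_, Submodule.le_topologicalClosure _ h2⟩⟩

theorem IsCartesian.hasCore_wick
    (h : IsCartesian B D (rePart B D).graph (imPart B D).graph) :
    (wickPlus B D).HasCore D.domain ∧ (wickMinus B D).HasCore D.domain := by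
  have hd : ∀ c, relDom (relLin (rePart B D).graph (imPart B D).graph 1 c) = D.domain := by
    intro c
    rw [relDom_relLin, ← h.relDom_eq, relDom_graph]
  exact ⟨hasCore_of_graph_eq (wickPlus_graph h.regular.dense_domain h.dense_relDom) (hd _),
    hasCore_of_graph_eq (wickMinus_graph h.regular.dense_domain h.dense_relDom) (hd _)⟩

theorem IsSelfAdjRegular.adj_offDiag {P Q : E →ₗ.[ℂ] E} (hP : IsSelfAdjRegular B P.graph)
    (hQ : IsSelfAdjRegular B Q.graph) : adj B (offDiag B P Q) = offDiag B Q P := by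
  have hd := (hP.regular_selfAdj.1.offDiag hQ.regular_selfAdj.1).dense_domain
  refine LinearPMap.eq_of_eq_graph ?_
  rw [adj_graph hd, offDiag_graph, offDiag_graph, relAdj_relOff, hP.relAdj_eq, hQ.relAdj_eq]

theorem IsCartesian.double_domain
    (h : IsCartesian B D (rePart B D).graph (imPart B D).graph) :
    (offDiag B (wickPlus B D) (wickMinus B D)).domain ⊓
      (adj B (offDiag B (wickPlus B D) (wickMinus B D))).domain = sumSub D.domain := by
  rw [h.isSelfAdjRegular_wick.1.adj_offDiag h.isSelfAdjRegular_wick.2, ← h.wick_domain]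
  ext p
  exact ⟨fun hp => ⟨⟨hp.2.1, hp.1.1⟩, hp.1.2, hp.2.2⟩, fun hp => ⟨⟨hp.1.2, hp.2.1⟩, hp.1.1, hp.2.2⟩⟩

theorem IsCartesian.dense_double
    (h : IsCartesian B D (rePart B D).graph (imPart B D).graph) :
    Dense ((relDom (offDiag B (wickPlus B D) (wickMinus B D)).graph ⊓
      relDom (relAdj B (offDiag B (wickPlus B D) (wickMinus B D)).graph) :
        Submodule ℂ (Sum₂ B E)) : Set (Sum₂ B E)) := by
  have hreg := h.isSelfAdjRegular_wick.1.regular_selfAdj.1.offDiag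
    h.isSelfAdjRegular_wick.2.regular_selfAdj.1
  have e : sumSub (B := B) D.domain = relDom (relOff D.graph D.graph) := by
    ext p
    rw [mem_relDom_relOff, relDom_graph]
    rfl
  rw [← adj_graph hreg.dense_domain, relDom_graph, relDom_graph, h.double_domain, e]
  refine dense_relDom_relOff ?_ ?_ <;> rw [relDom_graph] <;> exact h.regular.dense_domain

/-- For `D = S + iT`, the doubled Wick rotation `[[0, D₊], [D₋, 0]]` has real part
`[[0, S], [S, 0]]`. -/
theorem IsCartesian.double_re
    (h : IsCartesian B D (rePart B D).graph (imPart B D).graph) :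
    (rePart B (offDiag B (wickPlus B D) (wickMinus B D))).graph =
      relOff (relSMul ((1 : ℝ) : ℂ) (rePart B D).graph)
        (relSMul ((1 : ℝ) : ℂ) (rePart B D).graph) := by
  have hP := h.isSelfAdjRegular_wick.1
  have hQ := h.isSelfAdjRegular_wick.2
  have hreg := hP.regular_selfAdj.1.offDiag hQ.regular_selfAdj.1
  have e := h.wick_re
  rw [← wickPlus_graph h.regular.dense_domain h.dense_relDom,
    ← wickMinus_graph h.regular.dense_domain h.dense_relDom] at e
  rw [rePart_graph hreg.dense_domain h.dense_double, offDiag_graph, relAdj_relOff, hP.relAdj_eq,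
    hQ.relAdj_eq, relLin_relOff, relOff_topologicalClosure, relLin_comm (1 / 2) (1 / 2) (S :=
      (wickMinus B D).graph), ← e, ← relSMul_topologicalClosure (by norm_num), relSMul_relLin]
  norm_num

/-- For `D = S + iT`, the doubled Wick rotation `[[0, D₊], [D₋, 0]]` has imaginary part
`[[0, -iT], [iT, 0]]`. -/
theorem IsCartesian.double_im
    (h : IsCartesian B D (rePart B D).graph (imPart B D).graph) :
    (imPart B (offDiag B (wickPlus B D) (wickMinus B D))).graph =
      relOff (relSMul (-(Complex.I * (1 : ℝ))) (imPart B D).graph)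
        (relSMul (Complex.I * (1 : ℝ)) (imPart B D).graph) := by
  have hP := h.isSelfAdjRegular_wick.1
  have hQ := h.isSelfAdjRegular_wick.2
  have hreg := hP.regular_selfAdj.1.offDiag hQ.regular_selfAdj.1
  have e := h.wick_im
  rw [← wickPlus_graph h.regular.dense_domain h.dense_relDom,
    ← wickMinus_graph h.regular.dense_domain h.dense_relDom] at e
  rw [imPart_graph hreg.dense_domain h.dense_double, offDiag_graph, relAdj_relOff, hP.relAdj_eq,
    hQ.relAdj_eq, relLin_relOff, relOff_topologicalClosure, relLin_comm (-(Complex.I / 2)) _ (S :=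
      (wickMinus B D).graph), ← e, ← relSMul_topologicalClosure (by simp),
    ← relSMul_topologicalClosure (by simp), relSMul_relLin, relSMul_relLin]
  simp only [Complex.ofReal_one, mul_one, mul_neg, mul_one_div, neg_div, neg_neg]

end DoubledWickRotation

/-! ### The indefinite Kasparov module of a Cartesian decomposition -/

section CartesianToWick

variable {A B E : Type*} [NonUnitalCStarAlgebra A]
  [NonUnitalCStarAlgebra B] [PartialOrder B] [StarOrderedRing B]
  [NormedAddCommGroup E] [NormedSpace ℂ E] [SMul Bᵐᵒᵖ E] [CStarModule Bᵐᵒᵖ E] [CompleteSpace E]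

local notation "⟪" x "," y "⟫" => inner Bᵐᵒᵖ x y

variable {π : Rep A B E} {𝒜 : NonUnitalStarSubalgebra ℂ A} {D : E →ₗ.[ℂ] E}

theorem IsCartesianKasparov.isIndefiniteKasparovModule (hdata : IsBimoduleData π 𝒜)
    (h : IsCartesianKasparov π 𝒜 D) : IsIndefiniteKasparovModule (sumGrading B E) π.sum 𝒜
      (offDiag B (wickPlus B D) (wickMinus B D)) := by
  have hc := h.cartesian
  have hd := hc.regular.dense_domain
  obtain ⟨hP, hQ⟩ := hc.isSelfAdjRegular_wick
  have hreg := hP.regular_selfAdj.1.offDiag hQ.regular_selfAdj.1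
  have hadj := hP.adj_offDiag hQ
  have hp := wickPlus_graph hd hc.dense_relDom
  have hm := wickMinus_graph hd hc.dense_relDom
  have hR := hc.left.relOff (ω := ((1 : ℝ) : ℂ)) (by norm_num)
  have hI := hc.right.relOff (ω := -(Complex.I * (1 : ℝ))) (by simp)
  have e1 : star ((1 : ℝ) : ℂ) = ((1 : ℝ) : ℂ) := Complex.conj_ofReal 1
  have e2 : star (-(Complex.I * (1 : ℝ))) = Complex.I * (1 : ℝ) := by simp
  have hRI := hc.commutator.double (ρ := 1) one_pos
  rw [e1, ← hc.double_re] at hR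
  rw [e2, ← hc.double_im] at hI
  rw [← hc.double_re, ← hc.double_im] at hRI
  -- `D₊` and `D₋` extend the combinations of `D` and `D*` that are given by `IsCartesian.wick_mem`
  have hp_le : ∀ {α β : ℂ}, (∀ x d d', (x, d) ∈ D.graph → (x, d') ∈ relAdj B D.graph →
      (x, α • d + β • d') ∈ relLin (rePart B D).graph (imPart B D).graph 1 1) →
      relLin D.graph (adj B D).graph α β ≤ (wickPlus B D).graph := by
    rintro α β h ⟨x, _⟩ ⟨d, d', hx, hx', rfl⟩
    rw [hp]
    exact Submodule.le_topologicalClosure _ (h x d d' hx (adj_graph (B := B) hd ▸ hx'))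
  have hm_le : ∀ {α β : ℂ}, (∀ x d d', (x, d) ∈ D.graph → (x, d') ∈ relAdj B D.graph →
      (x, α • d + β • d') ∈ relLin (rePart B D).graph (imPart B D).graph 1 (-1)) →
      relLin D.graph (adj B D).graph α β ≤ (wickMinus B D).graph := by
    rintro α β h ⟨x, _⟩ ⟨d, d', hx, hx', rfl⟩
    rw [hm]
    exact Submodule.le_topologicalClosure _ (h x d d' hx (adj_graph (B := B) hd ▸ hx'))
  refine ⟨hdata.sum, isGrading_sumGrading, sumGrading_even π, hreg, isOdd_offDiag _ _,
    hR.regular_selfAdj.1, hI.regular_selfAdj.1, isAlmostAntiCommuting_iff.2 ⟨hR, hI, hRI⟩,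
    ⟨_, isCommonCore_self ?_ ?_,
      hR.regular_selfAdj.2.isEssSelfAdjOn (hasCore_rePart hreg.dense_domain hc.dense_double),
      hI.regular_selfAdj.2.isEssSelfAdjOn (hasCore_imPart hreg.dense_domain hc.dense_double),
      fun a ha => ?_⟩, fun a => ?_⟩
  · rw [hc.double_domain, hasCore_offDiag_iff hP.regular_selfAdj.1.closed hQ.regular_selfAdj.1.closed]
    exact hc.hasCore_wick
  · rw [hc.double_domain, hadj,
      hasCore_offDiag_iff hQ.regular_selfAdj.1.closed hP.regular_selfAdj.1.closed]
    exact hc.hasCore_wick.symm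
  · obtain ⟨h1, h2⟩ := h.commutator a ha
    rw [hc.domain_eq] at h2
    have h3 := h1.of_combination (hp_le fun x d d' hx hx' => (hc.wick_mem hx hx').1) h2
    have h4 := h1.of_combination (hm_le fun x d d' hx hx' => (hc.wick_mem hx hx').2) h2
    rw [hc.double_domain, hadj, Rep.sum_hom, hasBoundedCommutatorOn_offDiag_iff,
      hasBoundedCommutatorOn_offDiag_iff]
    exact ⟨⟨h3, h4⟩, h4, h3⟩
  · have hG : ∀ x s s', (x, s) ∈ D.graph → (x, s') ∈ D.graph → s = s' :=
      fun x s s' hs hs' => D.mem_graph_snd_inj hs hs' rfl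
    have hH : ∀ x s s', (x, s) ∈ relAdj B D.graph → (x, s') ∈ relAdj B D.graph → s = s' := by
      rw [← adj_graph hd]
      exact fun x s s' hs hs' => (adj B D).mem_graph_snd_inj hs hs' rfl
    refine IsCompactRel.isCompactOnDomain ?_ fun u v v' => ?_
    · rw [hadj, offDiag_graph, offDiag_graph, Rep.sum_hom, isCompactRel_relOff_iff, hp, hm]
      refine ⟨(h.compact a).of_combination hG hH ((1 - Complex.I) / 2) ((1 + Complex.I) / 2)
        ((1 + Complex.I) / 2) ((1 - Complex.I) / 2) fun x t t' ht ht' => ?_,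
        (h.compact a).of_combination hG hH ((1 + Complex.I) / 2) ((1 - Complex.I) / 2)
        ((1 - Complex.I) / 2) ((1 + Complex.I) / 2) fun x t t' ht ht' =>
          hc.mem_of_wick_graph ht ht'⟩
      rw [add_comm (((1 - Complex.I) / 2) • t), add_comm (((1 + Complex.I) / 2) • t)]
      exact hc.mem_of_wick_graph ht' ht
    · obtain ⟨w₁, p₁, m₁, h1, h2, h3⟩ := hc.exists_wick_riesz u.1 v'.2 v.2
      obtain ⟨w₂, p₂, m₂, h4, h5, h6⟩ := hc.exists_wick_riesz u.2 v.1 v'.1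
      rw [hadj, offDiag_graph, offDiag_graph, hp, hm]
      refine ⟨pairL B (w₁, w₂), pairL B (p₂, m₁), pairL B (m₂, p₁), ⟨h4, h2⟩, ⟨h5, h1⟩, ?_⟩
      rintro x q r ⟨b1, b2⟩ ⟨b3, b4⟩
      have e3 := h3 _ _ _ b4 b2
      have e4 := h6 _ _ _ b1 b3
      dsimp only at e3 e4
      simp only [sum_inner, pairL_fst, pairL_snd]
      linear_combination (norm := module) e3 + e4

end CartesianToWick

/-! ### Recovering the Cartesian decomposition from the doubled Wick rotation -/

section WickToCartesian

variable {A B E : Type*} [NonUnitalCStarAlgebra A]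
  [NonUnitalCStarAlgebra B] [PartialOrder B] [StarOrderedRing B]
  [NormedAddCommGroup E] [NormedSpace ℂ E] [SMul Bᵐᵒᵖ E] [CStarModule Bᵐᵒᵖ E] [CompleteSpace E]

local notation "⟪" x "," y "⟫" => inner Bᵐᵒᵖ x y

variable {π : Rep A B E} {𝒜 : NonUnitalStarSubalgebra ℂ A} {D : E →ₗ.[ℂ] E}

/-- Density in the graph norm of `Dom D ∩ Dom D*` makes `V` a core for any closed combination of
`D` and `D*` with this domain. -/
theorem IsCommonCore.hasCore_combination {P : E →ₗ.[ℂ] E} {V : Submodule ℂ E}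
    (h : IsCommonCore (B := B) D V) (hP : P.IsClosed) {α β : ℂ}
    (hle : relLin D.graph (adj B D).graph α β ≤ P.graph)
    (hdom : P.domain ≤ D.domain ⊓ (adj B D).domain) : P.HasCore V := by
  have hV : V ≤ P.domain := by
    intro x hx
    obtain ⟨h1, h2⟩ := h.le hx
    exact LinearPMap.mem_domain_of_mem_graph
      (hle ⟨_, _, D.mem_graph ⟨x, h1⟩, (adj B D).mem_graph ⟨x, h2⟩, rfl⟩ :
        (x, α • D ⟨x, h1⟩ + β • adj B D ⟨x, h2⟩) ∈ P.graph)
  rw [hasCore_iff hP]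
  refine ⟨hV, le_antisymm (Submodule.topologicalClosure_minimal _ inf_le_left hP) ?_⟩
  rintro ⟨x, y⟩ hxy
  have hx := hdom (LinearPMap.mem_domain_of_mem_graph hxy)
  obtain ⟨s, hs⟩ : ∃ s, (x, s) ∈ D.graph := ⟨_, D.mem_graph ⟨x, hx.1⟩⟩
  obtain ⟨t, ht⟩ : ∃ t, (x, t) ∈ (adj B D).graph := ⟨_, (adj B D).mem_graph ⟨x, hx.2⟩⟩
  obtain rfl : y = α • s + β • t :=
    P.mem_graph_snd_inj hxy (hle ⟨s, t, hs, ht, rfl⟩) rfl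
  refine Metric.mem_closure_iff.2 fun ε hε => ?_
  set K : ℝ := 1 + ‖α‖ + ‖β‖ with hK
  have hK0 : 0 < K := by positivity
  obtain ⟨⟨v, hv⟩, hvV, hlt⟩ := h.dense ⟨x, hx⟩ (ε / (3 * K)) (by positivity)
  dsimp only at hvV
  obtain ⟨s', hs'⟩ : ∃ s, (v, s) ∈ D.graph := ⟨_, D.mem_graph ⟨v, hv.1⟩⟩
  obtain ⟨t', ht'⟩ : ∃ t, (v, t) ∈ (adj B D).graph := ⟨_, (adj B D).mem_graph ⟨v, hv.2⟩⟩
  refine ⟨(v, α • s' + β • t'), mem_relRestrict.2 ⟨hle ⟨s', t', hs', ht', rfl⟩, hvV⟩, ?_⟩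
  have h1 := graphNorm_eq (B := B) (x := x - v) (s := s - s') (t := t - t')
    (D.graph.sub_mem hs hs') ((adj B D).graph.sub_mem ht ht')
    (Submodule.sub_mem _ hx hv)
  have h2 := le_sqrt_norm_inner (B := B) (x - v) (s - s') (t - t')
  have h3 : √‖⟪x - v, x - v⟫ + ⟪s - s', s - s'⟫ + ⟪t - t', t - t'⟫‖ < ε / (3 * K) :=
    h1.symm.trans_lt hlt
  have h4 : ‖x - v‖ + ‖s - s'‖ + ‖t - t'‖ < ε / K := by
    have : ε / K = 3 * (ε / (3 * K)) := by field_simp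
    linarith
  rw [lt_div_iff₀ hK0] at h4
  have h5 : ‖(α • s + β • t) - (α • s' + β • t')‖ ≤ ‖α‖ * ‖s - s'‖ + ‖β‖ * ‖t - t'‖ := by
    have : (α • s + β • t) - (α • s' + β • t') = α • (s - s') + β • (t - t') := by module
    rw [this]
    refine (norm_add_le _ _).trans ?_
    rw [norm_smul, norm_smul]
  have n1 := norm_nonneg (x - v)
  have n2 := norm_nonneg (s - s')
  have n3 := norm_nonneg (t - t')
  have n4 := norm_nonneg α
  have n5 := norm_nonneg β
  rw [dist_eq_norm]
  refine max_lt ?_ ?_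
  · change ‖x - v‖ < ε
    nlinarith [mul_nonneg n4 n1, mul_nonneg n5 n1]
  · change ‖(α • s + β • t) - (α • s' + β • t')‖ < ε
    nlinarith [mul_nonneg n4 n1, mul_nonneg n5 n1, mul_nonneg n4 n2, mul_nonneg n5 n2,
      mul_nonneg n4 n3, mul_nonneg n5 n3]

variable {S T X Y : Submodule ℂ (E × E)}

/-- `S` is recovered as the closure of `((S + T) + (S - T)) / 2`. -/
theorem HasTwistedCommutator.left_le_closure {σ : ℝ} (h : HasTwistedCommutator B σ S T)
    (hS : IsSelfAdjRegular B S) (hT : IsSelfAdjRegular B T) (hσ : σ * σ = 1)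
    (hX : relComb S T 1 = X) (hY : relComb S T (-1) = Y) :
    S ≤ (relLin X Y (1 / 2) (1 / 2)).topologicalClosure := by
  refine (h.core_left hS hT hσ).ge.trans (Submodule.topologicalClosure_mono ?_)
  rintro ⟨x, s⟩ ⟨hs, ht⟩
  obtain ⟨t, ht⟩ := mem_relDom.1 ht
  subst hX hY
  refine ⟨s + (1 : ℂ) • t, s + (-1 : ℂ) • t, ⟨s, t, hs, ht, rfl⟩, ⟨s, t, hs, ht, rfl⟩, ?_⟩
  dsimp only
  module

/-- `T` is recovered as the closure of `((S + T) - (S - T)) / 2`. -/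
theorem HasTwistedCommutator.right_le_closure {σ : ℝ} (h : HasTwistedCommutator B σ S T)
    (hS : IsSelfAdjRegular B S) (hT : IsSelfAdjRegular B T) (hσ : σ * σ = 1)
    (hX : relComb S T 1 = X) (hY : relComb S T (-1) = Y) :
    T ≤ (relLin X Y (1 / 2) (-(1 / 2))).topologicalClosure := by
  refine (h.core_right hS hT hσ).ge.trans (Submodule.topologicalClosure_mono ?_)
  rintro ⟨x, t⟩ ⟨ht, hs⟩
  obtain ⟨s, hs⟩ := mem_relDom.1 hs
  subst hX hY
  refine ⟨s + (1 : ℂ) • t, s + (-1 : ℂ) • t, ⟨s, t, hs, ht, rfl⟩, ⟨s, t, hs, ht, rfl⟩, ?_⟩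
  dsimp only
  module

/-- If `S` and `T` almost anti-commute, then `S ± T` are self-adjoint. Hence a self-adjoint relation
with a core contained in `S ± T` is equal to it. -/
theorem HasTwistedCommutator.relComb_eq_of_core (h : HasTwistedCommutator B (-1) S T)
    (hS : IsSelfAdjRegular B S) (hT : IsSelfAdjRegular B T) {c : ℂ} (hc : star c = c)
    (hc1 : ‖c‖ = 1) (hX : X = relAdj B X) (hY : Y ≤ relComb S T c)
    (hXY : Y.topologicalClosure = X) : relComb S T c = X := by
  have h1 : X ≤ relComb S T c := by
    rw [← hXY]
    exact Submodule.topologicalClosure_minimal _ hY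
      (h.isClosed_relComb hS hT (by norm_num) (by simpa using hc) hc1)
  refine le_antisymm ?_ h1
  have h2 := relComb_le_relAdj hS.relAdj_eq.ge hT.relAdj_eq.ge c
  rw [hc] at h2
  exact (h2.trans (relAdj_anti h1)).trans hX.ge

/-- If the real and imaginary parts `S` and `T` of `P = [[0, D₊], [D₋, 0]]` almost anti-commute, then the
real and imaginary parts of `D` almost commute. A priori little is known about `D₊` and `D₋`, nor
about the adjoint of `P`. However, `S ± T` are self-adjoint and extend `[[0, D*], [D, 0]]` and
`[[0, D], [D*, 0]]` on a core, so they are equal to these operators. This identifies `S` with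
`[[0, Re D], [Re D, 0]]` and `T` with `[[0, -i Im D], [i Im D, 0]]`. -/
theorem isCartesian_of_double (hD : IsRegular B D)
    (hc : D.HasCore (D.domain ⊓ (adj B D).domain))
    (hc' : (adj B D).HasCore (D.domain ⊓ (adj B D).domain))
    (hreg : IsRegular B (offDiag B (wickPlus B D) (wickMinus B D)))
    (h : IsAlmostAntiCommuting B (rePart B (offDiag B (wickPlus B D) (wickMinus B D)))
      (imPart B (offDiag B (wickPlus B D) (wickMinus B D)))) :
    IsCartesian B D (rePart B D).graph (imPart B D).graph := by
  have hd := hD.dense_domain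
  have hg := adj_graph (B := B) hd
  have hW : Dense ((relDom D.graph ⊓ relDom (relAdj B D.graph) : Submodule ℂ E) : Set E) := by
    rw [← hg, relDom_graph, relDom_graph]
    exact dense_of_hasCore hD.closed hd hc
  obtain ⟨hS, hT, hST⟩ := isAlmostAntiCommuting_iff.1 h
  set R := (rePart B D).graph with hRdef
  set I := (imPart B D).graph with hIdef
  set P := offDiag B (wickPlus B D) (wickMinus B D) with hPdef
  set S := (rePart B P).graph
  set T := (imPart B P).graph
  have hp := wickPlus_graph hd hW
  have hm := wickMinus_graph hd hW
  have hPg : P.graph = relOff (relLin R I 1 1).topologicalClosure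
      (relLin R I 1 (-1)).topologicalClosure := by rw [offDiag_graph, hp, hm]
  -- `P*` extends `[[0, D₋], [D₊, 0]]`, as `D₊` and `D₋` are symmetric.
  have hPadj : relOff (relLin R I 1 (-1)).topologicalClosure (relLin R I 1 1).topologicalClosure ≤
      relAdj B P.graph := by
    rw [hPg, relAdj_relOff]
    exact fun p h => ⟨relAdj_symm_closure (relLin_re_im_symm hd hW (by simp)) h.1,
      relAdj_symm_closure (relLin_re_im_symm hd hW (by simp)) h.2⟩
  have hPW : Dense ((relDom P.graph ⊓ relDom (relAdj B P.graph) :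
      Submodule ℂ (Sum₂ B E)) : Set (Sum₂ B E)) := by
    refine (dense_relDom_relOff (B := B) (dense_relDom_re_im hd hW 1)
      (dense_relDom_re_im hd hW 1)).mono ?_
    intro p hp'
    obtain ⟨h1, h2⟩ := mem_relDom_relOff.1 hp'
    have key : ∀ x, x ∈ relDom (relLin R I 1 1) →
        x ∈ relDom (relLin R I 1 1).topologicalClosure ∧
          x ∈ relDom (relLin R I 1 (-1)).topologicalClosure := by
      intro x hx
      have h1 : ∀ c, x ∈ relDom (relLin R I 1 c).topologicalClosure := by
        intro c
        rw [relDom_relLin, ← relDom_relLin 1 c] at hx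
        obtain ⟨w, hw⟩ := mem_relDom.1 hx
        exact mem_relDom.2 ⟨w, Submodule.le_topologicalClosure _ hw⟩
      exact ⟨h1 1, h1 (-1)⟩
    refine ⟨?_, ?_⟩
    · rw [hPg]
      exact mem_relDom_relOff.2 ⟨(key _ h1).2, (key _ h2).1⟩
    · obtain ⟨q, hq⟩ := mem_relDom.1 (mem_relDom_relOff.2 ⟨(key _ h1).1, (key _ h2).2⟩)
      exact mem_relDom.2 ⟨q, hPadj hq⟩
  -- the four matrix entries of the identities `D = Re D + i Im D` and `D* = Re D - i Im D`
  have hsol : ∀ y d : E, y = ((1 / 2 : ℂ) • d + (1 / 2 : ℂ) • y) +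
      (1 : ℂ) • ((-(Complex.I * (1 : ℝ))) • ((-(Complex.I / 2)) • d + (Complex.I / 2) • y)) ∧
      y = ((1 / 2 : ℂ) • y + (1 / 2 : ℂ) • d) +
      (1 : ℂ) • ((Complex.I * (1 : ℝ)) • ((-(Complex.I / 2)) • y + (Complex.I / 2) • d)) ∧
      y = ((1 / 2 : ℂ) • y + (1 / 2 : ℂ) • d) +
      (-1 : ℂ) • ((-(Complex.I * (1 : ℝ))) • ((-(Complex.I / 2)) • y + (Complex.I / 2) • d)) ∧
      y = ((1 / 2 : ℂ) • d + (1 / 2 : ℂ) • y) +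
      (-1 : ℂ) • ((Complex.I * (1 : ℝ)) • ((-(Complex.I / 2)) • d + (Complex.I / 2) • y)) := by
    intro y d
    simp only [Complex.ofReal_one]
    refine ⟨?_, ?_, ?_, ?_⟩ <;> match_scalars <;> first
      | linear_combination (1 / 2 : ℂ) * Complex.I_sq
      | linear_combination (-(1 / 2) : ℂ) * Complex.I_sq
  have hIsq : Complex.I * (Complex.I / 2) = -(1 / 2) := by
    linear_combination (1 / 2 : ℂ) * Complex.I_sq
  -- On vectors with components in `Dom D ∩ Dom D*`, where `D₊` and `D₋` are `Re D ± Im D`, the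
  -- operators `S` and `T` are given by `[[0, Re D], [Re D, 0]]` and `[[0, -i Im D], [i Im D, 0]]`.
  have hPmem : ∀ {p q q' : Sum₂ B E}, (p, q) ∈ relOff (B := B) D.graph D.graph →
      (p, q') ∈ relOff (relAdj B D.graph) (relAdj B D.graph) →
      (p, (1 / 2 : ℂ) • q + (1 / 2 : ℂ) • q') ∈ S ∧
      (p, pairL B ((-(Complex.I * (1 : ℝ))) • ((-(Complex.I / 2)) • q.1 + (Complex.I / 2) • q'.1),
        (Complex.I * (1 : ℝ)) • ((-(Complex.I / 2)) • q.2 + (Complex.I / 2) • q'.2))) ∈ T := by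
    rintro p q q' ⟨h1, h2⟩ ⟨h3, h4⟩
    dsimp only at h1 h2 h3 h4
    have r1 := re_mem hd hW h1 h3
    have i1 := im_mem hd hW h1 h3
    have r2 := re_mem hd hW h2 h4
    have i2 := im_mem hd hW h2 h4
    set ra := (1 / 2 : ℂ) • q.1 + (1 / 2 : ℂ) • q'.1
    set ia := (-(Complex.I / 2)) • q.1 + (Complex.I / 2) • q'.1
    set rb := (1 / 2 : ℂ) • q.2 + (1 / 2 : ℂ) • q'.2
    set ib := (-(Complex.I / 2)) • q.2 + (Complex.I / 2) • q'.2
    have m1 : (p, pairL B ((1 : ℂ) • ra + (1 : ℂ) • ia, (1 : ℂ) • rb + (-1 : ℂ) • ib)) ∈ P.graph := by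
      rw [hPg]
      exact ⟨Submodule.le_topologicalClosure _ ⟨ra, ia, r1, i1, rfl⟩,
        Submodule.le_topologicalClosure _ ⟨rb, ib, r2, i2, rfl⟩⟩
    have m2 : (p, pairL B ((1 : ℂ) • ra + (-1 : ℂ) • ia, (1 : ℂ) • rb + (1 : ℂ) • ib)) ∈
        relAdj B P.graph :=
      hPadj ⟨Submodule.le_topologicalClosure _ ⟨ra, ia, r1, i1, rfl⟩,
        Submodule.le_topologicalClosure _ ⟨rb, ib, r2, i2, rfl⟩⟩
    have m3 := re_mem hreg.dense_domain hPW m1 m2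
    have m4 := im_mem hreg.dense_domain hPW m1 m2
    rw [Complex.ofReal_one, mul_one]
    constructor
    · convert m3 using 2
      refine sum_ext ?_ ?_
      · change ra = (1 / 2 : ℂ) • ((1 : ℂ) • ra + (1 : ℂ) • ia) +
          (1 / 2 : ℂ) • ((1 : ℂ) • ra + (-1 : ℂ) • ia)
        module
      · change rb = (1 / 2 : ℂ) • ((1 : ℂ) • rb + (-1 : ℂ) • ib) +
          (1 / 2 : ℂ) • ((1 : ℂ) • rb + (1 : ℂ) • ib)
        module
    · convert m4 using 2
      refine sum_ext ?_ ?_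
      · change (-Complex.I) • ia = (-(Complex.I / 2)) • ((1 : ℂ) • ra + (1 : ℂ) • ia) +
          (Complex.I / 2) • ((1 : ℂ) • ra + (-1 : ℂ) • ia)
        module
      · change Complex.I • ib = (-(Complex.I / 2)) • ((1 : ℂ) • rb + (-1 : ℂ) • ib) +
          (Complex.I / 2) • ((1 : ℂ) • rb + (1 : ℂ) • ib)
        module
  have hWmem : ∀ x ∈ D.domain ⊓ (adj B D).domain, (∃ d, (x, d) ∈ D.graph) ∧
      ∃ d', (x, d') ∈ relAdj B D.graph := by
    intro x hx
    rw [← hg]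
    exact ⟨⟨_, D.mem_graph ⟨x, hx.1⟩⟩, ⟨_, (adj B D).mem_graph ⟨x, hx.2⟩⟩⟩
  have c1 := ((hasCore_iff hD.closed).1 hc).2
  have c2 := ((hasCore_iff hD.adj.closed).1 hc').2
  rw [hg] at c2
  have eX : relComb S T 1 = relOff (relAdj B D.graph) D.graph := by
    refine hST.relComb_eq_of_core hS hT (by simp) (by simp) ?_ (Y := relOff
      (relRestrict (relAdj B D.graph) (D.domain ⊓ (adj B D).domain))
      (relRestrict D.graph (D.domain ⊓ (adj B D).domain))) ?_ ?_
    · rw [relAdj_relOff, hD.relAdj_relAdj]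
    · rintro ⟨p, q⟩ ⟨⟨h1, h2⟩, h3, h4⟩
      obtain ⟨d, hd⟩ := (hWmem _ h2).1
      obtain ⟨d', hd'⟩ := (hWmem _ h4).2
      obtain ⟨m1, m2⟩ := hPmem (mk_mem_relOff hd h3 : (p, pairL B (d, q.2)) ∈ _)
        (mk_mem_relOff h1 hd' : (p, pairL B (q.1, d')) ∈ _)
      refine ⟨_, _, m1, m2, sum_ext ?_ ?_⟩
      · exact (hsol q.1 d).1
      · exact (hsol q.2 d').2.1
    · rw [relOff_topologicalClosure, c1, c2]
  have eY : relComb S T (-1) = relOff D.graph (relAdj B D.graph) := by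
    refine hST.relComb_eq_of_core hS hT (by simp) (by simp) ?_ (Y := relOff
      (relRestrict D.graph (D.domain ⊓ (adj B D).domain))
      (relRestrict (relAdj B D.graph) (D.domain ⊓ (adj B D).domain))) ?_ ?_
    · rw [relAdj_relOff, hD.relAdj_relAdj]
    · rintro ⟨p, q⟩ ⟨⟨h1, h2⟩, h3, h4⟩
      obtain ⟨d, hd⟩ := (hWmem _ h4).1
      obtain ⟨d', hd'⟩ := (hWmem _ h2).2
      obtain ⟨m1, m2⟩ := hPmem (mk_mem_relOff h1 hd : (p, pairL B (q.1, d)) ∈ _)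
        (mk_mem_relOff hd' h3 : (p, pairL B (d', q.2)) ∈ _)
      refine ⟨_, _, m1, m2, sum_ext ?_ ?_⟩
      · exact (hsol q.1 d').2.2.1
      · exact (hsol q.2 d).2.2.2
    · rw [relOff_topologicalClosure, c1, c2]
  have hRg := rePart_graph hd hW
  have hIg := imPart_graph hd hW
  have hS0 : S = relOff (relSMul ((1 : ℝ) : ℂ) R) (relSMul ((1 : ℝ) : ℂ) R) := by
    rw [hRdef, hRg, ← relSMul_topologicalClosure (by norm_num), relSMul_relLin,
      ← relOff_topologicalClosure]
    refine le_antisymm ?_ (Submodule.topologicalClosure_minimal _ ?_ hS.isClosed)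
    · have := hST.left_le_closure hS hT (by norm_num) eX eY
      rw [relLin_relOff, relLin_comm (1 / 2) (1 / 2) (S := relAdj B D.graph)] at this
      simpa using this
    · rintro ⟨p, q⟩ ⟨⟨d₁, d₁', h1, h2, e1⟩, d₂, d₂', h3, h4, e2⟩
      dsimp only at e1 e2
      have m := (hPmem (mk_mem_relOff h1 h3 : (p, pairL B (d₁, d₂)) ∈ _)
        (mk_mem_relOff h2 h4 : (p, pairL B (d₁', d₂')) ∈ _)).1
      refine (?_ : q = (1 / 2 : ℂ) • pairL B (d₁, d₂) + (1 / 2 : ℂ) • pairL B (d₁', d₂')) ▸ m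
      refine sum_ext (e1.trans ?_) (e2.trans ?_)
      · rw [Complex.ofReal_one, one_mul]
        rfl
      · rw [Complex.ofReal_one, one_mul]
        rfl
  have hT0 : T = relOff (relSMul (-(Complex.I * (1 : ℝ))) I) (relSMul (Complex.I * (1 : ℝ)) I) := by
    rw [hIdef, hIg, ← relSMul_topologicalClosure (by simp), ← relSMul_topologicalClosure (by simp),
      relSMul_relLin, relSMul_relLin, ← relOff_topologicalClosure]
    refine le_antisymm ?_ (Submodule.topologicalClosure_minimal _ ?_ hT.isClosed)
    · have := hST.right_le_closure hS hT (by norm_num) eX eY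
      rw [relLin_relOff, relLin_comm (1 / 2) (-(1 / 2)) (S := relAdj B D.graph)] at this
      simpa [hIsq] using this
    · rintro ⟨p, q⟩ ⟨⟨d₁, d₁', h1, h2, e1⟩, d₂, d₂', h3, h4, e2⟩
      dsimp only at e1 e2
      have m := (hPmem (mk_mem_relOff h1 h3 : (p, pairL B (d₁, d₂)) ∈ _)
        (mk_mem_relOff h2 h4 : (p, pairL B (d₁', d₂')) ∈ _)).2
      refine (?_ : q = pairL B (
        (-(Complex.I * (1 : ℝ))) • ((-(Complex.I / 2)) • d₁ + (Complex.I / 2) • d₁'),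
        (Complex.I * (1 : ℝ)) • ((-(Complex.I / 2)) • d₂ + (Complex.I / 2) • d₂'))) ▸ m
      refine sum_ext (e1.trans ?_) (e2.trans ?_)
      · rw [pairL_fst]
        module
      · rw [pairL_snd]
        module
  have e1 : star ((1 : ℝ) : ℂ) = ((1 : ℝ) : ℂ) := Complex.conj_ofReal 1
  have e2 : star (-(Complex.I * (1 : ℝ))) = Complex.I * (1 : ℝ) := by simp
  rw [hS0] at hS hST
  rw [hT0] at hT hST
  have hR' := isSelfAdjRegular_of_relOff (ω := ((1 : ℝ) : ℂ)) (by norm_num) (by rwa [e1])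
  have hI' := isSelfAdjRegular_of_relOff (ω := -(Complex.I * (1 : ℝ))) (by simp) (by rwa [e2])
  exact isCartesian_of_core hD hc hc' hR' hI' (hasTwistedCommutator_of_double one_pos hR' hI' hST)

end WickToCartesian

/-! ### Recovering the Cartesian decomposition from the indefinite Kasparov module -/

section Equivalence

variable {A B E : Type*} [NonUnitalCStarAlgebra A]
  [NonUnitalCStarAlgebra B] [PartialOrder B] [StarOrderedRing B]
  [NormedAddCommGroup E] [NormedSpace ℂ E] [SMul Bᵐᵒᵖ E] [CStarModule Bᵐᵒᵖ E] [CompleteSpace E]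

variable {π : Rep A B E} {𝒜 : NonUnitalStarSubalgebra ℂ A} {D : E →ₗ.[ℂ] E}

theorem IsIndefiniteKasparovModule.isCartesianKasparov (hD : IsRegular B D)
    (hc : D.HasCore (D.domain ⊓ (adj B D).domain))
    (hc' : (adj B D).HasCore (D.domain ⊓ (adj B D).domain))
    (h : IsIndefiniteKasparovModule (sumGrading B E) π.sum 𝒜
      (offDiag B (wickPlus B D) (wickMinus B D))) : IsCartesianKasparov π 𝒜 D := by
  have hC := isCartesian_of_double hD hc hc' h.regular h.almostAntiCommuting
  have hd := hD.dense_domain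
  have hg := adj_graph (B := B) hd
  obtain ⟨hP, hQ⟩ := hC.isSelfAdjRegular_wick
  have hadj := hP.adj_offDiag hQ
  have hp := wickPlus_graph hd hC.dense_relDom
  have hm := wickMinus_graph hd hC.dense_relDom
  refine ⟨hC, fun a ha => ?_, fun a => ?_⟩
  · obtain ⟨V, hV, -, -, hcomm⟩ := h.exists_core
    obtain ⟨h1, h2⟩ := hcomm a ha
    have hle : relLin (offDiag B (wickPlus B D) (wickMinus B D)).graph
        (adj B (offDiag B (wickPlus B D) (wickMinus B D))).graph ((1 - Complex.I) / 2)
        ((1 + Complex.I) / 2) ≤ (offDiag B (adj B D) D).graph := by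
      rw [hadj, offDiag_graph, offDiag_graph, offDiag_graph, relLin_relOff, hp, hm, hg]
      rintro ⟨p, q⟩ ⟨⟨s, t, hs, ht, e⟩, s', t', hs', ht', e'⟩
      dsimp only at e e'
      refine ⟨?_, ?_⟩
      · dsimp only
        rw [e]
        exact (hC.mem_of_wick_graph hs ht).2
      · dsimp only
        rw [e', add_comm]
        exact (hC.mem_of_wick_graph ht' hs').1
    have hdom : (offDiag B (adj B D) D).domain = sumSub D.domain := by
      ext p
      change (p.1 ∈ D.domain ∧ p.2 ∈ (adj B D).domain) ↔ _
      rw [hC.domain_eq]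
      rfl
    have hcl := offDiag_isClosed (B := B) hD.adj.closed hD.closed
    -- the commutators are bounded on a core of the combination, hence on its domain
    have hV' := hV.hasCore_combination hcl hle (by rw [hdom, hC.double_domain])
    have h3 := (h1.of_combination hle h2).of_core hcl (π.sum.continuous a) hV'
    rw [hdom, Rep.sum_hom, hasBoundedCommutatorOn_offDiag_iff] at h3
    rw [hC.domain_eq]
    exact h3.symm
  · have h1 := (h.locallyCompact a).isCompactRel
    rw [hadj, offDiag_graph, offDiag_graph, Rep.sum_hom, isCompactRel_relOff_iff] at h1
    refine h1.1.of_combination (fun x s s' hs hs' => hQ.eq_of_mem hs hs')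
      (fun x s s' hs hs' => hP.eq_of_mem hs hs') ((1 + Complex.I) / 2) ((1 - Complex.I) / 2)
      ((1 - Complex.I) / 2) ((1 + Complex.I) / 2) fun x t t' ht ht' => ?_
    rw [hp, hm]
    exact ⟨Submodule.le_topologicalClosure _ (hC.wick_mem ht ht').2,
      Submodule.le_topologicalClosure _ (hC.wick_mem ht ht').1⟩

end Equivalence

end HilbertModule

end

open HilbertModule in
theorem mainTheorem2 {A B E : Type*} [NonUnitalCStarAlgebra A]
    [NonUnitalCStarAlgebra B] [PartialOrder B] [StarOrderedRing B]
    [NormedAddCommGroup E] [NormedSpace ℂ E] [CompleteSpace E]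
    [SMul Bᵐᵒᵖ E] [CStarModule Bᵐᵒᵖ E]
    (hE : IsCountablyGenerated B E)
    (π : Rep A B E)
    (𝒜 : NonUnitalStarSubalgebra ℂ A)
    (h𝒜 : TopologicalSpace.IsSeparable (𝒜 : Set A)) (h𝒜_dense : Dense (𝒜 : Set A))
    (D : E →ₗ.[ℂ] E) (hD : IsRegular B D) :
    List.TFAE [
      IsOddIndefiniteKasparovModule π 𝒜 D,
      (D.HasCore (D.domain ⊓ (adj B D).domain) ∧
          (adj B D).HasCore (D.domain ⊓ (adj B D).domain)) ∧
        IsIndefiniteKasparovModule (sumGrading B E) π.sum 𝒜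
          (offDiag B (wickPlus B D) (wickMinus B D)),
      IsPairOfKasparovModules (sumGrading B E) π.sum 𝒜
        (offDiag B (adj B D) D) (offDiag B D (adj B D))] := by
  have hdata : IsBimoduleData π 𝒜 := ⟨hE, h𝒜, h𝒜_dense⟩
  tfae_have 1 → 2 := fun h =>
    ⟨h.isCartesianKasparov.cartesian.hasCore,
      h.isCartesianKasparov.isIndefiniteKasparovModule hdata⟩
  tfae_have 2 → 3 := fun h =>
    (h.2.isCartesianKasparov hD h.1.1 h.1.2).isPairOfKasparovModules hdata
  tfae_have 3 → 1 := fun h => (h.isCartesianKasparov hD).isOddIndefiniteKasparovModule hdata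
  tfae_finish
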